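/- Let $M$ be a closed Riemannian manifold and let $f:M\to M$ be a $C^1$ partially hyperbolic diffeomorphism with one-dimensional center. That is, there is a continuous $Df$-invariant splitting $TM=E^s\oplus E^c\oplus E^u$ with $E^s,E^u$ non-trivial and $\dim E^c=1$, and there are constants $\lambda\in(0,1)$ and $C>0$, such that for every $x\in M$ and $n\ge 0$ $$\|Df^n|_{E^s(x)}\|<C\lambda^n,\qquad \|Df^{-n}|_{E^u(x)}\|<C\lambda^n,$$ $$\|Df|_{E^s(x)}\|<m(Df|_{E^c(x)})\le\|Df|_{E^c(x)}\|<m(Df|_{E^u(x)}),$$ where $\|T\|$ and $m(T)$ denote the maximum and the minimum of $\|Tv\|$ over unit vectors $v$. Suppose that $f$ is dynamically coherent: there are $f$-invariant foliations $\mathcal W^{cs}$ and $\mathcal W^{cu}$ with $C^1$ leaves tangent to $E^s\oplus E^c$ and $E^c\oplus E^u$, respectively. Let $\mathcal W^c=\mathcal W^{cs}\cap\mathcal W^{cu}$ be the center foliation, whose leaves are the connected components (for the leaf topology) of the intersections of leaves of $\mathcal W^{cs}$ and $\mathcal W^{cu}$. Let $\mathcal W^c_R(x)$ be the ball with center $x$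 and radius $R$ in the leaf $\mathcal W^c(x)$ for its intrinsic metric. Let $\mathcal W^u$ be the unstable foliation, that is, the foliation to which $E^u$ uniquely integrates; its leaf through $x$ consists of the points that can be joined to $x$ by a $C^1$ curve tangent to $E^u$. A minimal unstable lamination is a non-empty compact $\mathcal W^u$-saturated set $A\subset M$ such that $\overline{\mathcal W^u(x)}=A$ for every $x\in A$. Suppose that $\mathcal W^{cs}$ is minimal (every leaf is dense in $M$) and that $f$ acts quasi-isometrically in the future on $\mathcal W^c$: there are constants $l,L_0>0$ such that $f^n(\mathcal W^c_l(x))\subset\mathcal W^c_{L_0}(f^n(x))$ for every $x\in M$ and $n\ge0$. Then there exists $L>0$ such that every minimal unstable lamination $A$ satisfies $\mathcal W^c_L(x)\cap A\neq\emptyset$ for every $x\in M$. In particular, $A$ intersects every leaf of $\mathcal W^c$. -/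

import Mathlib

open Set Filter Topology Manifold Bundle
open scoped ContDiff

noncomputable section

namespace PartialHyperbolicity

/-- A family of linear subspaces of the tangent spaces of an `n`-manifold. -/
abbrev Distribution (n : ℕ) (M : Type*) [TopologicalSpace M]
    [ChartedSpace (EuclideanSpace ℝ (Fin n)) M] :=
  ∀ x : M, Submodule ℝ (TangentSpace (𝓡 n) x)

/-- A topological foliation of dimension `d` of an `n`-manifold, given by foliation charts onto
`ℝ^d × ℝ^(n-d)`. The plaques of a chart `φ` are the sets `(φ ·).2 = const`, and on the overlap of
two charts the plaques agree locally. -/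
structure Foliation (n d : ℕ) (M : Type*) [TopologicalSpace M] where
  /-- the foliation charts -/
  charts : Set (OpenPartialHomeomorph M
    (EuclideanSpace ℝ (Fin d) × EuclideanSpace ℝ (Fin (n - d))))
  target_eq : ∀ φ ∈ charts, φ.target = univ
  cover : ∀ x : M, ∃ φ ∈ charts, x ∈ φ.source
  compat : ∀ φ ∈ charts, ∀ ψ ∈ charts, ∀ p ∈ φ.source ∩ ψ.source,
    ∀ᶠ q in 𝓝 p ×ˢ 𝓝 p, ((φ q.1).2 = (φ q.2).2 ↔ (ψ q.1).2 = (ψ q.2).2)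

namespace Foliation

section Topological

variable {n d : ℕ} {M : Type*} [TopologicalSpace M]

/-- `x` and `y` lie on a common plaque. -/
def SamePlaque (W : Foliation n d M) (x y : M) : Prop :=
  ∃ φ ∈ W.charts, x ∈ φ.source ∧ y ∈ φ.source ∧ (φ x).2 = (φ y).2

/-- The leaf through `x`: all points joined to `x` by a finite chain of plaques. -/
def leaf (W : Foliation n d M) (x : M) : Set M :=
  {y | Relation.EqvGen W.SamePlaque x y}

/-- The foliation is minimal: every leaf is dense. -/
def IsMinimal (W : Foliation n d M) : Prop :=
  ∀ x : M, Dense (W.leaf x)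

/-- The foliation is invariant under `f`: every leaf is mapped onto a leaf. -/
def IsInvariant (W : Foliation n d M) (f : M → M) : Prop :=
  ∀ x : M, f '' W.leaf x = W.leaf (f x)

/-- The curve `γ`, restricted to `[0,1]`, stays in one leaf and is continuous for the leaf
topology: it is locally contained in a plaque. -/
def IsLeafCurve (W : Foliation n d M) (γ : ℝ → M) : Prop :=
  ContinuousOn γ (Icc 0 1) ∧
    ∀ t ∈ Icc (0 : ℝ) 1, ∀ φ ∈ W.charts, γ t ∈ φ.source →
      ∀ᶠ s in 𝓝[Icc 0 1] t, (φ (γ s)).2 = (φ (γ t)).2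

end Topological

section Smooth

variable {n d : ℕ} {M : Type*} [TopologicalSpace M] [ChartedSpace (EuclideanSpace ℝ (Fin n)) M]

/-- The leaves are `C^1` immersed submanifolds tangent to the distribution `E`: every plaque is
parametrized by a `C^1` immersion whose derivative has image `E`. -/
def IsTangentTo (W : Foliation n d M) (E : Distribution n M) : Prop :=
  ∀ φ ∈ W.charts, ∀ t : EuclideanSpace ℝ (Fin (n - d)),
    ContMDiff (𝓡 d) (𝓡 n) 1 (fun a : EuclideanSpace ℝ (Fin d) => φ.symm (a, t)) ∧
    ∀ a : EuclideanSpace ℝ (Fin d),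
      Function.Injective
        (mfderiv (𝓡 d) (𝓡 n) (fun a : EuclideanSpace ℝ (Fin d) => φ.symm (a, t)) a) ∧
      LinearMap.range
        (mfderiv (𝓡 d) (𝓡 n)
          (fun a : EuclideanSpace ℝ (Fin d) => φ.symm (a, t)) a).toLinearMap
        = E (φ.symm (a, t))

end Smooth

end Foliation

section Manifold

variable {n : ℕ} {M : Type*} [TopologicalSpace M] [ChartedSpace (EuclideanSpace ℝ (Fin n)) M]

/-- The distribution `E` is a continuous subbundle of the tangent bundle: near every point it is
spanned by continuous linearly independent vector fields. -/
def IsContinuousSubbundle [IsManifold (𝓡 n) 1 M] (E : Distribution n M) : Prop :=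
  ∀ x₀ : M, ∃ U ∈ 𝓝 x₀, ∃ (k : ℕ) (X : Fin k → ∀ x : M, TangentSpace (𝓡 n) x),
    (∀ i, ContinuousOn (fun x => (⟨x, X i x⟩ : TangentBundle (𝓡 n) M)) U) ∧
    ∀ x ∈ U, LinearIndependent ℝ (fun i => X i x) ∧
      Submodule.span ℝ (range fun i => X i x) = E x

/-- `γ`, restricted to `[0,1]`, is a `C^1` curve. -/
def IsC1Curve (γ : ℝ → M) : Prop :=
  ContMDiffOn 𝓘(ℝ) (𝓡 n) 1 γ (Icc 0 1)

/-- `γ`, restricted to `[0,1]`, is everywhere tangent to `E`. -/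
def IsCurveTangentTo (E : Distribution n M) (γ : ℝ → M) : Prop :=
  ∀ t ∈ Icc (0 : ℝ) 1, mfderivWithin 𝓘(ℝ) (𝓡 n) γ (Icc 0 1) t (1 : ℝ) ∈ E (γ t)

/-- The set of points that can be joined to `x` by a `C^1` curve tangent to `E`. For a uniquely
integrable bundle, such as the unstable bundle `E^u` of a partially hyperbolic diffeomorphism,
this is the leaf through `x` of the foliation tangent to `E`. -/
def integralLeaf (E : Distribution n M) (x : M) : Set M :=
  {y | ∃ γ : ℝ → M, IsC1Curve (n := n) γ ∧ IsCurveTangentTo E γ ∧ γ 0 = x ∧ γ 1 = y}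

/-- A minimal unstable lamination: a non-empty compact set, saturated by unstable leaves, in which
every unstable leaf is dense. -/
structure IsMinimalUnstableLamination (Eu : Distribution n M) (A : Set M) : Prop where
  nonempty : A.Nonempty
  isCompact : IsCompact A
  saturated : ∀ x ∈ A, integralLeaf Eu x ⊆ A
  closure_eq : ∀ x ∈ A, closure (integralLeaf Eu x) = A

/-- A center curve: a `C^1` curve inside a leaf of the foliation `W^c = W^cs ∩ W^cu`, whose leaves
are the connected components, for the leaf topologies, of the intersections of a leaf of `W^cs`
with a leaf of `W^cu`. -/
structure IsCenterCurve {dcs dcu : ℕ} (Wcs : Foliation n dcs M) (Wcu : Foliation n dcu M)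
    (γ : ℝ → M) : Prop where
  contMDiff : IsC1Curve (n := n) γ
  leaf_cs : Wcs.IsLeafCurve γ
  leaf_cu : Wcu.IsLeafCurve γ

/-- The center leaf `W^c(x)`. -/
def centerLeaf {dcs dcu : ℕ} (Wcs : Foliation n dcs M) (Wcu : Foliation n dcu M) (x : M) :
    Set M :=
  {y | ∃ γ : ℝ → M, IsCenterCurve Wcs Wcu γ ∧ γ 0 = x ∧ γ 1 = y}

variable [RiemannianBundle (fun x : M => TangentSpace (𝓡 n) x)]

/-- The ball `W^c_R(x)` of center `x` and radius `R` in the center leaf of `x`, for the intrinsic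
distance of the leaf (the infimum of the lengths of the `C^1` curves in the leaf). -/
def centerBall {dcs dcu : ℕ} (Wcs : Foliation n dcs M) (Wcu : Foliation n dcu M) (R : ℝ) (x : M) :
    Set M :=
  {y | ∃ γ : ℝ → M, IsCenterCurve Wcs Wcu γ ∧ γ 0 = x ∧ γ 1 = y ∧
    pathELength (𝓡 n) γ 0 1 < ENNReal.ofReal R}

/-- `f` acts quasi-isometrically in the future on the center foliation. -/
def ActsQuasiIsometricallyInFuture {dcs dcu : ℕ} (Wcs : Foliation n dcs M)
    (Wcu : Foliation n dcu M) (f : M → M) : Prop :=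
  ∃ l > (0 : ℝ), ∃ L > (0 : ℝ), ∀ (x : M) (m : ℕ),
    f^[m] '' centerBall Wcs Wcu l x ⊆ centerBall Wcs Wcu L (f^[m] x)

/-- `f` is a (strongly) partially hyperbolic `C^1` diffeomorphism with invariant continuous
splitting `TM = Es ⊕ Ec ⊕ Eu`. -/
structure IsPartiallyHyperbolic [IsManifold (𝓡 n) 1 M] (f : M ≃ₘ^1⟮𝓡 n, 𝓡 n⟯ M)
    (Es Ec Eu : Distribution n M) : Prop where
  continuous_s : IsContinuousSubbundle Es
  continuous_c : IsContinuousSubbundle Ec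
  continuous_u : IsContinuousSubbundle Eu
  disjoint_s_c : ∀ x, Disjoint (Es x) (Ec x)
  disjoint_sc_u : ∀ x, Disjoint (Es x ⊔ Ec x) (Eu x)
  sup_eq_top : ∀ x, Es x ⊔ Ec x ⊔ Eu x = ⊤
  nontrivial_s : ∀ x, Es x ≠ ⊥
  nontrivial_u : ∀ x, Eu x ≠ ⊥
  invariant_s : ∀ x, (Es x).map (mfderiv (𝓡 n) (𝓡 n) f x).toLinearMap = Es (f x)
  invariant_c : ∀ x, (Ec x).map (mfderiv (𝓡 n) (𝓡 n) f x).toLinearMap = Ec (f x)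
  invariant_u : ∀ x, (Eu x).map (mfderiv (𝓡 n) (𝓡 n) f x).toLinearMap = Eu (f x)
  hyperbolic : ∃ lam ∈ Ioo (0 : ℝ) 1, ∃ C > (0 : ℝ), ∀ (x : M) (m : ℕ),
    (∀ v ∈ Es x, ‖v‖ = 1 → ‖mfderiv (𝓡 n) (𝓡 n) (f^[m]) x v‖ < C * lam ^ m) ∧
    (∀ v ∈ Eu x, ‖v‖ = 1 → ‖mfderiv (𝓡 n) (𝓡 n) (f.symm^[m]) x v‖ < C * lam ^ m)
  dominated_s_c : ∀ x, ∀ v ∈ Es x, ∀ w ∈ Ec x, ‖v‖ = 1 → ‖w‖ = 1 →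
    ‖mfderiv (𝓡 n) (𝓡 n) f x v‖ < ‖mfderiv (𝓡 n) (𝓡 n) f x w‖
  dominated_c_u : ∀ x, ∀ v ∈ Ec x, ∀ w ∈ Eu x, ‖v‖ = 1 → ‖w‖ = 1 →
    ‖mfderiv (𝓡 n) (𝓡 n) f x v‖ < ‖mfderiv (𝓡 n) (𝓡 n) f x w‖

/-- `f` is dynamically coherent with center-stable foliation `Wcs` and center-unstable foliation
`Wcu`: these are `f`-invariant foliations tangent to `Es ⊕ Ec` and `Ec ⊕ Eu`. -/
structure IsDynamicallyCoherent {dcs dcu : ℕ} (f : M ≃ₘ^1⟮𝓡 n, 𝓡 n⟯ M)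
    (Es Ec Eu : Distribution n M) (Wcs : Foliation n dcs M) (Wcu : Foliation n dcu M) : Prop where
  tangent_cs : Wcs.IsTangentTo (fun x => Es x ⊔ Ec x)
  tangent_cu : Wcu.IsTangentTo (fun x => Ec x ⊔ Eu x)
  invariant_cs : Wcs.IsInvariant f
  invariant_cu : Wcu.IsInvariant f

end Manifold

end PartialHyperbolicity

end

noncomputable section

namespace PartialHyperbolicity

open Metric

/-! ### Penalised minimisation -/

/-- If the nonnegative gap `F` can always be decreased at a rate larger than `κ` inside a ball, it
vanishes somewhere in that ball. -/
theorem exists_eq_zero_of_decrease {X : Type*} [PseudoMetricSpace X] {Z : Set X} {z₀ : X}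
    {r κ : ℝ} {F : X → ℝ} (hκ : 0 < κ) (hz₀ : z₀ ∈ Z) (hZ : IsCompact (Z ∩ closedBall z₀ r))
    (hF : ContinuousOn F (Z ∩ closedBall z₀ r)) (hF0 : ∀ z, 0 ≤ F z) (hr : F z₀ < κ * r)
    (hdec : ∀ z ∈ Z, z ∈ ball z₀ r → F z ≠ 0 → ∃ z' ∈ Z, F z' + κ * dist z z' < F z) :
    ∃ z ∈ Z, z ∈ closedBall z₀ r ∧ F z = 0 := by
  have hr0 : 0 < r := by
    by_contra h
    have : κ * r ≤ 0 := mul_nonpos_of_nonneg_of_nonpos hκ.le (not_lt.mp h)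
    linarith [hF0 z₀]
  have hne : (Z ∩ closedBall z₀ r).Nonempty := ⟨z₀, hz₀, mem_closedBall_self hr0.le⟩
  -- The penalty has two roles. Together with `hr` it keeps the minimiser inside the open ball, and
  -- by the triangle inequality a decrease of `F` at rate above `κ` outweighs the growth of the
  -- penalty.
  obtain ⟨z, hz, hmin⟩ := hZ.exists_isMinOn hne
    (f := fun z => F z + κ * dist z z₀) (hF.add (by fun_prop))
  have h1 : F z + κ * dist z z₀ ≤ F z₀ := by
    have := hmin (show z₀ ∈ Z ∩ closedBall z₀ r from ⟨hz₀, mem_closedBall_self hr0.le⟩)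
    simpa using this
  refine ⟨z, hz.1, hz.2, ?_⟩
  by_contra h
  have hzb : z ∈ ball z₀ r := by
    rw [mem_ball]
    have := hF0 z
    exact lt_of_mul_lt_mul_left (by linarith) hκ.le
  obtain ⟨z', hz', hlt⟩ := hdec z hz.1 hzb h
  have htri : κ * dist z' z₀ ≤ κ * dist z z' + κ * dist z z₀ := by
    rw [← mul_add]
    refine mul_le_mul_of_nonneg_left ?_ hκ.le
    rw [dist_comm z z']
    exact dist_triangle _ _ _
  have hz'b : z' ∈ closedBall z₀ r := by
    rw [mem_closedBall]
    have := hF0 z'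
    exact (lt_of_mul_lt_mul_left (a := κ) (by linarith) hκ.le).le
  have : F z + κ * dist z z₀ ≤ F z' + κ * dist z' z₀ := hmin ⟨hz', hz'b⟩
  linarith

/-- Two closed sets with first-order moves in complementary directions intersect, if they come
close enough to each other. The second coordinate of `A` records a cost of the moves. -/
theorem exists_mem_inter_of_moves {F : Type*} [NormedAddCommGroup F] [NormedSpace ℝ F]
    [ProperSpace F] {A : Set (F × ℝ)} {B : Set F} {y₀ : F} {r ρ K ε : ℝ}
    (hA : IsClosed (A ∩ closedBall y₀ r ×ˢ univ)) (hB : IsClosed (B ∩ closedBall y₀ r))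
    (P Q : F → F) (hK : 0 ≤ K) (hP : ∀ w, ‖P w‖ ≤ K * ‖w‖) (hQ : ∀ w, ‖Q w‖ ≤ K * ‖w‖)
    (hε : 0 ≤ ε) (hεK : ε * K ≤ 1 / 8)
    (hPQ : ∀ a m b, (a, m) ∈ A → b ∈ B → a ∈ ball y₀ r → b ∈ ball y₀ r →
      ‖(b - a) - P (b - a) - Q (b - a)‖ ≤ 1 / 8 * ‖b - a‖)
    (moveA : ∀ a m, (a, m) ∈ A → a ∈ ball y₀ r → ∀ w, ∀ e > 0, ∀ᶠ h in 𝓝[>] (0 : ℝ),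
      ∃ a', (a', m + h * ‖P w‖) ∈ A ∧ ‖a' - a - h • P w‖ ≤ h * (ε * ‖P w‖ + e))
    (moveB : ∀ b ∈ B, b ∈ ball y₀ r → ∀ w, ∀ e > 0, ∀ᶠ h in 𝓝[>] (0 : ℝ),
      ∃ b' ∈ B, ‖b' - b + h • Q w‖ ≤ h * (ε * ‖Q w‖ + e))
    {a₀ b₀ : F} {m₀ : ℝ} (ha₀ : (a₀, m₀) ∈ A) (hb₀ : b₀ ∈ B)
    (ha₀r : dist a₀ y₀ < r / 2) (hb₀r : dist b₀ y₀ < r / 2) (hρr : ρ ≤ r / 2)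
    (hρ : 4 * (K + 1) * ‖b₀ - a₀‖ < ρ) :
    ∃ a m, (a, m) ∈ A ∧ a ∈ B ∧ dist a a₀ ≤ ρ ∧ m ≤ m₀ + ρ := by
  -- The cost coordinate is part of the point, so the sup metric of the product also bounds the
  -- final cost by `m₀ + ρ`.
  set Z : Set ((F × ℝ) × F) := {z | z.1 ∈ A ∧ z.2 ∈ B} with hZdef
  set z₀ : (F × ℝ) × F := ((a₀, m₀), b₀) with hz₀def
  -- A move of parameter `h` displaces every coordinate by at most `h * ((K + 1) * ‖w‖)`, so with
  -- this `κ` the penalty costs at most `h * ‖w‖ / 4`.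
  set κ : ℝ := 1 / (4 * (K + 1)) with hκdef
  have hκ : 0 < κ := by positivity
  have hin : ∀ z : (F × ℝ) × F, z ∈ closedBall z₀ ρ →
      z.1.1 ∈ ball y₀ r ∧ z.2 ∈ ball y₀ r := by
    intro z hz
    rw [mem_closedBall, Prod.dist_eq, Prod.dist_eq] at hz
    simp only [max_le_iff, hz₀def] at hz
    constructor
    · rw [mem_ball]; linarith [dist_triangle z.1.1 a₀ y₀, hz.1.1]
    · rw [mem_ball]; linarith [dist_triangle z.2 b₀ y₀, hz.2]
  have hcomp : IsCompact (Z ∩ closedBall z₀ ρ) := by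
    have hcl : IsClosed ({z : (F × ℝ) × F | z.1 ∈ A ∩ closedBall y₀ r ×ˢ univ ∧
        z.2 ∈ B ∩ closedBall y₀ r} ∩ closedBall z₀ ρ) :=
      ((hA.preimage continuous_fst).inter (hB.preimage continuous_snd)).inter isClosed_closedBall
    have heq : Z ∩ closedBall z₀ ρ = {z : (F × ℝ) × F | z.1 ∈ A ∩ closedBall y₀ r ×ˢ univ ∧
        z.2 ∈ B ∩ closedBall y₀ r} ∩ closedBall z₀ ρ := by
      ext z
      constructor
      · rintro ⟨⟨h1, h2⟩, h3⟩
        exact ⟨⟨⟨h1, ball_subset_closedBall (hin z h3).1, trivial⟩, h2,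
          ball_subset_closedBall (hin z h3).2⟩, h3⟩
      · rintro ⟨⟨h1, h2⟩, h3⟩
        exact ⟨⟨h1.1, h2.1⟩, h3⟩
    rw [heq]
    exact (isCompact_closedBall z₀ ρ).of_isClosed_subset hcl inter_subset_right
  obtain ⟨z, hz, hzb, hz0⟩ := exists_eq_zero_of_decrease (Z := Z) (z₀ := z₀) (r := ρ)
    (F := fun z => ‖z.2 - z.1.1‖) hκ ⟨ha₀, hb₀⟩ hcomp (by fun_prop) (fun z => norm_nonneg _)
    (by
      rw [hκdef, one_div, inv_mul_eq_div, lt_div_iff₀ (by positivity)]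
      linarith [hρ, mul_comm (4 * (K + 1)) ‖b₀ - a₀‖])
    (by
      rintro ⟨⟨a, m⟩, b⟩ ⟨haA, hbB⟩ hzball hne
      dsimp only at haA hbB hne ⊢
      obtain ⟨har, hbr⟩ := hin _ (ball_subset_closedBall hzball)
      dsimp only at har hbr
      set w := b - a with hw
      have hwpos : 0 < ‖w‖ := lt_of_le_of_ne (norm_nonneg _) (Ne.symm hne)
      obtain ⟨h, ⟨⟨a', ha', ha'n⟩, ⟨b', hb', hb'n⟩⟩, hh⟩ :=
        (((moveA a m haA har w (‖w‖ / 32) (by positivity)).and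
          (moveB b hbB hbr w (‖w‖ / 32) (by positivity))).and
          (Ioo_mem_nhdsGT (show (0 : ℝ) < 1 by norm_num))).exists
      refine ⟨((a', m + h * ‖P w‖), b'), ⟨ha', hb'⟩, ?_⟩
      have h0 : 0 < h := hh.1
      have hPw := hP w
      have hQw := hQ w
      have hεP : ε * ‖P w‖ ≤ 1 / 8 * ‖w‖ :=
        (mul_le_mul_of_nonneg_left hPw hε).trans (by rw [← mul_assoc]; gcongr)
      have hεQ : ε * ‖Q w‖ ≤ 1 / 8 * ‖w‖ :=
        (mul_le_mul_of_nonneg_left hQw hε).trans (by rw [← mul_assoc]; gcongr)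
      have hpq := hPQ a m b haA hbB har hbr
      rw [← hw] at hpq
      have e1 : ‖a' - a - h • P w‖ ≤ h * (5 / 32 * ‖w‖) :=
        ha'n.trans (mul_le_mul_of_nonneg_left (by linarith) h0.le)
      have e2 : ‖b' - b + h • Q w‖ ≤ h * (5 / 32 * ‖w‖) :=
        hb'n.trans (mul_le_mul_of_nonneg_left (by linarith) h0.le)
      -- Moving `a` along `P w` and `b` along `-Q w` would close a fraction `h` of the gap. The
      -- errors are `1/8` from the defect of `P + Q` and `5/32 = 1/8 + 1/32` from each move, in
      -- total `7/16`. The net gain `9/16` exceeds the penalty `1/4`.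
      have gap : ‖b' - a'‖ ≤ (1 - h) * ‖w‖ + h * (7 / 16 * ‖w‖) := by
        have : b' - a' = (1 - h) • w + h • (w - P w - Q w) + (b' - b + h • Q w)
            - (a' - a - h • P w) := by
          rw [hw]; module
        rw [this]
        refine (norm_sub_le _ _).trans ?_
        refine (add_le_add_left (norm_add_le _ _) _).trans ?_
        refine (add_le_add_left (add_le_add_left (norm_add_le _ _) _) _).trans ?_
        rw [norm_smul, norm_smul, Real.norm_of_nonneg (by linarith [hh.2] : 0 ≤ 1 - h),
          Real.norm_of_nonneg h0.le]
        have := mul_le_mul_of_nonneg_left hpq h0.le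
        linarith
      have d1 : dist a a' ≤ h * ((K + 1) * ‖w‖) := by
        rw [dist_comm, dist_eq_norm]
        have : a' - a = (a' - a - h • P w) + h • P w := by abel
        rw [this]
        refine (norm_add_le _ _).trans ?_
        rw [norm_smul, Real.norm_of_nonneg h0.le]
        have := mul_le_mul_of_nonneg_left hPw h0.le
        nlinarith [mul_pos h0 hwpos]
      have d2 : dist b b' ≤ h * ((K + 1) * ‖w‖) := by
        rw [dist_comm, dist_eq_norm]
        have : b' - b = (b' - b + h • Q w) - h • Q w := by abel
        rw [this]
        refine (norm_sub_le _ _).trans ?_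
        rw [norm_smul, Real.norm_of_nonneg h0.le]
        have := mul_le_mul_of_nonneg_left hQw h0.le
        nlinarith [mul_pos h0 hwpos]
      have d3 : dist m (m + h * ‖P w‖) ≤ h * ((K + 1) * ‖w‖) := by
        rw [Real.dist_eq, sub_add_cancel_left, abs_neg, abs_of_nonneg (by positivity)]
        refine mul_le_mul_of_nonneg_left (hPw.trans ?_) h0.le
        gcongr; linarith
      have hd : κ * dist (((a, m), b) : (F × ℝ) × F) ((a', m + h * ‖P w‖), b')
          ≤ h * (‖w‖ / 4) := by
        have : dist (((a, m), b) : (F × ℝ) × F) ((a', m + h * ‖P w‖), b')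
            ≤ h * ((K + 1) * ‖w‖) := by
          rw [Prod.dist_eq, Prod.dist_eq]
          exact max_le (max_le d1 d3) d2
        refine (mul_le_mul_of_nonneg_left this hκ.le).trans (le_of_eq ?_)
        rw [hκdef]; field_simp
      have := mul_pos h0 hwpos
      linarith)
  rw [norm_eq_zero, sub_eq_zero] at hz0
  rw [mem_closedBall, Prod.dist_eq, Prod.dist_eq] at hzb
  simp only [max_le_iff, hz₀def, Real.dist_eq] at hzb
  refine ⟨z.1.1, z.1.2, hz.1, hz0 ▸ hz.2, hzb.1.1, ?_⟩
  linarith [le_abs_self (z.1.2 - m₀), hzb.1.2]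

/-! ### The Peano existence theorem -/

/-- The stable and unstable directions depend only continuously on the point, so curves tangent to
them have to come from existence without uniqueness. The Picard–Lindelöf solutions of `C^1`
approximations are uniformly Lipschitz, and their pointwise limit along an ultrafilter solves the
equation. -/
theorem exists_hasDerivWithinAt_of_continuousOn {F : Type*} [NormedAddCommGroup F]
    [NormedSpace ℝ F] [FiniteDimensional ℝ F] {X : F → F} {O : Set F} (hO : IsOpen O)
    (hX : ContinuousOn X O) {a : F} (ha : a ∈ O) :
    ∃ h₀ > (0 : ℝ), ∃ σ : ℝ → F, σ 0 = a ∧ ∀ t ∈ Icc 0 h₀, σ t ∈ O ∧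
      HasDerivWithinAt σ (X (σ t)) (Icc 0 h₀) t := by
  have : ProperSpace F := FiniteDimensional.proper ℝ F
  have : CompleteSpace F := FiniteDimensional.complete ℝ F
  obtain ⟨r, hr, hrO⟩ := Metric.nhds_basis_closedBall.mem_iff.1 (hO.mem_nhds ha)
  -- extend the vector field continuously by composing with a retraction on the ball
  set R : F → F := fun x => a + (r / max r ‖x - a‖) • (x - a) with hR
  have hmax : ∀ x, 0 < max r ‖x - a‖ := fun x => lt_max_of_lt_left hr
  have hRc : Continuous R := by
    refine continuous_const.add (Continuous.smul ?_ (by fun_prop))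
    exact continuous_const.div (by fun_prop) (fun x => (hmax x).ne')
  have hRmem : ∀ x, R x ∈ closedBall a r := by
    intro x
    rw [mem_closedBall, dist_eq_norm, hR]
    simp only [add_sub_cancel_left, norm_smul, norm_div, Real.norm_of_nonneg hr.le,
      Real.norm_of_nonneg (hmax x).le]
    rw [div_mul_eq_mul_div, div_le_iff₀ (hmax x)]
    exact mul_le_mul_of_nonneg_left (le_max_right _ _) hr.le
  have hRid : ∀ x ∈ closedBall a r, R x = x := by
    intro x hx
    rw [mem_closedBall, dist_eq_norm] at hx
    simp [hR, max_eq_left hx, div_self hr.ne']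
  have hXR : Continuous (X ∘ R) :=
    (hX.mono hrO).comp_continuous hRc hRmem
  obtain ⟨C, hC⟩ := ((isCompact_closedBall a r).image_of_continuousOn (hX.mono hrO)).isBounded
    |>.exists_norm_le
  have hC0 : 0 ≤ C := (norm_nonneg _).trans (hC _ ⟨a, mem_closedBall_self hr.le, rfl⟩)
  -- The approximations differ from the extended field by less than `1 / (k + 1) ≤ 1`, hence one
  -- speed bound, and one time interval `r / L`, serves them all.
  set L : ℝ := C + 1 with hL
  have hLpos : 0 < L := by positivity
  set h₀ : ℝ := r / L with hh₀
  have hh₀pos : 0 < h₀ := by positivity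
  -- smooth approximations and their integral curves
  have key : ∀ k : ℕ, ∃ g : F → F, (∀ x ∈ closedBall a r, dist (g x) (X x) < 1 / (k + 1)) ∧
      ∃ σ : ℝ → F, σ 0 = a ∧ (∀ t ∈ Icc 0 h₀, σ t ∈ closedBall a r) ∧
      (∀ s ∈ Icc 0 h₀, ∀ t ∈ Icc 0 h₀, ‖σ t - σ s‖ ≤ L * ‖t - s‖) ∧
      ∀ t ∈ Icc 0 h₀, HasDerivWithinAt σ (g (σ t)) (Icc 0 h₀) t := by
    intro k
    have hk : (0 : ℝ) < 1 / (k + 1) := by positivity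
    obtain ⟨g, hg, hgd, -⟩ := hXR.exists_contDiff_approx (ε := fun _ => 1 / ((k : ℝ) + 1)) 1
      continuous_const (fun _ => hk)
    have hgX : ∀ x ∈ closedBall a r, dist (g x) (X x) < 1 / (k + 1) := by
      intro x hx
      have := hgd x
      rwa [Function.comp_apply, hRid x hx] at this
    refine ⟨g, hgX, ?_⟩
    obtain ⟨Kl, hKl⟩ := (hg.locallyLipschitz.locallyLipschitzOn (s := closedBall a r))
      |>.exists_lipschitzOnWith_of_compact (isCompact_closedBall a r)
    have hgb : ∀ x, ‖g x‖ ≤ L := by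
      intro x
      have h1 := hgd x
      have h2 : (1 : ℝ) / (k + 1) ≤ 1 := by
        rw [div_le_one (by positivity)]; linarith [(Nat.cast_nonneg k : (0 : ℝ) ≤ k)]
      have h3 := hC _ ⟨R x, hRmem x, rfl⟩
      rw [dist_eq_norm, Function.comp_apply] at h1
      have : g x = (g x - X (R x)) + X (R x) := by abel
      rw [this]
      exact (norm_add_le _ _).trans (by rw [hL]; linarith)
    have hPL : IsPicardLindelof (fun _ : ℝ => g) (tmin := 0) (tmax := h₀)
        ⟨0, left_mem_Icc.2 hh₀pos.le⟩ a ⟨r, hr.le⟩ 0 ⟨L, hLpos.le⟩ Kl := by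
      refine ⟨fun t _ => hKl, fun x _ => continuousOn_const, fun t _ x _ => hgb x, ?_⟩
      simp only [sub_zero, sub_self, max_eq_left hh₀pos.le]
      change L * h₀ ≤ r - 0
      rw [hh₀]; field_simp; linarith
    obtain ⟨σ, hσ0, hσ⟩ := hPL.exists_eq_forall_mem_Icc_hasDerivWithinAt₀
    have hlip : ∀ s ∈ Icc 0 h₀, ∀ t ∈ Icc 0 h₀, ‖σ t - σ s‖ ≤ L * ‖t - s‖ := fun s hs t ht =>
      (convex_Icc 0 h₀).norm_image_sub_le_of_norm_hasDerivWithin_le hσ (fun x _ => hgb _) hs ht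
    refine ⟨σ, hσ0, ?_, hlip, hσ⟩
    intro t ht
    have := hlip 0 (left_mem_Icc.2 hh₀pos.le) t ht
    rw [hσ0, sub_zero, Real.norm_of_nonneg ht.1] at this
    rw [mem_closedBall, dist_eq_norm]
    refine this.trans ((mul_le_mul_of_nonneg_left ht.2 hLpos.le).trans ?_)
    rw [hh₀]; field_simp; exact le_rfl
  choose g hgX σ hσ0 hσmem hσlip hσ using key
  -- the limit along an ultrafilter
  set U : Ultrafilter ℕ := hyperfilter ℕ with hU
  have hUle : (U : Filter ℕ) ≤ atTop := by
    rw [hU]; exact Nat.hyperfilter_le_atTop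
  have hlim : ∀ t, ∃ x ∈ closedBall a r, t ∈ Icc 0 h₀ → Tendsto (fun k => σ k t) U (𝓝 x) := by
    intro t
    by_cases ht : t ∈ Icc 0 h₀
    · obtain ⟨x, hx, hle⟩ := (isCompact_closedBall a r).ultrafilter_le_nhds
        (U.map fun k => σ k t) (by
          rw [le_principal_iff]
          exact Eventually.of_forall (f := (U : Filter ℕ)) (fun k => hσmem k t ht))
      exact ⟨x, hx, fun _ => hle⟩
    · exact ⟨a, mem_closedBall_self hr.le, fun h => absurd h ht⟩
  choose x hxmem hx using hlim
  have hx0 : x 0 = a := by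
    refine tendsto_nhds_unique (hx 0 (left_mem_Icc.2 hh₀pos.le)) ?_
    simp only [hσ0]; exact tendsto_const_nhds
  refine ⟨h₀, hh₀pos, x, hx0, fun s hs => ⟨hrO (hxmem s), ?_⟩⟩
  rw [hasDerivWithinAt_iff_isLittleO, Asymptotics.isLittleO_iff]
  intro e he
  obtain ⟨δ, hδ, hδX⟩ := Metric.continuousOn_iff.1 (hX.mono hrO) (x s) (hxmem s) (e / 2)
    (by positivity)
  have hball : ∀ᶠ t in 𝓝[Icc 0 h₀] s, ‖t - s‖ < δ / (2 * L) := by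
    have : ball s (δ / (2 * L)) ∈ 𝓝 s := ball_mem_nhds _ (by positivity)
    filter_upwards [nhdsWithin_le_nhds this] with t ht
    rwa [mem_ball, dist_eq_norm] at ht
  filter_upwards [hball, self_mem_nhdsWithin] with t htδ ht
  -- Between `s` and `t` the curve `σ k` stays within `δ` of `x s`, half of it from the Lipschitz
  -- bound and half from convergence at `s`. Its velocity is therefore within `e` of `X (x s)`, and
  -- the mean value inequality applies before passing to the limit.
  have h1 : ∀ᶠ k in (U : Filter ℕ), ‖σ k t - σ k s - (t - s) • X (x s)‖ ≤ e * ‖t - s‖ := by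
    have hk1 : ∀ᶠ k in (U : Filter ℕ), dist (σ k s) (x s) < δ / 2 :=
      (hx s hs).eventually (ball_mem_nhds _ (by positivity))
    have hk2 : ∀ᶠ k : ℕ in (U : Filter ℕ), 1 / ((k : ℝ) + 1) < e / 2 :=
      hUle ((tendsto_one_div_add_atTop_nhds_zero_nat (𝕜 := ℝ)).eventually
        (gt_mem_nhds (by positivity)))
    filter_upwards [hk1, hk2] with k hk1 hk2
    have hsub : uIcc s t ⊆ Icc 0 h₀ := uIcc_subset_Icc hs ht
    have := (convex_uIcc s t).norm_image_sub_le_of_norm_hasFDerivWithin_le'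
      (f := σ k) (φ := ContinuousLinearMap.toSpanSingleton ℝ (X (x s))) (C := e)
      (fun τ hτ => ((hσ k τ (hsub hτ)).mono hsub).hasFDerivWithinAt) (fun τ hτ => ?_)
      left_mem_uIcc right_mem_uIcc
    · simpa using this
    · have hsp : ContinuousLinearMap.toSpanSingleton ℝ (g k (σ k τ))
          - ContinuousLinearMap.toSpanSingleton ℝ (X (x s))
          = ContinuousLinearMap.toSpanSingleton ℝ (g k (σ k τ) - X (x s)) := by ext; simp
      rw [hsp, ContinuousLinearMap.norm_toSpanSingleton]
      have hτ' : ‖τ - s‖ ≤ ‖t - s‖ := by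
        simpa [Real.norm_eq_abs] using abs_sub_left_of_mem_uIcc hτ
      have d1 : dist (σ k τ) (x s) < δ := by
        refine (dist_triangle _ (σ k s) _).trans_lt ?_
        have := hσlip k s hs τ (hsub hτ)
        rw [← dist_eq_norm] at this
        have h3 : L * ‖τ - s‖ < δ / 2 := by
          have := mul_lt_mul_of_pos_left (hτ'.trans_lt htδ) hLpos
          refine this.trans_eq ?_
          field_simp
        linarith
      have d2 := hδX (σ k τ) (hσmem k τ (hsub hτ)) d1
      have d3 := hgX k (σ k τ) (hσmem k τ (hsub hτ))
      rw [← dist_eq_norm]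
      linarith [dist_triangle (g k (σ k τ)) (X (σ k τ)) (X (x s))]
  refine le_of_tendsto ?_ h1
  exact (((hx t ht).sub (hx s hs)).sub tendsto_const_nhds).norm

end PartialHyperbolicity

namespace PartialHyperbolicity

open Metric

/-! ### Local foliations with `C^1` plaques in a vector space -/

variable {E F G : Type*} [NormedAddCommGroup E] [NormedSpace ℝ E]
  [NormedAddCommGroup F] [NormedSpace ℝ F] [FiniteDimensional ℝ F]
  [NormedAddCommGroup G] [NormedSpace ℝ G]

/-- The plaques of the foliation chart `φ` are `C^1` and tangent to `D`. -/
structure HasC1Plaques (φ : OpenPartialHomeomorph E (F × G)) (D : E → Submodule ℝ E) : Prop where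
  contDiffAt : ∀ p ∈ φ.target, ContDiffAt ℝ 1 (fun a => φ.symm (a, p.2)) p.1
  injective : ∀ p ∈ φ.target, Function.Injective (fderiv ℝ (fun a => φ.symm (a, p.2)) p.1)
  range_eq : ∀ p ∈ φ.target,
    LinearMap.range (fderiv ℝ (fun a => φ.symm (a, p.2)) p.1).toLinearMap = D (φ.symm p)

/-- An immersion `Φ` on a ball, nearly tangent to the range of the projection `σ ∘ pr`. -/
structure IsNearlyFlat (Φ : F → E) (pr : E →L[ℝ] F) (σ : F →L[ℝ] E) (ε : ℝ) (B : Set F) :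
    Prop where
  contDiffAt : ∀ a ∈ B, ContDiffAt ℝ 1 Φ a
  injective : ∀ a ∈ B, Function.Injective (fderiv ℝ Φ a)
  norm_sub_le : ∀ a ∈ B, ∀ v,
    ‖fderiv ℝ Φ a v - σ (pr (fderiv ℝ Φ a v))‖ ≤ ε * ‖fderiv ℝ Φ a v‖

namespace IsNearlyFlat

variable {Φ : F → E} {pr : E →L[ℝ] F} {σ : F →L[ℝ] E} {ε : ℝ} {B : Set F}

/-- A tangent vector killed by `pr` would have norm at most half of itself. Hence `pr ∘ Φ` has
invertible derivative and is a local diffeomorphism. -/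
theorem exists_equiv (h : IsNearlyFlat Φ pr σ ε B) (hε : ε ≤ 1 / 2) {a : F} (ha : a ∈ B) :
    ∃ e : F ≃L[ℝ] F, HasStrictFDerivAt (fun x => pr (Φ x)) (e : F →L[ℝ] F) a ∧
      ∀ v, e v = pr (fderiv ℝ Φ a v) := by
  have hinj : Function.Injective ((pr.comp (fderiv ℝ Φ a)).toLinearMap) := by
    rw [← LinearMap.ker_eq_bot, LinearMap.ker_eq_bot']
    intro v hv
    have hv' : pr (fderiv ℝ Φ a v) = 0 := hv
    have h1 := h.norm_sub_le a ha v
    rw [hv', map_zero, sub_zero] at h1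
    have h2 : ‖fderiv ℝ Φ a v‖ = 0 := by nlinarith [norm_nonneg (fderiv ℝ Φ a v)]
    rw [norm_eq_zero] at h2
    exact h.injective a ha (h2.trans (map_zero _).symm)
  set e : F ≃L[ℝ] F := (LinearEquiv.ofInjectiveEndo _ hinj).toContinuousLinearEquiv with he
  refine ⟨e, ?_, fun v => rfl⟩
  have h1 : HasStrictFDerivAt Φ (fderiv ℝ Φ a) a :=
    (h.contDiffAt a ha).hasStrictFDerivAt one_ne_zero
  have h2 := pr.hasStrictFDerivAt.comp a h1
  have h3 : (e : F →L[ℝ] F) = pr.comp (fderiv ℝ Φ a) := by ext v; rfl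
  rw [h3]; exact h2

/-- Lifts of straight segments are nearly straight. -/
theorem norm_lift_sub_le (h : IsNearlyFlat Φ pr σ ε B) (hε0 : 0 ≤ ε) (hε : ε ≤ 1 / 2)
    {α : ℝ → F} {s : ℝ} {w : F} (hα : ContinuousOn α (Icc 0 s)) (hαB : ∀ τ ∈ Icc 0 s, α τ ∈ B)
    (hlift : ∀ τ ∈ Icc 0 s, pr (Φ (α τ)) = pr (Φ (α 0)) + τ • w) {τ : ℝ} (hτ : τ ∈ Icc 0 s) :
    ‖Φ (α τ) - Φ (α 0) - τ • σ w‖ ≤ 2 * ε * ‖σ w‖ * τ := by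
  have hder : ∀ u ∈ Icc 0 s, ∃ v, HasDerivWithinAt (fun τ => Φ (α τ)) v (Icc 0 s) u ∧
      ‖v - σ w‖ ≤ 2 * ε * ‖σ w‖ := by
    intro u hu
    obtain ⟨e, he, hev⟩ := h.exists_equiv hε (hαB u hu)
    set li := he.localInverse (fun x => pr (Φ x)) e (α u) with hli
    have hli' : HasStrictFDerivAt li (e.symm : F →L[ℝ] F) (pr (Φ (α u))) := he.to_localInverse
    -- Only continuity of `α` is assumed. Differentiability follows because `α` agrees locally with
    -- the local inverse of `pr ∘ Φ` along a line.
    have hev1 : ∀ᶠ τ in 𝓝[Icc 0 s] u, α τ = li (pr (Φ (α 0)) + τ • w) := by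
      have h1 : ∀ᶠ x in 𝓝 (α u), li (pr (Φ x)) = x := he.eventually_left_inverse
      filter_upwards [(hα u hu).eventually h1, self_mem_nhdsWithin] with τ hτ hτs
      rw [← hlift τ hτs]; exact hτ.symm
    have hline : HasDerivWithinAt (fun τ : ℝ => pr (Φ (α 0)) + τ • w) w (Icc 0 s) u := by
      simpa using ((hasDerivAt_id u).smul_const w).const_add (pr (Φ (α 0))) |>.hasDerivWithinAt
    have hα' : HasDerivWithinAt α (e.symm w) (Icc 0 s) u := by
      have hli'' : HasFDerivAt li (e.symm : F →L[ℝ] F) (pr (Φ (α 0)) + u • w) := by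
        rw [← hlift u hu]; exact hli'.hasFDerivAt
      have := hli''.comp_hasDerivWithinAt u hline
      exact this.congr_of_eventuallyEq hev1 (hev1.self_of_nhdsWithin hu)
    have hΦ : HasFDerivAt Φ (fderiv ℝ Φ (α u)) (α u) :=
      ((h.contDiffAt _ (hαB u hu)).differentiableAt one_ne_zero).hasFDerivAt
    refine ⟨_, hΦ.comp_hasDerivWithinAt u hα', ?_⟩
    set v := fderiv ℝ Φ (α u) (e.symm w) with hv
    have hpv : pr v = w := by rw [hv, ← hev, e.apply_symm_apply]
    have h1 := h.norm_sub_le _ (hαB u hu) (e.symm w)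
    rw [← hv, hpv] at h1
    have h2 : ‖v‖ ≤ ‖v - σ w‖ + ‖σ w‖ := by
      simpa using norm_add_le (v - σ w) (σ w)
    have h3 : ‖v‖ ≤ 2 * ‖σ w‖ := by nlinarith [norm_nonneg v]
    nlinarith
  choose! v hv hvn using hder
  have := (convex_Icc 0 s).norm_image_sub_le_of_norm_hasFDerivWithin_le'
      (f := fun τ => Φ (α τ)) (φ := ContinuousLinearMap.toSpanSingleton ℝ (σ w))
      (C := 2 * ε * ‖σ w‖) (fun τ hτ => (hv τ hτ).hasFDerivWithinAt) (fun τ hτ => ?_)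
      (left_mem_Icc.2 (hτ.1.trans hτ.2)) hτ
  · simpa [Real.norm_of_nonneg hτ.1] using this
  · have hsp : ContinuousLinearMap.toSpanSingleton ℝ (v τ)
          - ContinuousLinearMap.toSpanSingleton ℝ (σ w)
          = ContinuousLinearMap.toSpanSingleton ℝ (v τ - σ w) := by ext; simp
    rw [hsp, ContinuousLinearMap.norm_toSpanSingleton]
    exact hvn τ hτ

/-- Straight segments lift, as long as the lift cannot reach the boundary. -/
theorem exists_lift {a₀ : F} {ρ c : ℝ} (h : IsNearlyFlat Φ pr σ ε (ball a₀ ρ)) (hε0 : 0 ≤ ε)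
    (hε : ε ≤ 1 / 2) (hΦ : ContinuousOn Φ (closedBall a₀ ρ)) {a w : F} (ha : a ∈ ball a₀ ρ)
    (hc : ∀ b ∈ sphere a₀ ρ, c ≤ ‖Φ b - Φ a‖) (hw : 2 * ‖σ w‖ < c) :
    ∃ α : ℝ → F, ContinuousOn α (Icc 0 1) ∧ α 0 = a ∧ (∀ τ ∈ Icc (0 : ℝ) 1, α τ ∈ ball a₀ ρ) ∧
      ∀ τ ∈ Icc (0 : ℝ) 1, pr (Φ (α τ)) = pr (Φ a) + τ • w := by
  set S : Set ℝ := {s | ∃ α : ℝ → F, ContinuousOn α (Icc 0 s) ∧ α 0 = a ∧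
    (∀ τ ∈ Icc (0 : ℝ) s, α τ ∈ ball a₀ ρ) ∧
      ∀ τ ∈ Icc (0 : ℝ) s, pr (Φ (α τ)) = pr (Φ a) + τ • w} with hS
  have hmono : ∀ s ∈ S, ∀ s' ≤ s, s' ∈ S := by
    rintro s ⟨α, h1, h2, h3, h4⟩ s' hs'
    have := Icc_subset_Icc (le_refl (0 : ℝ)) hs'
    exact ⟨α, h1.mono this, h2, fun τ hτ => h3 τ (this hτ), fun τ hτ => h4 τ (this hτ)⟩
  -- A lift moves by at most `2 * ‖σ w‖ < c` in `E`, whereas reaching the sphere would require a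
  -- displacement of at least `c`. Limits of lifts therefore stay in the open ball.
  have hbd : ∀ s ∈ Icc (0 : ℝ) 1, ∀ α : ℝ → F, ContinuousOn α (Icc 0 s) → α 0 = a →
      (∀ τ ∈ Icc (0 : ℝ) s, α τ ∈ ball a₀ ρ) →
      (∀ τ ∈ Icc (0 : ℝ) s, pr (Φ (α τ)) = pr (Φ a) + τ • w) → ‖Φ (α s) - Φ a‖ ≤ 2 * ‖σ w‖ := by
    intro s hs α h1 h2 h3 h4
    have := h.norm_lift_sub_le hε0 hε h1 h3 (by rwa [h2]) (right_mem_Icc.2 hs.1)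
    rw [h2] at this
    have h5 : ‖Φ (α s) - Φ a‖ ≤ ‖Φ (α s) - Φ a - s • σ w‖ + ‖s • σ w‖ := by
      simpa using norm_add_le (Φ (α s) - Φ a - s • σ w) (s • σ w)
    rw [norm_smul, Real.norm_of_nonneg hs.1] at h5
    have h6 : s * ‖σ w‖ ≤ ‖σ w‖ := mul_le_of_le_one_left (norm_nonneg _) hs.2
    have h7 : 2 * ε * ‖σ w‖ * s ≤ ‖σ w‖ := by
      have : 2 * ε * (‖σ w‖ * s) ≤ 1 * (‖σ w‖ * s) := by
        refine mul_le_mul_of_nonneg_right (by linarith) (mul_nonneg (norm_nonneg _) hs.1)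
      nlinarith
    linarith
  -- extension past a limit time `s`
  have hext : ∀ s ∈ Icc (0 : ℝ) 1, (∀ s' ∈ Ico 0 s, s' ∈ S) →
      ∃ η > 0, s + η ∈ S := by
    intro s hs hlt
    -- an accumulation point of lifts at times tending to `s`
    obtain ⟨x, hx, hfreq⟩ : ∃ x ∈ ball a₀ ρ, pr (Φ x) = pr (Φ a) + s • w ∧
        ∀ V ∈ 𝓝 x, ∀ η > 0, ∃ s' ∈ Icc 0 s, s - η < s' ∧ ∃ α : ℝ → F,
          ContinuousOn α (Icc 0 s') ∧ α 0 = a ∧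
          (∀ τ ∈ Icc (0 : ℝ) s', α τ ∈ ball a₀ ρ) ∧
          (∀ τ ∈ Icc (0 : ℝ) s', pr (Φ (α τ)) = pr (Φ a) + τ • w) ∧ α s' ∈ V := by
      rcases hs.1.eq_or_lt with h0 | h0
      · refine ⟨a, ha, by simp [← h0], fun V hV η hη => ⟨0, by simp [← h0], by linarith,
          fun _ => a, continuousOn_const, rfl, fun _ _ => ha, ?_, mem_of_mem_nhds hV⟩⟩
        intro τ hτ
        have : τ = 0 := le_antisymm hτ.2 hτ.1
        simp [this]
      · obtain ⟨u, hu, hulim⟩ := exists_seq_strictMono_tendsto' h0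
        have hul : ∀ k, u k ∈ Ico 0 s := fun k => ⟨(hulim.1 k).1.le, (hulim.1 k).2⟩
        have := fun k => hlt _ (hul k)
        choose α h1 h2 h3 h4 using this
        have hmem : ∀ k, α k (u k) ∈ closedBall a₀ ρ := fun k =>
          ball_subset_closedBall (h3 k _ (right_mem_Icc.2 (hul k).1))
        obtain ⟨x, hx, ψ, hψ, hψlim⟩ := (isCompact_closedBall a₀ ρ).tendsto_subseq hmem
        have hΦx : Tendsto (fun k => Φ (α (ψ k) (u (ψ k)))) atTop (𝓝 (Φ x)) :=
          (hΦ x hx).tendsto.comp (tendsto_nhdsWithin_iff.2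
            ⟨hψlim, Eventually.of_forall fun k => hmem _⟩)
        have huψ : Tendsto (fun k => u (ψ k)) atTop (𝓝 s) := hulim.2.comp hψ.tendsto_atTop
        refine ⟨x, ?_, ?_, ?_⟩
        · by_contra hxb
          have hxs : x ∈ sphere a₀ ρ := by
            rw [mem_sphere]
            exact le_antisymm hx (not_lt.1 hxb)
          have h5 : ‖Φ x - Φ a‖ ≤ 2 * ‖σ w‖ :=
            le_of_tendsto (hΦx.sub_const _).norm (Eventually.of_forall fun k =>
              hbd _ ⟨(hul _).1, (hul _).2.le.trans hs.2⟩ _ (h1 _) (h2 _) (h3 _) (h4 _))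
          linarith [hc x hxs]
        · refine tendsto_nhds_unique ((pr.continuous.tendsto _).comp hΦx) ?_
          have : (fun k => pr (Φ (α (ψ k) (u (ψ k))))) = fun k => pr (Φ a) + u (ψ k) • w :=
            funext fun k => h4 _ _ (right_mem_Icc.2 (hul _).1)
          rw [show (⇑pr ∘ fun k => Φ (α (ψ k) (u (ψ k)))) = _ from this]
          exact tendsto_const_nhds.add (huψ.smul_const w)
        · intro V hV η hη
          obtain ⟨k, hk1, hk2⟩ := ((hψlim.eventually hV).and
            (huψ.eventually (lt_mem_nhds (show s - η < s by linarith)))).exists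
          exact ⟨_, ⟨(hul _).1, (hul _).2.le⟩, hk2, α (ψ k), h1 _, h2 _, h3 _, h4 _, hk1⟩
    obtain ⟨hgx, hfreq⟩ := hfreq
    obtain ⟨e, he, -⟩ := h.exists_equiv hε hx
    set g := (he.toOpenPartialHomeomorph (fun x => pr (Φ x))).restr (ball a₀ ρ) with hg
    have hgsrc : g.source ∈ 𝓝 x := by
      refine g.open_source.mem_nhds ?_
      rw [hg, OpenPartialHomeomorph.restr_source, isOpen_ball.interior_eq]
      exact ⟨he.mem_toOpenPartialHomeomorph_source, hx⟩
    have hgB : ∀ y ∈ g.source, y ∈ ball a₀ ρ := by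
      intro y hy
      rw [hg, OpenPartialHomeomorph.restr_source, isOpen_ball.interior_eq] at hy
      exact hy.2
    have hgapp : ∀ y, g y = pr (Φ y) := fun y => rfl
    have htgt : ∀ᶠ τ : ℝ in 𝓝 s, pr (Φ a) + τ • w ∈ g.target := by
      have hcont : ContinuousAt (fun τ : ℝ => pr (Φ a) + τ • w) s := by fun_prop
      refine hcont.eventually (g.open_target.mem_nhds ?_)
      change pr (Φ a) + s • w ∈ g.target
      rw [← hgx, ← hgapp]
      exact g.map_source (mem_of_mem_nhds hgsrc)
    obtain ⟨η, hη, hηt⟩ := Metric.nhds_basis_ball.eventually_iff.1 htgt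
    -- The lifts at different times need not extend one another. A single lift ending in the source
    -- of `g` at a time `s'` close to `s` suffices: the local inverse `g.symm` continues it past
    -- `s`.
    obtain ⟨s', hs', hs'η, α, h1, h2, h3, h4, h5⟩ := hfreq _ hgsrc η hη
    have htgt' : ∀ τ ∈ Icc s' (s + η / 2), pr (Φ a) + τ • w ∈ g.target := by
      intro τ hτ
      apply hηt
      rw [mem_ball, Real.dist_eq, abs_lt]
      exact ⟨by linarith [hτ.1], by linarith [hτ.2]⟩
    refine ⟨η / 2, by positivity, fun τ => if τ ≤ s' then α τ else g.symm (pr (Φ a) + τ • w),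
      ?_, ?_, ?_, ?_⟩
    · have hglue : α s' = g.symm (pr (Φ a) + s' • w) := by
        rw [← h4 s' (right_mem_Icc.2 hs'.1), ← hgapp, g.left_inv h5]
      refine ContinuousOn.if ?_ ?_ ?_
      · rintro τ ⟨-, hτ⟩
        have : τ = s' := by simpa using frontier_le_subset_eq continuous_id continuous_const hτ
        rw [this, hglue]
      · refine h1.mono ?_
        rintro τ ⟨h6, h7⟩
        exact ⟨h6.1, (isClosed_Iic (a := s')).closure_subset h7⟩
      · refine ContinuousOn.comp (t := g.target) g.continuousOn_symm (by fun_prop) ?_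
        rintro τ ⟨h6, h7⟩
        have : s' ≤ τ := by
          have hcl : IsClosed {τ : ℝ | s' ≤ τ} := isClosed_Ici
          refine closure_minimal ?_ hcl h7
          intro y hy
          exact (not_le.1 hy).le
        exact htgt' τ ⟨this, h6.2⟩
    · simp [hs'.1, h2]
    · intro τ hτ
      dsimp only
      split_ifs with hle
      · exact h3 τ ⟨hτ.1, hle⟩
      · exact hgB _ (g.map_target (htgt' τ ⟨(not_le.1 hle).le, hτ.2⟩))
    · intro τ hτ
      dsimp only
      split_ifs with hle
      · exact h4 τ ⟨hτ.1, hle⟩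
      · rw [← hgapp, g.right_inv (htgt' τ ⟨(not_le.1 hle).le, hτ.2⟩)]
  have h0 : (0 : ℝ) ∈ S := by
    refine ⟨fun _ => a, continuousOn_const, rfl, fun _ _ => ha, fun τ hτ => ?_⟩
    have : τ = 0 := le_antisymm hτ.2 hτ.1
    simp [this]
  by_contra hne
  have h1S : (1 : ℝ) ∉ S := hne
  have hlub := isLUB_csSup (s := S ∩ Icc 0 1) ⟨0, h0, by simp⟩ ⟨1, fun x hx => hx.2.2⟩
  set s := sSup (S ∩ Icc 0 1) with hs
  have hs0 : 0 ≤ s := hlub.1 ⟨h0, by simp⟩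
  have hs1 : s ≤ 1 := hlub.2 fun x hx => hx.2.2
  obtain ⟨η, hη, hηS⟩ := hext s ⟨hs0, hs1⟩ (by
    intro s' hs'
    obtain ⟨x, hx, hlt, -⟩ := hlub.exists_between hs'.2
    exact hmono x hx.1 s' hlt.le)
  by_cases hle : s + η ≤ 1
  · have := hlub.1 ⟨hηS, by linarith, hle⟩
    linarith
  · exact h1S (hmono _ hηS 1 (not_le.1 hle).le)

/-- A monodromy argument. If `a` and `b` have the same projection, lift from each point `y u` of the
segment `[a, b]` the straight segment from its projection to the projection of `a`. The endpoints of
these lifts vary continuously in a discrete fibre, so they coincide. For `u = 0` and `u = 1` the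
lifts are constant, whence `a = b`. -/
theorem injOn {a₀ : F} {ρ c : ℝ} (h : IsNearlyFlat Φ pr σ ε (ball a₀ ρ)) (hε0 : 0 ≤ ε)
    (hε : ε ≤ 1 / 2) (hΦ : ContinuousOn Φ (closedBall a₀ ρ)) (hΦi : InjOn Φ (ball a₀ ρ))
    {C : Set F} (hC : Convex ℝ C) (hCB : C ⊆ ball a₀ ρ)
    (hc : ∀ a ∈ C, ∀ b ∈ sphere a₀ ρ, c ≤ ‖Φ b - Φ a‖)
    (hw : ∀ a ∈ C, ∀ b ∈ C, 2 * ‖σ (pr (Φ b) - pr (Φ a))‖ < c) :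
    InjOn (fun x => pr (Φ x)) C := by
  intro a ha b hb hab
  have hab' : pr (Φ a) = pr (Φ b) := hab
  set y : unitInterval → F := fun u => AffineMap.lineMap a b (u : ℝ) with hy
  have hyC : ∀ u, y u ∈ C := fun u => hC.lineMap_mem ha hb u.2
  have hyc : Continuous y := AffineMap.lineMap_continuous.comp continuous_subtype_val
  have hΦb : ContinuousOn Φ (ball a₀ ρ) := hΦ.mono ball_subset_closedBall
  have hgy : Continuous fun u => pr (Φ (y u)) :=
    pr.continuous.comp (hΦb.comp_continuous hyc fun u => hCB (hyC u))
  have hl := fun u => h.exists_lift hε0 hε hΦ (hCB (hyC u)) (hc _ (hyC u)) (hw _ (hyC u) a ha)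
  choose α h1 h2 h3 h4 using hl
  set p : ball a₀ ρ → F := fun x => pr (Φ x) with hp
  have hpl : IsLocalHomeomorph p := by
    have : IsLocalHomeomorphOn (fun x => pr (Φ x)) (ball a₀ ρ) := by
      refine IsLocalHomeomorphOn.mk _ _ fun x hx => ?_
      obtain ⟨e, he, -⟩ := h.exists_equiv hε hx
      exact ⟨he.toOpenPartialHomeomorph _, he.mem_toOpenPartialHomeomorph_source, fun _ _ => rfl⟩
    rw [isLocalHomeomorph_iff_isLocalHomeomorphOn_univ]
    exact this.comp isOpen_ball.isOpenEmbedding_subtypeVal.isLocalHomeomorph.isLocalHomeomorphOn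
      fun x _ => x.2
  have hps : IsSeparatedMap p := T2Space.isSeparatedMap p
  set g : unitInterval × unitInterval → ball a₀ ρ := fun z => ⟨α z.2 z.1, h3 _ _ z.1.2⟩ with hg
  have hgc : Continuous g := by
    refine hpl.continuous_lift hps
      ⟨fun z => pr (Φ (y z.2)) + (z.1 : ℝ) • (pr (Φ a) - pr (Φ (y z.2))), ?_⟩ ?_ ?_ ?_
    · have h5 : Continuous fun z : unitInterval × unitInterval => pr (Φ (y z.2)) :=
        hgy.comp continuous_snd
      exact h5.add ((continuous_subtype_val.comp continuous_fst).smul (continuous_const.sub h5))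
    · ext z
      exact h4 _ _ z.1.2
    · refine Continuous.subtype_mk ?_ _
      have : (fun u => α u ((0 : unitInterval) : ℝ)) = y := funext fun u => h2 u
      rw [this]; exact hyc
    · intro u
      refine Continuous.subtype_mk ?_ _
      exact (h1 u).comp_continuous continuous_subtype_val fun t => t.2
  have hend : (fun u : unitInterval => g (1, u)) = fun _ => g (1, 0) := by
    refine hps.eq_of_comp_eq hpl.isLocallyInjective (hgc.comp (by fun_prop)) continuous_const ?_ 0
      rfl
    ext u
    have h5 : ∀ u, pr (Φ (α u 1)) = pr (Φ a) := fun u => by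
      rw [h4 u 1 (by simp)]; simp
    exact (h5 u).trans (h5 0).symm
  -- With displacement `w = 0` the lift estimate says that `Φ` takes equal values at both ends, and
  -- `Φ` is injective on the ball.
  have hfix : ∀ u, pr (Φ (y u)) = pr (Φ a) → α u 1 = y u := by
    intro u hu
    refine hΦi (h3 u 1 (by simp)) (hCB (hyC u)) ?_
    have := h.norm_lift_sub_le hε0 hε (h1 u) (h3 u) (w := 0) (by
      intro τ hτ
      rw [h4 u τ hτ, h2, hu]; simp) (τ := 1) (by simp)
    simpa [h2, sub_eq_zero] using this
  have h01 : α 1 1 = α 0 1 := congrArg Subtype.val (congrFun hend 1)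
  rw [hfix 1 (by simp [hy, hab']), hfix 0 (by simp [hy])] at h01
  simpa [hy] using h01.symm

end IsNearlyFlat

/-- Plaques are flat at small scales: the difference of two nearby points of a plaque is almost
tangent to the distribution. -/
theorem HasC1Plaques.eventually_norm_sub_le [FiniteDimensional ℝ E] [FiniteDimensional ℝ G]
    {φ : OpenPartialHomeomorph E (F × G)}
    {D : E → Submodule ℝ E} (h : HasC1Plaques φ D) {y₀ : E} (hy₀ : y₀ ∈ φ.source)
    (P : E →L[ℝ] E) (hPD : ∀ w, P w ∈ D y₀)
    (hcont : ∀ ε > 0, ∀ᶠ y in 𝓝 y₀, ∀ w ∈ D y, ‖w - P w‖ ≤ ε * ‖w‖) {ε : ℝ} (hε : 0 < ε) :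
    ∀ᶠ z : E × E in 𝓝 (y₀, y₀), (φ z.1).2 = (φ z.2).2 →
      ‖(z.2 - z.1) - P (z.2 - z.1)‖ ≤ ε * ‖z.2 - z.1‖ := by
  set a₀ := (φ y₀).1 with ha₀
  set t₀ := (φ y₀).2 with ht₀
  have hz₀ : (a₀, t₀) = φ y₀ := rfl
  have htar : (a₀, t₀) ∈ φ.target := φ.map_source hy₀
  have hsymm : φ.symm (a₀, t₀) = y₀ := φ.left_inv hy₀
  set σ : F →L[ℝ] E := fderiv ℝ (fun a => φ.symm (a, t₀)) a₀ with hσ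
  have hσi : Function.Injective σ.toLinearMap := h.injective _ htar
  have hσr : LinearMap.range σ.toLinearMap = D y₀ := by
    rw [← hsymm]; exact h.range_eq _ htar
  obtain ⟨pr, hpr⟩ : ∃ pr : E →L[ℝ] F, ∀ w, σ (pr w) = P w := by
    refine ⟨((LinearEquiv.ofInjective σ.toLinearMap hσi).symm.toLinearMap ∘ₗ
      (P.toLinearMap.codRestrict (LinearMap.range σ.toLinearMap)
        fun w => hσr ▸ hPD w)).toContinuousLinearMap, fun w => ?_⟩
    exact congrArg Subtype.val ((LinearEquiv.ofInjective σ.toLinearMap hσi).apply_symm_apply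
      (P.toLinearMap.codRestrict (LinearMap.range σ.toLinearMap) (fun w => hσr ▸ hPD w) w))
  -- The lift estimate will give the error `2 * ε₁ * ‖P (q - p)‖`, to be bounded by `ε * ‖q - p‖`.
  -- The bound `1 / 2` is what lifting requires.
  set ε₁ : ℝ := min (1 / 2) (ε / (2 * (‖P‖ + 1))) with hε₁
  have hPpos : 0 < ‖P‖ + 1 := by positivity
  have hε₁0 : 0 < ε₁ := by positivity
  have hε₁h : ε₁ ≤ 1 / 2 := min_le_left _ _
  have hsc : ContinuousAt φ.symm (a₀, t₀) := φ.continuousAt_symm htar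
  -- a product neighbourhood where the plaques are nearly flat
  have hW : {z : F × G | z ∈ φ.target ∧ ∀ w ∈ D (φ.symm z), ‖w - P w‖ ≤ ε₁ * ‖w‖}
      ∈ 𝓝 (a₀, t₀) := by
    refine inter_mem (φ.open_target.mem_nhds htar) ?_
    exact hsc.eventually (by rw [hsymm]; exact hcont ε₁ hε₁0)
  obtain ⟨ρ, hρ, hρW⟩ := Metric.nhds_basis_closedBall.mem_iff.1 hW
  have hmemW : ∀ a ∈ closedBall a₀ ρ, ∀ t ∈ closedBall t₀ ρ, (a, t) ∈ φ.target ∧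
      ∀ w ∈ D (φ.symm (a, t)), ‖w - P w‖ ≤ ε₁ * ‖w‖ := fun a ha t ht =>
    hρW (by rw [← closedBall_prod_same]; exact ⟨ha, ht⟩)
  have hflat : ∀ t ∈ closedBall t₀ ρ,
      IsNearlyFlat (fun a => φ.symm (a, t)) pr σ ε₁ (ball a₀ ρ) := by
    intro t ht
    have hb : ∀ a ∈ ball a₀ ρ, a ∈ closedBall a₀ ρ := fun a ha => ball_subset_closedBall ha
    refine ⟨fun a ha => h.contDiffAt (a, t) (hmemW a (hb a ha) t ht).1,
      fun a ha => h.injective (a, t) (hmemW a (hb a ha) t ht).1, fun a ha v => ?_⟩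
    rw [hpr]
    refine (hmemW a (hb a ha) t ht).2 _ ?_
    rw [← h.range_eq (a, t) (hmemW a (hb a ha) t ht).1]
    exact ⟨v, rfl⟩
  have hΦc : ∀ t ∈ closedBall t₀ ρ, ContinuousOn (fun a => φ.symm (a, t)) (closedBall a₀ ρ) :=
    fun t ht => φ.continuousOn_symm.comp (by fun_prop) fun a ha => (hmemW a ha t ht).1
  have hΦi : ∀ t ∈ closedBall t₀ ρ, InjOn (fun a => φ.symm (a, t)) (ball a₀ ρ) := by
    intro t ht a ha b hb hab
    have := φ.symm.injOn (hmemW a (ball_subset_closedBall ha) t ht).1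
      (hmemW b (ball_subset_closedBall hb) t ht).1 hab
    exact congrArg Prod.fst this
  -- Injectivity of the chart and compactness separate the middle of each plaque from its boundary,
  -- uniformly in the transversal parameter.
  obtain ⟨c, hc0, hc⟩ : ∃ c > (0 : ℝ), ∀ z ∈ (closedBall a₀ (ρ / 2) ×ˢ sphere a₀ ρ) ×ˢ
      closedBall t₀ ρ, c ≤ ‖φ.symm (z.1.2, z.2) - φ.symm (z.1.1, z.2)‖ := by
    have : ProperSpace F := FiniteDimensional.proper ℝ F
    have : ProperSpace G := FiniteDimensional.proper ℝ G
    have hhalf : closedBall a₀ (ρ / 2) ⊆ closedBall a₀ ρ := closedBall_subset_closedBall (by linarith)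
    refine (((isCompact_closedBall a₀ (ρ / 2)).prod (isCompact_sphere a₀ ρ)).prod
      (isCompact_closedBall t₀ ρ)).exists_forall_le' (ContinuousOn.norm (ContinuousOn.sub ?_ ?_)) ?_
    · exact φ.continuousOn_symm.comp (by fun_prop) fun z hz =>
        (hmemW _ (sphere_subset_closedBall hz.1.2) _ hz.2).1
    · exact φ.continuousOn_symm.comp (by fun_prop) fun z hz => (hmemW _ (hhalf hz.1.1) _ hz.2).1
    · rintro ⟨⟨a, b⟩, t⟩ ⟨⟨ha, hb⟩, ht⟩
      rw [norm_pos_iff]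
      refine sub_ne_zero.2 ?_
      intro heq
      have := congrArg Prod.fst (φ.symm.injOn (hmemW b (sphere_subset_closedBall hb) t ht).1
        (hmemW a (hhalf ha) t ht).1 heq)
      dsimp only at this hb ha
      rw [this, mem_sphere] at hb
      rw [mem_closedBall] at ha
      linarith
  -- a smaller ball on which the projected plaques are embedded
  obtain ⟨ρ₁, hρ₁, hρ₁ρ, hρ₁c⟩ : ∃ ρ₁ > 0, ρ₁ ≤ ρ / 2 ∧ ∀ z ∈ ball (a₀, t₀) ρ₁,
      ‖φ.symm z - y₀‖ < c / (8 * (‖P‖ + 1)) := by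
    have : ∀ᶠ z in 𝓝 (a₀, t₀), ‖φ.symm z - y₀‖ < c / (8 * (‖P‖ + 1)) := by
      have h1 : Tendsto (fun z => ‖φ.symm z - y₀‖) (𝓝 (a₀, t₀)) (𝓝 0) := by
        have := (hsc.sub_const y₀).norm
        simpa [ContinuousAt, hsymm] using this
      exact h1.eventually (gt_mem_nhds (by positivity))
    obtain ⟨r, hr, hrb⟩ := Metric.nhds_basis_ball.eventually_iff.1 this
    exact ⟨min r (ρ / 2), by positivity, min_le_right _ _,
      fun z hz => hrb (ball_subset_ball (min_le_left _ _) hz)⟩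
  have hball : ∀ a ∈ ball a₀ ρ₁, ∀ t ∈ ball t₀ ρ₁, (a, t) ∈ ball (a₀, t₀) ρ₁ := fun a ha t ht => by
    rw [← ball_prod_same]; exact ⟨ha, ht⟩
  have hsmall : ∀ t ∈ ball t₀ ρ₁, ∀ a ∈ ball a₀ ρ₁, ∀ b ∈ ball a₀ ρ₁,
      2 * ‖σ (pr (φ.symm (b, t)) - pr (φ.symm (a, t)))‖ < c := by
    intro t ht a ha b hb
    rw [← map_sub, hpr]
    have h1 := P.le_opNorm (φ.symm (b, t) - φ.symm (a, t))
    have h2 := hρ₁c _ (hball a ha t ht)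
    have h3 := hρ₁c _ (hball b hb t ht)
    have h4 : ‖φ.symm (b, t) - φ.symm (a, t)‖ ≤ 2 * (c / (8 * (‖P‖ + 1))) := by
      have : φ.symm (b, t) - φ.symm (a, t) = (φ.symm (b, t) - y₀) - (φ.symm (a, t) - y₀) := by abel
      rw [this]
      exact (norm_sub_le _ _).trans (by linarith)
    have h5 : ‖P‖ * ‖φ.symm (b, t) - φ.symm (a, t)‖ ≤ (‖P‖ + 1) * (2 * (c / (8 * (‖P‖ + 1)))) :=
      mul_le_mul (by linarith) h4 (norm_nonneg _) hPpos.le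
    have h6 : (‖P‖ + 1) * (2 * (c / (8 * (‖P‖ + 1)))) = c / 4 := by field_simp; norm_num
    linarith
  have hcC : ∀ t ∈ ball t₀ ρ₁, ∀ a ∈ ball a₀ ρ₁, ∀ b ∈ sphere a₀ ρ,
      c ≤ ‖φ.symm (b, t) - φ.symm (a, t)‖ := fun t ht a ha b hb =>
    hc ((a, b), t) ⟨⟨closedBall_subset_closedBall hρ₁ρ (ball_subset_closedBall ha), hb⟩,
      closedBall_subset_closedBall (by linarith) (ball_subset_closedBall ht)⟩
  -- the neighbourhood in the ambient space
  have hV : {y | y ∈ φ.source ∧ φ y ∈ ball (a₀, t₀) ρ₁} ∈ 𝓝 y₀ :=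
    inter_mem (φ.open_source.mem_nhds hy₀)
      ((φ.continuousAt hy₀).eventually (ball_mem_nhds _ hρ₁))
  obtain ⟨δ, hδ, hδV⟩ := Metric.nhds_basis_ball.mem_iff.1 hV
  have hδ' : 0 < δ / (8 * (‖P‖ + 1)) := by positivity
  have hδ'le : δ / (8 * (‖P‖ + 1)) ≤ δ / 8 := by
    apply div_le_div_of_nonneg_left hδ.le (by norm_num)
    linarith [norm_nonneg P]
  filter_upwards [prod_mem_nhds (ball_mem_nhds y₀ hδ') (ball_mem_nhds y₀ hδ')]
  rintro ⟨p, q⟩ ⟨hp, hq⟩ hpq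
  dsimp only at hp hq hpq ⊢
  rw [mem_ball, dist_eq_norm] at hp hq
  obtain ⟨hps, hpb⟩ := hδV (by rw [mem_ball, dist_eq_norm]; linarith : p ∈ ball y₀ δ)
  obtain ⟨hqs, hqb⟩ := hδV (by rw [mem_ball, dist_eq_norm]; linarith : q ∈ ball y₀ δ)
  set a := (φ p).1 with ha
  set b := (φ q).1 with hb
  set t := (φ p).2 with ht
  rw [← ball_prod_same] at hpb hqb
  have haB : a ∈ ball a₀ ρ₁ := hpb.1
  have hbB : b ∈ ball a₀ ρ₁ := hqb.1
  have htB : t ∈ ball t₀ ρ₁ := hpb.2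
  have htρ : t ∈ closedBall t₀ ρ :=
    closedBall_subset_closedBall (by linarith) (ball_subset_closedBall htB)
  have hpa : φ.symm (a, t) = p := φ.left_inv hps
  have hqa : φ.symm (b, t) = q := by rw [hpq]; exact φ.left_inv hqs
  have hsub : ball a₀ ρ₁ ⊆ ball a₀ ρ := ball_subset_ball (by linarith)
  -- Lift the segment from the projection of `p` to that of `q`, starting at `p`. The lift is nearly
  -- straight, and once its end is identified with `q` the estimate for `q - p` follows.
  obtain ⟨α, h1, h2, h3, h4⟩ := (hflat t htρ).exists_lift hε₁0.le hε₁h (hΦc t htρ) (hsub haB)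
    (hcC t htB a haB) (hsmall t htB a haB b hbB)
  have h5 := (hflat t htρ).norm_lift_sub_le hε₁0.le hε₁h h1 h3 (by rwa [h2]) (τ := 1) (by simp)
  rw [h2, one_smul, mul_one] at h5
  have h4' := h4 1 (by simp)
  rw [one_smul, add_sub_cancel] at h4'
  rw [← map_sub, hpr, hpa, hqa] at h5
  have hPw : ‖P (q - p)‖ ≤ ‖P‖ * ‖q - p‖ := P.le_opNorm _
  have hqp : ‖q - p‖ ≤ 2 * (δ / (8 * (‖P‖ + 1))) := by
    have : q - p = (q - y₀) - (p - y₀) := by abel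
    rw [this]
    exact (norm_sub_le _ _).trans (by linarith)
  -- Injectivity of the projection is known only on the ball of radius `ρ₁`. The end of the lift is
  -- there because its image is within `2 * ‖P (q - p)‖` of `p`, hence within `δ` of `y₀`.
  have hα1 : α 1 ∈ ball a₀ ρ₁ := by
    have h6 : ‖φ.symm (α 1, t) - p‖ ≤ 2 * ‖P (q - p)‖ := by
      have e1 : φ.symm (α 1, t) - p = (φ.symm (α 1, t) - p - P (q - p)) + P (q - p) := by abel
      rw [e1]
      refine (norm_add_le _ _).trans ?_
      have : 2 * ε₁ * ‖P (q - p)‖ ≤ 1 * ‖P (q - p)‖ :=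
        mul_le_mul_of_nonneg_right (by linarith) (norm_nonneg _)
      linarith
    have h7 : ‖P‖ * ‖q - p‖ ≤ (‖P‖ + 1) * (2 * (δ / (8 * (‖P‖ + 1)))) :=
      mul_le_mul (by linarith) hqp (norm_nonneg _) hPpos.le
    have h8 : (‖P‖ + 1) * (2 * (δ / (8 * (‖P‖ + 1)))) = δ / 4 := by field_simp; norm_num
    have h9 : φ.symm (α 1, t) ∈ ball y₀ δ := by
      rw [mem_ball, dist_eq_norm]
      have e1 : φ.symm (α 1, t) - y₀ = (φ.symm (α 1, t) - p) + (p - y₀) := by abel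
      rw [e1]
      refine (norm_add_le _ _).trans_lt ?_
      linarith
    have h10 := (hδV h9).2
    rw [φ.right_inv (hmemW _ (ball_subset_closedBall (h3 1 (by simp))) t htρ).1,
      ← ball_prod_same] at h10
    exact h10.1
  have hinj := (hflat t htρ).injOn hε₁0.le hε₁h (hΦc t htρ) (hΦi t htρ) (convex_ball a₀ ρ₁) hsub
    (hcC t htB) (hsmall t htB)
  have hαb : α 1 = b := hinj hα1 hbB h4'
  rw [hαb, hqa] at h5
  refine h5.trans ?_
  have h6 : 2 * ε₁ * ‖P (q - p)‖ ≤ 2 * ε₁ * (‖P‖ * ‖q - p‖) :=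
    mul_le_mul_of_nonneg_left hPw (by positivity)
  have h7 : ε₁ * (2 * (‖P‖ + 1)) ≤ ε := by
    rw [← le_div_iff₀ (by positivity)]; exact min_le_right _ _
  have h8 : 2 * ε₁ * (‖P‖ * ‖q - p‖) ≤ ε₁ * (2 * (‖P‖ + 1)) * ‖q - p‖ := by
    have : 0 ≤ ε₁ * ‖q - p‖ := by positivity
    nlinarith
  exact h6.trans (h8.trans (mul_le_mul_of_nonneg_right h7 (norm_nonneg _)))

end PartialHyperbolicity

namespace PartialHyperbolicity

open Metric

set_option linter.unusedSectionVars false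

variable {E F G : Type*} [NormedAddCommGroup E] [NormedSpace ℝ E]
  [NormedAddCommGroup F] [NormedSpace ℝ F] [FiniteDimensional ℝ F]
  [NormedAddCommGroup G] [NormedSpace ℝ G]

/-! ### Moves inside a plaque -/

/-- The plaque of `p` in the foliation chart `φ`. -/
def plaque (φ : OpenPartialHomeomorph E (F × G)) (p : E) : Set E :=
  {y | y ∈ φ.source ∧ (φ y).2 = (φ p).2}

theorem isClosed_plaque_inter {φ : OpenPartialHomeomorph E (F × G)} {C : Set E}
    (hC : IsClosed C) (hCφ : C ⊆ φ.source) (p : E) : IsClosed (plaque φ p ∩ C) := by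
  have h1 : ContinuousOn (fun y => (φ y).2) C :=
    (continuous_snd.comp_continuousOn φ.continuousOn).mono hCφ
  have h2 := h1.preimage_isClosed_of_isClosed hC (isClosed_singleton (x := (φ p).2))
  convert! h2 using 1
  ext y
  constructor
  · rintro ⟨⟨-, h⟩, hy⟩; exact ⟨hy, h⟩
  · rintro ⟨hy, h⟩; exact ⟨⟨hCφ hy, h⟩, hy⟩

theorem HasC1Plaques.exists_move {φ : OpenPartialHomeomorph E (F × G)} {D : E → Submodule ℝ E}
    (h : HasC1Plaques φ D) {p : E} (hp : p ∈ φ.source) {v : E} (hv : v ∈ D p) {e : ℝ}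
    (he : 0 < e) :
    ∀ᶠ s in 𝓝[>] (0 : ℝ), ∃ p' ∈ plaque φ p, ‖p' - p - s • v‖ ≤ s * e := by
  have htar := φ.map_source hp
  have hpp : φ.symm ((φ p).1, (φ p).2) = p := φ.left_inv hp
  rw [← φ.left_inv hp, ← h.range_eq _ htar] at hv
  obtain ⟨b, hb⟩ := hv
  have hd : HasFDerivAt (fun a => φ.symm (a, (φ p).2))
      (fderiv ℝ (fun a => φ.symm (a, (φ p).2)) (φ p).1) (φ p).1 :=
    ((h.contDiffAt _ htar).differentiableAt one_ne_zero).hasFDerivAt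
  have hline : HasDerivAt (fun s : ℝ => (φ p).1 + s • b) b 0 := by
    simpa using ((hasDerivAt_id (0 : ℝ)).smul_const b).const_add (φ p).1
  have hcomp : HasDerivAt (fun s : ℝ => φ.symm ((φ p).1 + s • b, (φ p).2)) v 0 := by
    have := HasFDerivAt.comp_hasDerivAt (x := (0 : ℝ)) (f := fun s : ℝ => (φ p).1 + s • b)
      (by simpa using hd) hline
    rw [← hb]; exact this
  have h1 := (hasDerivAt_iff_isLittleO.1 hcomp).bound he
  have h2 : ∀ᶠ s : ℝ in 𝓝 0, ((φ p).1 + s • b, (φ p).2) ∈ φ.target := by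
    have : ContinuousAt (fun s : ℝ => ((φ p).1 + s • b, (φ p).2)) 0 := by fun_prop
    exact this.eventually (φ.open_target.mem_nhds (by simpa using htar))
  filter_upwards [nhdsWithin_le_nhds h1, nhdsWithin_le_nhds h2, self_mem_nhdsWithin]
    with s hs1 hs2 hs3
  refine ⟨_, ⟨φ.map_target hs2, by rw [φ.right_inv hs2]⟩, ?_⟩
  simp only [sub_zero, zero_smul, add_zero, hpp] at hs1
  rw [Real.norm_of_nonneg (le_of_lt hs3)] at hs1
  linarith

/-- The Peano theorem inside a plaque. -/
theorem HasC1Plaques.exists_integral_curve [FiniteDimensional ℝ E]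
    {φ : OpenPartialHomeomorph E (F × G)}
    {D : E → Submodule ℝ E} (h : HasC1Plaques φ D) {X : E → E} {O : Set E} (hO : IsOpen O)
    (hX : ContinuousOn X O) (hXD : ∀ y ∈ O, X y ∈ D y) {p : E} (hp : p ∈ φ.source) (hpO : p ∈ O) :
    ∃ s₀ > (0 : ℝ), ∃ σ : ℝ → E, σ 0 = p ∧ ∀ t ∈ Icc 0 s₀, σ t ∈ O ∧ σ t ∈ plaque φ p ∧
      HasDerivWithinAt σ (X (σ t)) (Icc 0 s₀) t := by
  set Φ : F → E := fun a => φ.symm (a, (φ p).2) with hΦ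
  set a₀ := (φ p).1 with ha₀
  have hpp : Φ a₀ = p := φ.left_inv hp
  set V : Set F := {a | (a, (φ p).2) ∈ φ.target} with hV
  have hVo : IsOpen V := φ.open_target.preimage (by fun_prop)
  have ha₀V : a₀ ∈ V := φ.map_source hp
  have hΦd : ∀ a ∈ V, ContDiffAt ℝ 1 Φ a := fun a ha => h.contDiffAt (a, (φ p).2) ha
  have hΦd' : ContDiffOn ℝ 1 Φ V := fun a ha => (hΦd a ha).contDiffWithinAt
  have hΦ'c : ContinuousOn (fderiv ℝ Φ) V := hΦd'.continuousOn_fderiv_of_isOpen hVo le_rfl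
  -- To pull `X` back to the parameter space, use a fixed left inverse of the derivative at `a₀`.
  -- Composed with the derivative at a nearby `a` it gives an invertible `T a`, and `Y a = (T a)⁻¹
  -- (g (X (Φ a)))` is a continuous field that `Φ` carries to `X`.
  obtain ⟨g, hg⟩ := (fderiv ℝ Φ a₀).toLinearMap.exists_leftInverse_of_injective
    (LinearMap.ker_eq_bot.2 (h.injective _ ha₀V))
  set gL : E →L[ℝ] F := g.toContinuousLinearMap with hgL
  have : CompleteSpace F := FiniteDimensional.complete ℝ F
  set T : F → F →L[ℝ] F := fun a => gL.comp (fderiv ℝ Φ a) with hT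
  have hTc : ContinuousOn T V := continuousOn_const.clm_comp hΦ'c
  have hT₀ : T a₀ = 1 := by
    ext v
    exact LinearMap.congr_fun hg v
  set V' : Set F := V ∩ (T ⁻¹' {A | IsUnit A}) with hV'
  have hV'o : IsOpen V' := hTc.isOpen_inter_preimage hVo Units.isOpen
  have hΦc : ContinuousOn Φ V' := fun a ha => ((hΦd a ha.1).continuousAt).continuousWithinAt
  set V'' : Set F := V' ∩ Φ ⁻¹' O with hV''
  have hV''o : IsOpen V'' := hΦc.isOpen_inter_preimage hV'o hO
  have ha₀V'' : a₀ ∈ V'' := by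
    refine ⟨⟨ha₀V, ?_⟩, by rw [mem_preimage, hpp]; exact hpO⟩
    change IsUnit (T a₀)
    rw [hT₀]; exact isUnit_one
  set Y : F → F := fun a => Ring.inverse (T a) (gL (X (Φ a))) with hY
  have hYc : ContinuousOn Y V'' := by
    refine ContinuousOn.clm_apply ?_ (gL.continuous.comp_continuousOn
      (hX.comp (hΦc.mono inter_subset_left) fun a ha => ha.2))
    intro a ha
    obtain ⟨u, hu⟩ : IsUnit (T a) := ha.1.2
    have h1 : ContinuousAt Ring.inverse (T a) := by
      rw [← hu]; exact NormedRing.inverse_continuousAt u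
    exact h1.comp_continuousWithinAt ((hTc a ha.1.1).mono (inter_subset_left.trans
      inter_subset_left))
  have hYX : ∀ a ∈ V'', fderiv ℝ Φ a (Y a) = X (Φ a) := by
    intro a ha
    have h1 : X (Φ a) ∈ D (Φ a) := hXD _ ha.2
    rw [hΦ, ← h.range_eq (a, (φ p).2) ha.1.1] at h1
    obtain ⟨u, hu⟩ := h1
    have hu' : fderiv ℝ Φ a u = X (Φ a) := hu
    have h2 : Y a = u := by
      have h3 : gL (X (Φ a)) = T a u := by rw [← hu']; rfl
      rw [hY]
      dsimp only
      rw [h3]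
      have h4 : Ring.inverse (T a) * T a = 1 := Ring.inverse_mul_cancel _ ha.1.2
      exact congrArg (fun A : F →L[ℝ] F => A u) h4
    rw [h2, hu']
  obtain ⟨s₀, hs₀, α, hα0, hα⟩ := exists_hasDerivWithinAt_of_continuousOn hV''o hYc ha₀V''
  refine ⟨s₀, hs₀, fun t => Φ (α t), (congrArg Φ hα0).trans hpp, fun t ht => ?_⟩
  obtain ⟨h1, h2⟩ := hα t ht
  refine ⟨h1.2, ⟨φ.map_target h1.1.1, by rw [hΦ, φ.right_inv h1.1.1]⟩, ?_⟩
  have h3 : HasFDerivAt Φ (fderiv ℝ Φ (α t)) (α t) :=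
    ((hΦd _ h1.1.1).differentiableAt one_ne_zero).hasFDerivAt
  rw [← hYX _ h1]
  exact h3.comp_hasDerivWithinAt t h2

/-! ### Projections onto continuous distributions -/

/-- `Q y` is a continuous family of projections with kernel `D y`. -/
structure IsKernelProjection (O : Set E) (D : E → Submodule ℝ E) (Q : E → E →L[ℝ] E) :
    Prop where
  isOpen : IsOpen O
  continuousOn : ContinuousOn Q O
  apply_eq_zero : ∀ y ∈ O, ∀ w ∈ D y, Q y w = 0
  sub_mem : ∀ y ∈ O, ∀ w, w - Q y w ∈ D y

/-- Plaques are flat at small scales, in terms of projections. -/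
theorem IsKernelProjection.eventually_norm_le [FiniteDimensional ℝ E] [FiniteDimensional ℝ G]
    {φ : OpenPartialHomeomorph E (F × G)} {D : E → Submodule ℝ E} {O : Set E}
    {Q : E → E →L[ℝ] E} (hQ : IsKernelProjection O D Q) (h : HasC1Plaques φ D) {z : E}
    (hz : z ∈ φ.source) (hzO : z ∈ O) {ε : ℝ} (hε : 0 < ε) :
    ∀ᶠ y : E × E in 𝓝 (z, z), (φ y.1).2 = (φ y.2).2 → ‖Q z (y.2 - y.1)‖ ≤ ε * ‖y.2 - y.1‖ := by
  have := h.eventually_norm_sub_le hz (1 - Q z) (fun w => hQ.sub_mem z hzO w) ?_ hε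
  · simpa using this
  · intro e he
    have h1 : ∀ᶠ y in 𝓝 z, ‖Q y - Q z‖ < e := by
      have h2 : Tendsto (fun y => ‖Q y - Q z‖) (𝓝 z) (𝓝 0) := by
        have := ((hQ.continuousOn.continuousAt (hQ.isOpen.mem_nhds hzO)).sub_const (Q z)).norm
        simpa [ContinuousAt] using this
      exact h2.eventually (gt_mem_nhds he)
    filter_upwards [h1, hQ.isOpen.mem_nhds hzO] with y hy hyO w hw
    have h3 : w - (1 - Q z) w = -((Q y - Q z) w) := by
      simp [hQ.apply_eq_zero y hyO w hw]
    rw [h3, norm_neg]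
    exact ((Q y - Q z).le_opNorm w).trans (mul_le_mul_of_nonneg_right hy.le (norm_nonneg _))

/-- First-order moves inside a plaque, in a direction of the model kernel. -/
theorem IsKernelProjection.exists_move {φ : OpenPartialHomeomorph E (F × G)}
    {D : E → Submodule ℝ E} {O : Set E} {Q : E → E →L[ℝ] E} (hQ : IsKernelProjection O D Q)
    (h : HasC1Plaques φ D) {y₀ a x : E} {ε e : ℝ} (ha : a ∈ φ.source) (haO : a ∈ O)
    (hx : Q y₀ x = 0) (hε : ‖Q a - Q y₀‖ ≤ ε) (he : 0 < e) :
    ∀ᶠ s in 𝓝[>] (0 : ℝ), ∃ a' ∈ plaque φ a, ‖a' - a - s • x‖ ≤ s * (ε * ‖x‖ + e) := by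
  filter_upwards [h.exists_move ha (hQ.sub_mem a haO x) he, self_mem_nhdsWithin] with s hs hs0
  obtain ⟨a', ha', hn⟩ := hs
  refine ⟨a', ha', ?_⟩
  have h1 : a' - a - s • x = (a' - a - s • (x - Q a x)) - s • (Q a x) := by module
  have h2 : ‖Q a x‖ ≤ ε * ‖x‖ := by
    have : Q a x = (Q a - Q y₀) x := by simp [hx]
    rw [this]
    exact ((Q a - Q y₀).le_opNorm x).trans (mul_le_mul_of_nonneg_right hε (norm_nonneg _))
  rw [h1]
  refine (norm_sub_le _ _).trans ?_
  rw [norm_smul, Real.norm_of_nonneg (le_of_lt hs0)]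
  have := mul_le_mul_of_nonneg_left h2 (le_of_lt hs0)
  linarith

/-- A continuous splitting `E = Ds ⊕ Dc ⊕ Du` over an open set, given by its projections. -/
structure IsLocalSplitting (O : Set E) (Ds Dc Du : E → Submodule ℝ E)
    (Ps Pc Pu : E → E →L[ℝ] E) : Prop where
  isOpen : IsOpen O
  continuousOn_s : ContinuousOn Ps O
  continuousOn_c : ContinuousOn Pc O
  continuousOn_u : ContinuousOn Pu O
  add_eq : ∀ y ∈ O, ∀ w, Ps y w + Pc y w + Pu y w = w
  mem_s : ∀ y ∈ O, ∀ w, Ps y w ∈ Ds y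
  mem_c : ∀ y ∈ O, ∀ w, Pc y w ∈ Dc y
  mem_u : ∀ y ∈ O, ∀ w, Pu y w ∈ Du y
  of_mem_s : ∀ y ∈ O, ∀ w ∈ Ds y, Pc y w = 0 ∧ Pu y w = 0
  of_mem_c : ∀ y ∈ O, ∀ w ∈ Dc y, Ps y w = 0 ∧ Pu y w = 0
  of_mem_u : ∀ y ∈ O, ∀ w ∈ Du y, Ps y w = 0 ∧ Pc y w = 0

namespace IsLocalSplitting

variable {O : Set E} {Ds Dc Du : E → Submodule ℝ E} {Ps Pc Pu : E → E →L[ℝ] E}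

theorem cs (h : IsLocalSplitting O Ds Dc Du Ps Pc Pu) :
    IsKernelProjection O (fun y => Ds y ⊔ Dc y) Pu where
  isOpen := h.isOpen
  continuousOn := h.continuousOn_u
  apply_eq_zero y hy w hw := by
    obtain ⟨a, ha, b, hb, rfl⟩ := Submodule.mem_sup.1 hw
    rw [map_add, (h.of_mem_s y hy a ha).2, (h.of_mem_c y hy b hb).2, add_zero]
  sub_mem y hy w := by
    have : w - Pu y w = Ps y w + Pc y w := by
      rw [sub_eq_iff_eq_add]; exact (h.add_eq y hy w).symm
    rw [this]
    exact Submodule.add_mem_sup (h.mem_s y hy w) (h.mem_c y hy w)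

theorem cu (h : IsLocalSplitting O Ds Dc Du Ps Pc Pu) :
    IsKernelProjection O (fun y => Dc y ⊔ Du y) Ps where
  isOpen := h.isOpen
  continuousOn := h.continuousOn_s
  apply_eq_zero y hy w hw := by
    obtain ⟨a, ha, b, hb, rfl⟩ := Submodule.mem_sup.1 hw
    rw [map_add, (h.of_mem_c y hy a ha).1, (h.of_mem_u y hy b hb).1, add_zero]
  sub_mem y hy w := by
    have : w - Ps y w = Pc y w + Pu y w := by
      rw [sub_eq_iff_eq_add, add_comm, ← add_assoc]; exact (h.add_eq y hy w).symm
    rw [this]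
    exact Submodule.add_mem_sup (h.mem_c y hy w) (h.mem_u y hy w)

end IsLocalSplitting

end PartialHyperbolicity

namespace PartialHyperbolicity

open Metric

set_option linter.unusedSectionVars false

/-! ### Local product structure -/

variable {E Fs Gs Fu Gu : Type*} [NormedAddCommGroup E] [NormedSpace ℝ E] [FiniteDimensional ℝ E]
  [NormedAddCommGroup Fs] [NormedSpace ℝ Fs] [FiniteDimensional ℝ Fs]
  [NormedAddCommGroup Gs] [NormedSpace ℝ Gs] [FiniteDimensional ℝ Gs]
  [NormedAddCommGroup Fu] [NormedSpace ℝ Fu] [FiniteDimensional ℝ Fu]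
  [NormedAddCommGroup Gu] [NormedSpace ℝ Gu] [FiniteDimensional ℝ Gu]

/-- A continuous splitting with one-dimensional center, and foliation charts with plaques tangent
to the center-stable and center-unstable distributions. -/
structure IsLocallyCoherent (O : Set E) (Ds Dc Du : E → Submodule ℝ E)
    (Ps Pc Pu : E → E →L[ℝ] E) (φs : OpenPartialHomeomorph E (Fs × Gs))
    (φu : OpenPartialHomeomorph E (Fu × Gu)) : Prop extends
    IsLocalSplitting O Ds Dc Du Ps Pc Pu where
  plaques_s : HasC1Plaques φs (fun y => Ds y ⊔ Dc y)
  plaques_u : HasC1Plaques φu (fun y => Dc y ⊔ Du y)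
  finrank_c : ∀ y ∈ O, Module.finrank ℝ (Dc y) = 1

namespace IsLocalSplitting

variable {O : Set E} {Ds Dc Du : E → Submodule ℝ E} {Ps Pc Pu : E → E →L[ℝ] E} {y : E}

theorem apply_s (h : IsLocalSplitting O Ds Dc Du Ps Pc Pu) (hy : y ∈ O) {w : E}
    (hw : w ∈ Ds y) : Ps y w = w := by
  have := h.add_eq y hy w
  rwa [(h.of_mem_s y hy w hw).1, (h.of_mem_s y hy w hw).2, add_zero, add_zero] at this

theorem apply_c (h : IsLocalSplitting O Ds Dc Du Ps Pc Pu) (hy : y ∈ O) {w : E}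
    (hw : w ∈ Dc y) : Pc y w = w := by
  have := h.add_eq y hy w
  rwa [(h.of_mem_c y hy w hw).1, (h.of_mem_c y hy w hw).2, add_zero, zero_add] at this

theorem apply_u (h : IsLocalSplitting O Ds Dc Du Ps Pc Pu) (hy : y ∈ O) {w : E}
    (hw : w ∈ Du y) : Pu y w = w := by
  have := h.add_eq y hy w
  rwa [(h.of_mem_u y hy w hw).1, (h.of_mem_u y hy w hw).2, add_zero, zero_add] at this

/-- One-dimensionality of the center turns the center component into a single real coordinate `l`,
by which center plaques are parametrised. -/
theorem exists_functional (h : IsLocalSplitting O Ds Dc Du Ps Pc Pu) (hy : y ∈ O)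
    (hc : Module.finrank ℝ (Dc y) = 1) :
    ∃ (e₀ : E) (l : E →L[ℝ] ℝ), e₀ ∈ Dc y ∧ l e₀ = 1 ∧ ∀ w, Pc y w = l w • e₀ := by
  obtain ⟨⟨e₀, he₀⟩, hne, hspan⟩ := finrank_eq_one_iff'.1 hc
  have hne' : e₀ ≠ 0 := fun h => hne (Subtype.ext h)
  obtain ⟨g, hg⟩ := SeparatingDual.exists_eq_one (R := ℝ) hne'
  refine ⟨e₀, g.comp (Pc y), he₀, ?_, fun w => ?_⟩
  · simp [h.apply_c hy he₀, hg]
  · obtain ⟨c, hc⟩ := hspan ⟨Pc y w, h.mem_c y hy w⟩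
    have hc' : c • e₀ = Pc y w := congrArg Subtype.val hc
    simp [← hc', hg]

end IsLocalSplitting

namespace IsLocallyCoherent

variable {O : Set E} {Ds Dc Du : E → Submodule ℝ E} {Ps Pc Pu : E → E →L[ℝ] E}
  {φs : OpenPartialHomeomorph E (Fs × Gs)} {φu : OpenPartialHomeomorph E (Fu × Gu)} {y₀ : E}

/-- A ball on which the splitting is almost constant and the plaques are almost flat. -/
theorem exists_radius (h : IsLocallyCoherent O Ds Dc Du Ps Pc Pu φs φu) (hO : y₀ ∈ O)
    (hs : y₀ ∈ φs.source) (hu : y₀ ∈ φu.source) {ε r₀ : ℝ} (hε : 0 < ε) (hr₀ : 0 < r₀) :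
    ∃ r > 0, r ≤ r₀ ∧ closedBall y₀ r ⊆ O ∧ closedBall y₀ r ⊆ φs.source ∧
      closedBall y₀ r ⊆ φu.source ∧
      (∀ y ∈ closedBall y₀ r, ‖Ps y - Ps y₀‖ ≤ ε ∧ ‖Pu y - Pu y₀‖ ≤ ε) ∧
      ∀ p ∈ closedBall y₀ r, ∀ q ∈ closedBall y₀ r,
        ((φs p).2 = (φs q).2 → ‖Pu y₀ (q - p)‖ ≤ ε * ‖q - p‖) ∧
        ((φu p).2 = (φu q).2 → ‖Ps y₀ (q - p)‖ ≤ ε * ‖q - p‖) := by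
  have hP : ∀ P : E → E →L[ℝ] E, ContinuousOn P O → ∀ᶠ y in 𝓝 y₀, ‖P y - P y₀‖ < ε := by
    intro P hP
    have h2 : Tendsto (fun y => ‖P y - P y₀‖) (𝓝 y₀) (𝓝 0) := by
      have := ((hP.continuousAt (h.isOpen.mem_nhds hO)).sub_const (P y₀)).norm
      simpa [ContinuousAt] using this
    exact h2.eventually (gt_mem_nhds hε)
  have h1 : ∀ᶠ y in 𝓝 y₀, (y ∈ O ∧ y ∈ φs.source ∧ y ∈ φu.source) ∧
      ‖Ps y - Ps y₀‖ < ε ∧ ‖Pu y - Pu y₀‖ < ε := by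
    filter_upwards [h.isOpen.mem_nhds hO, φs.open_source.mem_nhds hs, φu.open_source.mem_nhds hu,
      hP Ps h.continuousOn_s, hP Pu h.continuousOn_u] with y a b c d e
    exact ⟨⟨a, b, c⟩, d, e⟩
  have h2 := h.cs.eventually_norm_le h.plaques_s hs hO hε
  have h3 := h.cu.eventually_norm_le h.plaques_u hu hO hε
  rw [nhds_prod_eq] at h2 h3
  obtain ⟨V, hV, hVm⟩ := eventually_prod_self_iff'.1 (h2.and h3)
  obtain ⟨r, hr, hrb⟩ := Metric.nhds_basis_closedBall.mem_iff.1 (inter_mem h1 hV)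
  have hsub : closedBall y₀ (min r r₀) ⊆ closedBall y₀ r :=
    closedBall_subset_closedBall (min_le_left _ _)
  refine ⟨min r r₀, by positivity, min_le_right _ _, fun y hy => (hrb (hsub hy)).1.1.1,
    fun y hy => (hrb (hsub hy)).1.1.2.1, fun y hy => (hrb (hsub hy)).1.1.2.2,
    fun y hy => ⟨(hrb (hsub hy)).1.2.1.le, (hrb (hsub hy)).1.2.2.le⟩, fun p hp q hq => ?_⟩
  exact hVm p (hrb (hsub hp)).2 q (hrb (hsub hq)).2

/-- Center plaques contain points with arbitrary nearby center coordinate. -/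
theorem exists_center_point (h : IsLocallyCoherent O Ds Dc Du Ps Pc Pu φs φu) (hO : y₀ ∈ O)
    (hs : y₀ ∈ φs.source) (hu : y₀ ∈ φu.source) {e₀ : E} {l : E →L[ℝ] ℝ} (he₀ : l e₀ = 1)
    (hl : ∀ w, Pc y₀ w = l w • e₀) {η : ℝ} (hη : 0 < η) :
    ∃ δ > 0, ∀ p ∈ ball y₀ δ, ∀ τ : ℝ, |τ| ≤ δ →
      ∃ z ∈ plaque φs p ∩ plaque φu p, ‖z - p‖ ≤ η ∧ l z = l p + τ := by
  have hne : e₀ ≠ 0 := by rintro rfl; simp at he₀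
  -- In `E × E` every `w` splits exactly as `(w.1 - v w, w.2 - v w) + (v w, v w)`. The first summand
  -- is tangent to center-stable × center-unstable, the second to the diagonal, along which `l` does
  -- not change.
  set v : E × E → E := fun w => Pu y₀ w.1 + Ps y₀ w.2 with hv
  set K : ℝ := 1 + ‖Pu y₀‖ + ‖Ps y₀‖ with hK
  have hK1 : 1 ≤ K := by rw [hK]; linarith [norm_nonneg (Pu y₀), norm_nonneg (Ps y₀)]
  have hvK : ∀ w, ‖v w‖ ≤ (‖Pu y₀‖ + ‖Ps y₀‖) * ‖w‖ := by
    intro w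
    refine (norm_add_le _ _).trans ?_
    rw [add_mul]
    exact add_le_add
      (((Pu y₀).le_opNorm _).trans (mul_le_mul_of_nonneg_left (norm_fst_le w) (norm_nonneg _)))
      (((Ps y₀).le_opNorm _).trans (mul_le_mul_of_nonneg_left (norm_snd_le w) (norm_nonneg _)))
  have hlv : ∀ w, l (v w) = 0 := by
    intro w
    have h1 : Pc y₀ (v w) = 0 := by
      rw [hv, map_add, (h.of_mem_u y₀ hO _ (h.mem_u y₀ hO _)).2,
        (h.of_mem_s y₀ hO _ (h.mem_s y₀ hO _)).1, add_zero]
    rw [hl] at h1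
    exact (smul_eq_zero.1 h1).resolve_right hne
  have hPux : ∀ w : E × E, Pu y₀ (w.1 - v w) = 0 := by
    intro w
    rw [hv, map_sub, map_add, h.apply_u hO (h.mem_u y₀ hO _),
      (h.of_mem_s y₀ hO _ (h.mem_s y₀ hO _)).2, add_zero, sub_self]
  have hPsx : ∀ w : E × E, Ps y₀ (w.2 - v w) = 0 := by
    intro w
    rw [hv, map_sub, map_add, h.apply_s hO (h.mem_s y₀ hO _),
      (h.of_mem_u y₀ hO _ (h.mem_u y₀ hO _)).1, zero_add, sub_self]
  set ε : ℝ := 1 / (8 * K) with hε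
  have hε0 : 0 < ε := by positivity
  have hεK : ε * K ≤ 1 / 8 := by
    rw [hε]; apply le_of_eq; field_simp
  obtain ⟨r, hr, -, hrO, hrs, hru, hrP, -⟩ := h.exists_radius hO hs hu hε0 zero_lt_one
  set ρ : ℝ := min (r / 2) η with hρ
  have hρ0 : 0 < ρ := by positivity
  set δ : ℝ := min (r / 4) (min (r / (8 * (‖e₀‖ + 1))) (ρ / (8 * (K + 1) * (‖e₀‖ + 1)))) with hδ
  have hδ0 : 0 < δ := by positivity
  refine ⟨δ, hδ0, fun p hp τ hτ => ?_⟩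
  have hτ1 : |τ| * ‖e₀‖ ≤ r / 8 := by
    have : |τ| ≤ r / (8 * (‖e₀‖ + 1)) := hτ.trans ((min_le_right _ _).trans (min_le_left _ _))
    calc |τ| * ‖e₀‖ ≤ r / (8 * (‖e₀‖ + 1)) * (‖e₀‖ + 1) := by
          apply mul_le_mul this (by linarith) (norm_nonneg _) (by positivity)
      _ = r / 8 := by field_simp
  have hτ2 : 4 * (K + 1) * (|τ| * ‖e₀‖) < ρ := by
    have : |τ| ≤ ρ / (8 * (K + 1) * (‖e₀‖ + 1)) :=
      hτ.trans ((min_le_right _ _).trans (min_le_right _ _))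
    calc 4 * (K + 1) * (|τ| * ‖e₀‖)
        ≤ 4 * (K + 1) * (ρ / (8 * (K + 1) * (‖e₀‖ + 1)) * (‖e₀‖ + 1)) := by
          refine mul_le_mul_of_nonneg_left ?_ (by positivity)
          exact mul_le_mul this (by linarith) (norm_nonneg _) (by positivity)
      _ = ρ / 2 := by field_simp; norm_num
      _ < ρ := by linarith
  have hpr : dist p y₀ < r / 4 := (mem_ball.1 hp).trans_le (min_le_left _ _)
  have hpB : p ∈ closedBall y₀ r := by rw [mem_closedBall]; linarith
  have hpq : dist (p + τ • e₀) y₀ < r / 2 := by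
    rw [dist_eq_norm]
    have : p + τ • e₀ - y₀ = (p - y₀) + τ • e₀ := by abel
    rw [this]
    refine (norm_add_le _ _).trans_lt ?_
    rw [norm_smul, Real.norm_eq_abs, ← dist_eq_norm]
    linarith
  -- The product of the two plaques of `p` is intersected with the part of the diagonal at height `l
  -- p + τ`. The starting points `(p, p)` and `(p + τ • e₀, p + τ • e₀)` are at distance `|τ| *
  -- ‖e₀‖`. The cost coordinate is free here.
  obtain ⟨a, m, haA, haB, had, -⟩ := exists_mem_inter_of_moves (F := E × E)
    (A := {x | x.1.1 ∈ plaque φs p ∧ x.1.2 ∈ plaque φu p})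
    (B := {x | x.1 = x.2 ∧ l x.1 = l p + τ}) (y₀ := (y₀, y₀)) (r := r) (ρ := ρ) (K := K) (ε := ε)
    (by
      have h1 := (isClosed_plaque_inter (isClosed_closedBall (x := y₀) (ε := r)) hrs p).preimage
        (continuous_fst.comp continuous_fst : Continuous fun x : (E × E) × ℝ => x.1.1)
      have h2 := (isClosed_plaque_inter (isClosed_closedBall (x := y₀) (ε := r)) hru p).preimage
        (continuous_snd.comp continuous_fst : Continuous fun x : (E × E) × ℝ => x.1.2)
      convert! h1.inter h2 using 1
      ext x
      rw [← closedBall_prod_same]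
      constructor
      · rintro ⟨⟨h3, h4⟩, ⟨h5, h6⟩, -⟩; exact ⟨⟨h3, h5⟩, h4, h6⟩
      · rintro ⟨⟨h3, h5⟩, h4, h6⟩; exact ⟨⟨h3, h4⟩, ⟨h5, h6⟩, trivial⟩)
    (by
      refine IsClosed.inter (IsClosed.inter (isClosed_eq continuous_fst continuous_snd) ?_)
        isClosed_closedBall
      exact isClosed_eq (l.continuous.comp continuous_fst) continuous_const)
    (fun w => (w.1 - v w, w.2 - v w)) (fun w => (v w, v w)) (by positivity)
    (by
      intro w
      have h1 := hvK w
      refine max_le ?_ ?_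
      · refine (norm_sub_le _ _).trans ?_
        have := norm_fst_le w
        rw [hK]; linarith
      · refine (norm_sub_le _ _).trans ?_
        have := norm_snd_le w
        rw [hK]; linarith)
    (by
      intro w
      have h1 := hvK w
      have : ‖v w‖ ≤ K * ‖w‖ := by
        refine h1.trans ?_
        rw [hK]; linarith [norm_nonneg w]
      exact max_le this this)
    hε0.le hεK
    (by
      intro a m b _ _ _ _
      have : (b - a) - ((b - a).1 - v (b - a), (b - a).2 - v (b - a)) - (v (b - a), v (b - a))
          = 0 := by
        ext <;> simp
      rw [this, norm_zero]
      positivity)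
    (by
      rintro ⟨a, b⟩ m ⟨ha, hb⟩ hab w e he
      dsimp only at ha hb
      rw [← ball_prod_same] at hab
      have haB := ball_subset_closedBall hab.1
      have hbB := ball_subset_closedBall hab.2
      filter_upwards [h.cs.exists_move h.plaques_s ha.1 (hrO haB) (hPux w) (hrP a haB).2 he,
        h.cu.exists_move h.plaques_u hb.1 (hrO hbB) (hPsx w) (hrP b hbB).1 he,
        self_mem_nhdsWithin] with s hs1 hs2 hs0
      obtain ⟨a', ha', han⟩ := hs1
      obtain ⟨b', hb', hbn⟩ := hs2
      have hs0' : (0 : ℝ) ≤ s := le_of_lt hs0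
      refine ⟨(a', b'), ⟨⟨ha'.1, ha'.2.trans ha.2⟩, ⟨hb'.1, hb'.2.trans hb.2⟩⟩, ?_⟩
      refine max_le ?_ ?_
      · refine han.trans (mul_le_mul_of_nonneg_left ?_ hs0')
        gcongr
        exact norm_fst_le (w.1 - v w, w.2 - v w)
      · refine hbn.trans (mul_le_mul_of_nonneg_left ?_ hs0')
        gcongr
        exact norm_snd_le (w.1 - v w, w.2 - v w))
    (by
      rintro ⟨y, y'⟩ ⟨hyy, hly⟩ - w e he
      dsimp only at hyy hly
      subst hyy
      filter_upwards [self_mem_nhdsWithin] with s hs0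
      have hs0' : (0 : ℝ) ≤ s := le_of_lt hs0
      refine ⟨(y - s • v w, y - s • v w), ⟨rfl, by simp [hlv w, hly]⟩, ?_⟩
      have : ((y - s • v w, y - s • v w) : E × E) - (y, y) + s • (v w, v w) = 0 := by
        ext <;> simp
      rw [this, norm_zero]
      positivity)
    (a₀ := (p, p)) (b₀ := (p + τ • e₀, p + τ • e₀)) (m₀ := 0)
    ⟨⟨hrs hpB, rfl⟩, ⟨hru hpB, rfl⟩⟩ ⟨rfl, by simp [he₀]⟩
    (by rw [Prod.dist_eq]; exact max_lt (by linarith) (by linarith))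
    (by rw [Prod.dist_eq]; exact max_lt hpq hpq) (min_le_left _ _)
    (by
      have : ‖((p + τ • e₀, p + τ • e₀) : E × E) - (p, p)‖ = |τ| * ‖e₀‖ := by
        simp [Prod.norm_def, norm_smul]
      rw [this]; exact hτ2)
  obtain ⟨z, z'⟩ := a
  obtain ⟨hzz, hlz⟩ := haB
  dsimp only at hzz hlz
  subst hzz
  refine ⟨z, ⟨haA.1, haA.2⟩, ?_, hlz⟩
  rw [← dist_eq_norm]
  rw [Prod.dist_eq] at had
  exact (le_max_left _ _).trans (had.trans (min_le_right _ _))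

/-- When the stable and unstable components are each at most a quarter of `w`, the center component
carries at least half of `‖w‖`. Thus `l` controls displacements between points lying in the same
plaque of both foliations, and in particular separates them. -/
theorem norm_sub_le_of_mem (h : IsLocallyCoherent O Ds Dc Du Ps Pc Pu φs φu) (hO : y₀ ∈ O)
    {e₀ : E} {l : E →L[ℝ] ℝ} (hl : ∀ w, Pc y₀ w = l w • e₀) {ε : ℝ} (hε : ε ≤ 1 / 4) {w : E}
    (h1 : ‖Pu y₀ w‖ ≤ ε * ‖w‖) (h2 : ‖Ps y₀ w‖ ≤ ε * ‖w‖) :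
    ‖w‖ ≤ 2 * (|l w| * ‖e₀‖) ∧ ‖w - l w • e₀‖ ≤ 4 * ε * (|l w| * ‖e₀‖) := by
  have h3 : w - l w • e₀ = Ps y₀ w + Pu y₀ w := by
    rw [← hl]
    nth_rewrite 1 [← h.add_eq y₀ hO w]
    abel
  have h4 : ‖w - l w • e₀‖ ≤ 2 * ε * ‖w‖ := by
    rw [h3]; exact (norm_add_le _ _).trans (by linarith)
  have h5 : ‖w‖ ≤ ‖w - l w • e₀‖ + |l w| * ‖e₀‖ := by
    have := norm_add_le (w - l w • e₀) (l w • e₀)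
    rwa [sub_add_cancel, norm_smul, Real.norm_eq_abs] at this
  have h6 : 2 * ε * ‖w‖ ≤ 2 * (1 / 4) * ‖w‖ := by gcongr
  have h7 : ‖w‖ ≤ 2 * (|l w| * ‖e₀‖) := by linarith
  refine ⟨h7, ?_⟩
  rcases le_or_gt 0 ε with h0 | h0
  · exact h4.trans (by nlinarith)
  · have h8 : ‖w‖ = 0 := by
      have := norm_nonneg (Pu y₀ w)
      nlinarith [norm_nonneg w]
    rw [norm_eq_zero] at h8
    simp [h8]

/-- Nearby points of a center plaque are joined by a short `C^1` curve in the center plaque. -/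
theorem exists_center_curve (h : IsLocallyCoherent O Ds Dc Du Ps Pc Pu φs φu) (hO : y₀ ∈ O)
    (hs : y₀ ∈ φs.source) (hu : y₀ ∈ φu.source) {N : Set E} (hN : N ∈ 𝓝 y₀) {η : ℝ}
    (hη : 0 < η) :
    ∀ᶠ x : E × E in 𝓝 (y₀, y₀), x.2 ∈ plaque φs x.1 ∩ plaque φu x.1 →
      ∃ Γ Γ' : ℝ → E, Γ 0 = x.1 ∧ Γ 1 = x.2 ∧ ContinuousOn Γ' (Icc 0 1) ∧
        ∀ t ∈ Icc (0 : ℝ) 1, HasDerivWithinAt Γ (Γ' t) (Icc 0 1) t ∧ ‖Γ' t‖ ≤ η ∧ Γ t ∈ N ∧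
          Γ t ∈ plaque φs x.1 ∩ plaque φu x.1 := by
  obtain ⟨e₀, l, -, he₀, hl⟩ := h.exists_functional hO (h.finrank_c y₀ hO)
  have hl₀ : Pc y₀ e₀ = e₀ := by rw [hl, he₀, one_smul]
  have hec : ContinuousOn (fun y => Pc y e₀) O := h.continuousOn_c.clm_apply continuousOn_const
  have hev : ∀ᶠ y in 𝓝 y₀, y ∈ N ∧ 1 / 2 < l (Pc y e₀) ∧ ‖Pc y e₀‖ < ‖e₀‖ + 1 := by
    have hca : ContinuousAt (fun y => Pc y e₀) y₀ := hec.continuousAt (h.isOpen.mem_nhds hO)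
    have h1 : ∀ᶠ y in 𝓝 y₀, 1 / 2 < l (Pc y e₀) := by
      refine (l.continuous.continuousAt.comp hca).eventually (lt_mem_nhds ?_)
      simp only [Function.comp_apply, hl₀, he₀]; norm_num
    have h2 : ∀ᶠ y in 𝓝 y₀, ‖Pc y e₀‖ < ‖e₀‖ + 1 := by
      refine hca.norm.eventually (gt_mem_nhds ?_)
      simp only [hl₀]; linarith
    filter_upwards [hN, h1, h2] with y a b c using ⟨a, b, c⟩
  obtain ⟨r₀, hr₀, hr₀b⟩ := Metric.nhds_basis_closedBall.mem_iff.1 hev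
  obtain ⟨r, hr, hrr₀, hrO, hrs, hru, -, hrf⟩ :=
    h.exists_radius hO hs hu (show (0 : ℝ) < 1 / 4 by norm_num) hr₀
  have hgood : ∀ y ∈ closedBall y₀ r, y ∈ N ∧ 1 / 2 < l (Pc y e₀) ∧ ‖Pc y e₀‖ < ‖e₀‖ + 1 :=
    fun y hy => hr₀b (closedBall_subset_closedBall hrr₀ hy)
  have hsep : ∀ a ∈ closedBall y₀ r, ∀ b ∈ closedBall y₀ r, (φs a).2 = (φs b).2 →
      (φu a).2 = (φu b).2 → ‖b - a‖ ≤ 2 * (|l (b - a)| * ‖e₀‖) := fun a ha b hb h1 h2 =>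
    (h.norm_sub_le_of_mem hO hl le_rfl ((hrf a ha b hb).1 h1) ((hrf a ha b hb).2 h2)).1
  obtain ⟨δ, hδ, hδc⟩ := h.exists_center_point hO hs hu he₀ hl
    (show 0 < r / 4 by positivity)
  have hdiff : ∀ᶠ x : E × E in 𝓝 (y₀, y₀), |l (x.2 - x.1)| < δ ∧
      |l (x.2 - x.1)| * (2 * (‖e₀‖ + 1)) < η := by
    have h1 : Tendsto (fun x : E × E => |l (x.2 - x.1)|) (𝓝 (y₀, y₀)) (𝓝 0) := by
      have : Continuous fun x : E × E => |l (x.2 - x.1)| := by fun_prop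
      simpa using this.tendsto (y₀, y₀)
    have h2 := h1.mul_const (2 * (‖e₀‖ + 1))
    rw [zero_mul] at h2
    exact (h1.eventually (gt_mem_nhds hδ)).and (h2.eventually (gt_mem_nhds hη))
  filter_upwards [hdiff, prod_mem_nhds (ball_mem_nhds y₀ hδ) (univ_mem),
    prod_mem_nhds (ball_mem_nhds y₀ (show 0 < r / 4 by positivity))
      (ball_mem_nhds y₀ (show 0 < r / 4 by positivity))]
  rintro ⟨p, q⟩ ⟨hτδ, hτη⟩ ⟨hpδ, -⟩ ⟨hpr, hqr⟩ ⟨hqs, hqu⟩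
  dsimp only at hτδ hτη hpδ hpr hqr hqs hqu ⊢
  set τ := l (q - p) with hτ
  rw [mem_ball] at hpr hqr
  have hpB : p ∈ closedBall y₀ r := by rw [mem_closedBall]; linarith
  have hqB : q ∈ closedBall y₀ r := by rw [mem_closedBall]; linarith
  have hex : ∀ t ∈ Icc (0 : ℝ) 1, ∃ z ∈ plaque φs p ∩ plaque φu p, ‖z - p‖ ≤ r / 4 ∧
      l z = l p + t * τ := by
    intro t ht
    refine hδc p hpδ (t * τ) ?_
    rw [abs_mul, abs_of_nonneg ht.1]
    exact (mul_le_of_le_one_left (abs_nonneg _) ht.2).trans hτδ.le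
  -- The center plaque is parametrised by its center coordinate, which runs linearly from `l p` to
  -- `l q`. By `hsep` the point at each height is unique, so `Γ` is Lipschitz and has the right
  -- endpoints.
  choose! Γ hΓp hΓn hΓl using hex
  have hΓB : ∀ t ∈ Icc (0 : ℝ) 1, Γ t ∈ closedBall y₀ r := by
    intro t ht
    have := hΓn t ht
    rw [← dist_eq_norm] at this
    rw [mem_closedBall]
    linarith [dist_triangle (Γ t) p y₀]
  have hlip : ∀ t ∈ Icc (0 : ℝ) 1, ∀ t' ∈ Icc (0 : ℝ) 1,
      ‖Γ t' - Γ t‖ ≤ 2 * (|τ| * ‖e₀‖) * |t' - t| := by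
    intro t ht t' ht'
    refine (hsep _ (hΓB t ht) _ (hΓB t' ht') ((hΓp t ht).1.2.trans (hΓp t' ht').1.2.symm)
      ((hΓp t ht).2.2.trans (hΓp t' ht').2.2.symm)).trans (le_of_eq ?_)
    rw [map_sub, hΓl t ht, hΓl t' ht', show l p + t' * τ - (l p + t * τ) = (t' - t) * τ by ring,
      abs_mul]
    ring
  have h01 : (0 : ℝ) ∈ Icc (0 : ℝ) 1 := by simp
  have h11 : (1 : ℝ) ∈ Icc (0 : ℝ) 1 := by simp
  have hΓ0 : Γ 0 = p := by
    have := hsep p hpB _ (hΓB 0 h01) (hΓp 0 h01).1.2.symm (hΓp 0 h01).2.2.symm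
    rw [map_sub, hΓl 0 h01] at this
    simpa [sub_eq_zero] using this
  have hΓ1 : Γ 1 = q := by
    have := hsep q hqB _ (hΓB 1 h11) (hqs.2.trans (hΓp 1 h11).1.2.symm)
      (hqu.2.trans (hΓp 1 h11).2.2.symm)
    rw [map_sub, hΓl 1 h11, hτ, map_sub] at this
    simpa [sub_eq_zero] using this
  -- The center direction at `y`, normalised so that `l (V y) = 1`. As `l ∘ Γ` has constant speed
  -- `τ`, the velocity has to be `τ • V (Γ t)`.
  set V : E → E := fun y => (l (Pc y e₀))⁻¹ • Pc y e₀ with hV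
  have hVc : ContinuousOn V (closedBall y₀ r) := by
    have h1 := hec.mono hrO
    refine ContinuousOn.smul (ContinuousOn.inv₀ (l.continuous.comp_continuousOn h1) ?_) h1
    intro y hy
    have := (hgood y hy).2.1
    exact (by linarith : (0 : ℝ) < l (Pc y e₀)).ne'
  have hVn : ∀ y ∈ closedBall y₀ r, ‖V y‖ ≤ 2 * (‖e₀‖ + 1) := by
    intro y hy
    obtain ⟨-, h1, h2⟩ := hgood y hy
    rw [hV]
    dsimp only
    rw [norm_smul, norm_inv, Real.norm_of_nonneg (by linarith)]
    refine mul_le_mul ?_ h2.le (norm_nonneg _) (by norm_num)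
    rw [inv_le_comm₀ (by linarith) (by norm_num)]
    linarith
  have hΓc : ContinuousOn Γ (Icc 0 1) := by
    intro t ht
    rw [ContinuousWithinAt, tendsto_iff_norm_sub_tendsto_zero]
    have h1 : Tendsto (fun t' => 2 * (|τ| * ‖e₀‖) * |t' - t|) (𝓝[Icc 0 1] t) (𝓝 0) := by
      have : Continuous fun t' : ℝ => 2 * (|τ| * ‖e₀‖) * |t' - t| := by fun_prop
      simpa using (this.tendsto t).mono_left nhdsWithin_le_nhds
    refine squeeze_zero' (Eventually.of_forall fun _ => norm_nonneg _) ?_ h1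
    filter_upwards [self_mem_nhdsWithin] with t' ht' using hlip t ht t' ht'
  refine ⟨Γ, fun t => τ • V (Γ t), hΓ0, hΓ1,
    continuousOn_const.smul (hVc.comp hΓc fun t ht => hΓB t ht), fun t ht => ⟨?_, ?_,
      (hgood _ (hΓB t ht)).1, hΓp t ht⟩⟩
  · have hzB := hΓB t ht
    set z := Γ t with hz
    rw [hasDerivWithinAt_iff_isLittleO, Asymptotics.isLittleO_iff]
    intro c hc
    set M : ℝ := (1 + ‖l‖ * ‖V z‖) * (4 * (|τ| * ‖e₀‖)) + 1 with hM
    have hM0 : 0 < M := by positivity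
    have hcM : 0 < c / M := by positivity
    have h1 := h.cs.eventually_norm_le h.plaques_s (hrs hzB) (hrO hzB) hcM
    have h2 := h.cu.eventually_norm_le h.plaques_u (hru hzB) (hrO hzB) hcM
    have htend : Tendsto (fun t' => (z, Γ t')) (𝓝[Icc 0 1] t) (𝓝 (z, z)) :=
      tendsto_const_nhds.prodMk_nhds (hΓc t ht)
    filter_upwards [htend.eventually h1, htend.eventually h2, self_mem_nhdsWithin]
      with t' hu' hs' ht'
    have hu' := hu' ((hΓp t ht).1.2.trans (hΓp t' ht').1.2.symm)
    have hs' := hs' ((hΓp t ht).2.2.trans (hΓp t' ht').2.2.symm)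
    set Δ := Γ t' - z with hΔ
    obtain ⟨-, hl1, -⟩ := hgood z hzB
    have hezne : Pc z e₀ ≠ 0 := by
      intro h0
      rw [h0, map_zero] at hl1
      linarith
    obtain ⟨s, hs⟩ : ∃ s : ℝ, s • Pc z e₀ = Pc z Δ := by
      have hf := h.finrank_c z (hrO hzB)
      have := (finrank_eq_one_iff_of_nonzero' (⟨Pc z e₀, h.mem_c z (hrO hzB) e₀⟩ : Dc z)
        (fun h0 => hezne (congrArg Subtype.val h0))).1 hf ⟨Pc z Δ, h.mem_c z (hrO hzB) Δ⟩
      obtain ⟨s, hs⟩ := this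
      exact ⟨s, congrArg Subtype.val hs⟩
    have hlΔ : l Δ = (t' - t) * τ := by
      rw [hΔ, map_sub, hΓl t ht, hΓl t' ht']; ring
    set R := Ps z Δ + Pu z Δ with hR
    have hdec : Δ = s • Pc z e₀ + R := by
      rw [hs, hR]
      nth_rewrite 1 [← h.add_eq z (hrO hzB) Δ]
      abel
    -- Since `Δ` and `(t' - t) • τ • V z` have the same coordinate `l`, only the non-center part `R`
    -- of `Δ` contributes to the error. Flatness of both plaques at `z` makes `R` small compared
    -- with `Δ`, hence with `t' - t`.
    have hmain : Δ - (t' - t) • (τ • V z) = R - l R • V z := by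
      have h3 : l Δ • V z = s • Pc z e₀ + l R • V z := by
        rw [hdec, map_add, map_smul, add_smul, hV, smul_eq_mul, mul_smul]
        dsimp only
        rw [smul_inv_smul₀ (by linarith)]
      rw [smul_smul, ← hlΔ, h3]
      nth_rewrite 1 [hdec]
      abel
    have hRn : ‖R‖ ≤ 2 * (c / M) * ‖Δ‖ := (norm_add_le _ _).trans (by linarith)
    have hΔn := hlip t ht t' ht'
    rw [hmain, Real.norm_eq_abs]
    calc ‖R - l R • V z‖ ≤ ‖R‖ + ‖l‖ * ‖R‖ * ‖V z‖ := by
          refine (norm_sub_le _ _).trans ?_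
          rw [norm_smul]
          gcongr
          exact l.le_opNorm R
      _ = (1 + ‖l‖ * ‖V z‖) * ‖R‖ := by ring
      _ ≤ (1 + ‖l‖ * ‖V z‖) * (2 * (c / M) * (2 * (|τ| * ‖e₀‖) * |t' - t|)) := by
          gcongr
          exact hRn.trans (by gcongr)
      _ = (M - 1) * (c / M) * |t' - t| := by rw [hM]; ring
      _ ≤ M * (c / M) * |t' - t| := by gcongr; linarith
      _ = c * |t' - t| := by field_simp
  · rw [norm_smul, Real.norm_eq_abs]
    exact (mul_le_mul_of_nonneg_left (hVn _ (hΓB t ht)) (abs_nonneg _)).trans hτη.le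

/-- A closed set with first-order moves in the stable direction inside a center-stable plaque
intersects nearby center plaques. -/
theorem exists_mem_center_plaque (h : IsLocallyCoherent O Ds Dc Du Ps Pc Pu φs φu) (hO : y₀ ∈ O)
    (hs : y₀ ∈ φs.source) (hu : y₀ ∈ φu.source) {r₀ ρ : ℝ} (hr₀ : 0 < r₀) (hρ : 0 < ρ) :
    ∃ U ∈ 𝓝 y₀, ∀ p ∈ U, ∀ q ∈ U, ∀ A : Set (E × ℝ),
      IsClosed (A ∩ closedBall y₀ r₀ ×ˢ univ) → (∀ x ∈ A, x.1 ∈ plaque φs p) → (q, 0) ∈ A →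
      (∀ z m, (z, m) ∈ A → z ∈ ball y₀ r₀ → ∀ x, ∀ e > 0, ∀ᶠ s in 𝓝[>] (0 : ℝ),
        ∃ z', (z', m + s * ‖x‖) ∈ A ∧ ‖z' - z - s • Ps z x‖ ≤ s * e) →
      ∃ z m, (z, m) ∈ A ∧ z ∈ plaque φs p ∩ plaque φu p ∧ z ∈ ball y₀ ρ ∧ m ≤ ρ := by
  obtain ⟨e₀, l, -, he₀, hl⟩ := h.exists_functional hO (h.finrank_c y₀ hO)
  set K : ℝ := 1 + ‖Ps y₀‖ + ‖Pc y₀‖ with hK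
  have hK1 : 1 ≤ K := by rw [hK]; linarith [norm_nonneg (Pc y₀), norm_nonneg (Ps y₀)]
  set ε : ℝ := 1 / (8 * K) with hε
  have hε0 : 0 < ε := by positivity
  have hεK : ε * K ≤ 1 / 8 := by rw [hε]; apply le_of_eq; field_simp
  have hε8 : ε ≤ 1 / 8 := by nlinarith
  -- The quarter compensates the factor `4` in `norm_sub_le_of_mem`, so that moves in the center
  -- plaque have relative error `ε`.
  obtain ⟨r₁, hr₁, hr₁r₀, hrO, hrs, hru, hrP, hrf⟩ := h.exists_radius hO hs hu
    (show 0 < ε / 4 by positivity) hr₀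
  obtain ⟨δ, hδ, hδc⟩ := h.exists_center_point hO hs hu he₀ hl (show 0 < r₁ / 2 by positivity)
  set r : ℝ := min δ (r₁ / 2) with hr
  have hr0 : 0 < r := by positivity
  have hrr₁ : r ≤ r₁ / 2 := min_le_right _ _
  have hsub : closedBall y₀ r ⊆ closedBall y₀ r₁ := closedBall_subset_closedBall (by linarith)
  set ρ' : ℝ := min (r / 2) (ρ / 2) with hρ'
  have hρ'0 : 0 < ρ' := by positivity
  set κ : ℝ := min (r / 2) (min (ρ / 2) (ρ' / (16 * (K + 1)))) with hκ
  have hκ0 : 0 < κ := by positivity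
  refine ⟨ball y₀ κ, ball_mem_nhds _ hκ0, fun p hp q hq A hAc hAp hqA hmove => ?_⟩
  have hκr : κ ≤ r / 2 := min_le_left _ _
  rw [mem_ball] at hp hq
  have hpB : p ∈ closedBall y₀ r₁ := by rw [mem_closedBall]; linarith
  -- Stable moves on `A` and center moves on the center plaque of `p` leave only the unstable
  -- component of the gap. That component is small because both sets lie in one center-stable
  -- plaque.
  obtain ⟨a, m, haA, haB, had, ham⟩ := exists_mem_inter_of_moves (F := E) (A := A)
    (B := plaque φs p ∩ plaque φu p) (y₀ := y₀) (r := r) (ρ := ρ') (K := K) (ε := ε)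
    (by
      have h1 : IsClosed (closedBall y₀ r ×ˢ (univ : Set ℝ)) := isClosed_closedBall.prod isClosed_univ
      convert! hAc.inter h1 using 1
      ext x
      constructor
      · rintro ⟨h2, h3⟩
        exact ⟨⟨h2, closedBall_subset_closedBall (by linarith) h3.1, trivial⟩, h3⟩
      · rintro ⟨⟨h2, -⟩, h3⟩; exact ⟨h2, h3⟩)
    (by
      have h1 := isClosed_plaque_inter isClosed_closedBall (hsub.trans hrs) p
      have h2 := isClosed_plaque_inter isClosed_closedBall (hsub.trans hru) p
      convert! h1.inter h2 using 1
      ext x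
      constructor
      · rintro ⟨⟨h3, h4⟩, h5⟩; exact ⟨⟨h3, h5⟩, h4, h5⟩
      · rintro ⟨⟨h3, h5⟩, h4, -⟩; exact ⟨⟨h3, h4⟩, h5⟩)
    (Ps y₀) (Pc y₀) (by positivity)
    (fun w => ((Ps y₀).le_opNorm w).trans
      (mul_le_mul_of_nonneg_right (by rw [hK]; linarith [norm_nonneg (Pc y₀)]) (norm_nonneg _)))
    (fun w => ((Pc y₀).le_opNorm w).trans
      (mul_le_mul_of_nonneg_right (by rw [hK]; linarith [norm_nonneg (Ps y₀)]) (norm_nonneg _)))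
    hε0.le hεK
    (by
      intro a m b ha hb har hbr
      have h1 : (b - a) - Ps y₀ (b - a) - Pc y₀ (b - a) = Pu y₀ (b - a) := by
        nth_rewrite 1 [← h.add_eq y₀ hO (b - a)]
        abel
      rw [h1]
      refine ((hrf a (hsub (ball_subset_closedBall har)) b (hsub (ball_subset_closedBall hbr))).1
        ((hAp _ ha).2.trans hb.1.2.symm)).trans ?_
      exact mul_le_mul_of_nonneg_right (by linarith) (norm_nonneg _))
    (by
      intro a m ha har w e he
      have har₁ := hsub (ball_subset_closedBall har)
      filter_upwards [hmove a m ha (ball_subset_ball (by linarith) har) (Ps y₀ w) e he,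
        self_mem_nhdsWithin] with s hs hs0
      obtain ⟨a', ha', hn⟩ := hs
      refine ⟨a', ha', ?_⟩
      have h1 : a' - a - s • Ps y₀ w = (a' - a - s • Ps a (Ps y₀ w))
          + s • ((Ps a - Ps y₀) (Ps y₀ w)) := by
        rw [sub_apply, h.apply_s hO (h.mem_s y₀ hO w)]
        module
      have h2 : ‖(Ps a - Ps y₀) (Ps y₀ w)‖ ≤ ε * ‖Ps y₀ w‖ := by
        refine ((Ps a - Ps y₀).le_opNorm _).trans ?_
        have := (hrP a har₁).1
        gcongr
        linarith
      rw [h1]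
      refine (norm_add_le _ _).trans ?_
      rw [norm_smul, Real.norm_of_nonneg (le_of_lt hs0)]
      have := mul_le_mul_of_nonneg_left h2 (le_of_lt hs0)
      linarith)
    (by
      intro b hb hbr w e he
      -- The center move goes to the point of the center plaque whose coordinate has changed by `-(s
      -- * l w)`. By flatness its displacement is `-(s • Pc y₀ w)` up to the admitted error.
      have hsm : ∀ᶠ s : ℝ in 𝓝[>] 0, |-(s * l w)| < δ := by
        have : Continuous fun s : ℝ => |-(s * l w)| := by fun_prop
        refine nhdsWithin_le_nhds ((this.tendsto 0).eventually (gt_mem_nhds ?_))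
        simpa using hδ
      filter_upwards [hsm, self_mem_nhdsWithin] with s hs hs0
      have hs0' : (0 : ℝ) ≤ s := le_of_lt hs0
      obtain ⟨z, hz, hzn, hzl⟩ := hδc b (ball_subset_ball (min_le_left _ _) hbr) (-(s * l w)) hs.le
      have hbr₁ := hsub (ball_subset_closedBall hbr)
      have hzr₁ : z ∈ closedBall y₀ r₁ := by
        rw [← dist_eq_norm] at hzn
        rw [mem_ball] at hbr
        rw [mem_closedBall]
        linarith [dist_triangle z b y₀]
      refine ⟨z, ⟨⟨hz.1.1, hz.1.2.trans hb.1.2⟩, ⟨hz.2.1, hz.2.2.trans hb.2.2⟩⟩, ?_⟩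
      have h1 := (h.norm_sub_le_of_mem hO hl (show ε / 4 ≤ 1 / 4 by linarith)
        ((hrf b hbr₁ z hzr₁).1 hz.1.2.symm) ((hrf b hbr₁ z hzr₁).2 hz.2.2.symm)).2
      have h2 : l (z - b) = -(s * l w) := by rw [map_sub, hzl]; ring
      rw [h2, abs_neg, abs_mul, abs_of_nonneg hs0', neg_smul, sub_neg_eq_add, mul_smul, ← hl] at h1
      refine h1.trans ?_
      have h3 : ‖Pc y₀ w‖ = |l w| * ‖e₀‖ := by rw [hl, norm_smul, Real.norm_eq_abs]
      rw [h3]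
      nlinarith [mul_nonneg hs0' he.le])
    hqA ⟨⟨hrs hpB, rfl⟩, ⟨hru hpB, rfl⟩⟩ (by linarith) (by linarith)
    (min_le_left _ _)
    (by
      have h1 : ‖p - q‖ ≤ 2 * κ := by
        rw [← dist_eq_norm]
        linarith [dist_triangle_right p q y₀]
      have h2 : κ ≤ ρ' / (16 * (K + 1)) := (min_le_right _ _).trans (min_le_right _ _)
      calc 4 * (K + 1) * ‖p - q‖ ≤ 4 * (K + 1) * (2 * (ρ' / (16 * (K + 1)))) := by
            gcongr; linarith
        _ = ρ' / 2 := by field_simp; norm_num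
        _ < ρ' := by linarith)
  have hκρ : κ ≤ ρ / 2 := (min_le_right _ _).trans (min_le_left _ _)
  have hρ'ρ : ρ' ≤ ρ / 2 := min_le_right _ _
  refine ⟨a, m, haA, haB, ?_, by linarith⟩
  rw [mem_ball]
  linarith [dist_triangle a q y₀]

/-- A closed set with first-order moves in the unstable direction intersects nearby center-stable
plaques. -/
theorem exists_mem_plaque (h : IsLocallyCoherent O Ds Dc Du Ps Pc Pu φs φu) (hO : y₀ ∈ O)
    (hs : y₀ ∈ φs.source) (hu : y₀ ∈ φu.source) {r₀ ρ : ℝ} (hr₀ : 0 < r₀) (hρ : 0 < ρ) :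
    ∃ U ∈ 𝓝 y₀, ∀ q ∈ U, ∀ A : Set E, IsClosed (A ∩ closedBall y₀ r₀) →
      (∀ z ∈ A, z ∈ ball y₀ r₀ → ∀ x, ∀ e > 0, ∀ᶠ s in 𝓝[>] (0 : ℝ),
        ∃ z' ∈ A, ‖z' - z - s • Pu z x‖ ≤ s * e) →
      (A ∩ U).Nonempty → ∃ z ∈ A, z ∈ plaque φs q ∧ z ∈ ball y₀ ρ := by
  set K : ℝ := 1 + ‖Pu y₀‖ with hK
  have hK1 : 1 ≤ K := by rw [hK]; linarith [norm_nonneg (Pu y₀)]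
  set ε : ℝ := 1 / (8 * K) with hε
  have hε0 : 0 < ε := by positivity
  have hεK : ε * K ≤ 1 / 8 := by rw [hε]; apply le_of_eq; field_simp
  obtain ⟨r, hr0, hrr₀, hrO, hrs, hru, hrP, hrf⟩ := h.exists_radius hO hs hu hε0 hr₀
  set ρ' : ℝ := min (r / 2) (ρ / 2) with hρ'
  have hρ'0 : 0 < ρ' := by positivity
  set κ : ℝ := min (r / 2) (min (ρ / 2) (ρ' / (16 * (K + 1)))) with hκ
  have hκ0 : 0 < κ := by positivity
  refine ⟨ball y₀ κ, ball_mem_nhds _ hκ0, fun q hq A hAc hmove => ?_⟩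
  rintro ⟨a₀, ha₀A, ha₀⟩
  have hκr : κ ≤ r / 2 := min_le_left _ _
  rw [mem_ball] at ha₀ hq
  have hqB : q ∈ closedBall y₀ r := by rw [mem_closedBall]; linarith
  have hQ : ∀ w, Pu y₀ (-(w - Pu y₀ w)) = 0 := by
    intro w
    rw [map_neg, map_sub, h.apply_u hO (h.mem_u y₀ hO w), sub_self, neg_zero]
  -- Unstable moves on `A` and center-stable moves on the plaque of `q` are exactly complementary,
  -- because `Q = 1 - P`. No cost is recorded.
  obtain ⟨a, m, haA, haB, had, -⟩ := exists_mem_inter_of_moves (F := E) (A := A ×ˢ univ)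
    (B := plaque φs q) (y₀ := y₀) (r := r) (ρ := ρ') (K := K) (ε := ε)
    (by
      have h1 := (hAc.inter (isClosed_closedBall (x := y₀) (ε := r))).prod
        (isClosed_univ (X := ℝ))
      convert! h1 using 1
      ext x
      constructor
      · rintro ⟨h2, h3⟩
        exact ⟨⟨⟨h2.1, closedBall_subset_closedBall (by linarith) h3.1⟩, h3.1⟩, trivial⟩
      · rintro ⟨⟨⟨h2, -⟩, h3⟩, -⟩; exact ⟨⟨h2, trivial⟩, h3, trivial⟩)
    (isClosed_plaque_inter isClosed_closedBall hrs q)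
    (Pu y₀) (fun w => w - Pu y₀ w) (by positivity)
    (fun w => ((Pu y₀).le_opNorm w).trans
      (mul_le_mul_of_nonneg_right (by rw [hK]; linarith) (norm_nonneg _)))
    (fun w => (norm_sub_le _ _).trans (by
      have := (Pu y₀).le_opNorm w
      rw [hK, add_mul, one_mul]; linarith))
    hε0.le hεK
    (by
      intro a m b _ _ _ _
      rw [sub_self, norm_zero]
      positivity)
    (by
      intro a m ha har w e he
      have har₁ := ball_subset_closedBall har
      filter_upwards [hmove a ha.1 (ball_subset_ball (by linarith) har) (Pu y₀ w) e he,
        self_mem_nhdsWithin] with s hs hs0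
      obtain ⟨a', ha', hn⟩ := hs
      refine ⟨a', ⟨ha', trivial⟩, ?_⟩
      have h1 : a' - a - s • Pu y₀ w = (a' - a - s • Pu a (Pu y₀ w))
          + s • ((Pu a - Pu y₀) (Pu y₀ w)) := by
        rw [sub_apply, h.apply_u hO (h.mem_u y₀ hO w)]
        module
      have h2 : ‖(Pu a - Pu y₀) (Pu y₀ w)‖ ≤ ε * ‖Pu y₀ w‖ := by
        refine ((Pu a - Pu y₀).le_opNorm _).trans ?_
        have := (hrP a har₁).2
        gcongr
      rw [h1]
      refine (norm_add_le _ _).trans ?_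
      rw [norm_smul, Real.norm_of_nonneg (le_of_lt hs0)]
      have := mul_le_mul_of_nonneg_left h2 (le_of_lt hs0)
      linarith)
    (by
      intro b hb hbr w e he
      have hbr₁ := ball_subset_closedBall hbr
      filter_upwards [h.cs.exists_move h.plaques_s hb.1 (hrO hbr₁) (hQ w) (hrP b hbr₁).2 he]
        with s hs
      obtain ⟨b', hb', hn⟩ := hs
      refine ⟨b', ⟨hb'.1, hb'.2.trans hb.2⟩, ?_⟩
      rwa [smul_neg, sub_neg_eq_add, norm_neg] at hn)
    (m₀ := 0) ⟨ha₀A, trivial⟩ ⟨hrs hqB, rfl⟩ (by linarith) (by linarith) (min_le_left _ _)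
    (by
      have h1 : ‖q - a₀‖ ≤ 2 * κ := by
        rw [← dist_eq_norm]
        linarith [dist_triangle_right q a₀ y₀]
      have h2 : κ ≤ ρ' / (16 * (K + 1)) := (min_le_right _ _).trans (min_le_right _ _)
      calc 4 * (K + 1) * ‖q - a₀‖ ≤ 4 * (K + 1) * (2 * (ρ' / (16 * (K + 1)))) := by
            gcongr; linarith
        _ = ρ' / 2 := by field_simp; norm_num
        _ < ρ' := by linarith)
  have hκρ : κ ≤ ρ / 2 := (min_le_right _ _).trans (min_le_left _ _)
  have hρ'ρ : ρ' ≤ ρ / 2 := min_le_right _ _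
  refine ⟨a, haA.1, haB, ?_⟩
  rw [mem_ball]
  linarith [dist_triangle a a₀ y₀]

end IsLocallyCoherent

end PartialHyperbolicity

/-! ### Splittings and foliations of the manifold, read in a chart. -/

namespace PartialHyperbolicity

open Metric

set_option linter.unusedSectionVars false

variable {n : ℕ} {M : Type*} [TopologicalSpace M] [ChartedSpace (EuclideanSpace ℝ (Fin n)) M]

/-- The derivative of the inverse of the chart at `x₀`. -/
def chartFrame (x₀ : M) (y : EuclideanSpace ℝ (Fin n)) :
    EuclideanSpace ℝ (Fin n) →L[ℝ] TangentSpace (𝓡 n) ((chartAt (EuclideanSpace ℝ (Fin n)) x₀).symm y) :=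
  mfderiv (𝓡 n) (𝓡 n) (chartAt (EuclideanSpace ℝ (Fin n)) x₀).symm y

/-- A distribution, read in the chart at `x₀`. -/
def chartDistribution (D : Distribution n M) (x₀ : M) (y : EuclideanSpace ℝ (Fin n)) :
    Submodule ℝ (EuclideanSpace ℝ (Fin n)) :=
  (D ((chartAt (EuclideanSpace ℝ (Fin n)) x₀).symm y)).comap (chartFrame x₀ y).toLinearMap

theorem mem_chartDistribution {D : Distribution n M} {x₀ : M} {y w : EuclideanSpace ℝ (Fin n)} :
    w ∈ chartDistribution D x₀ y ↔
      chartFrame x₀ y w ∈ D ((chartAt (EuclideanSpace ℝ (Fin n)) x₀).symm y) :=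
  Iff.rfl

variable [IsManifold (𝓡 n) 1 M]

/-- The derivative of the chart at `x₀`. -/
def chartCoframe (x₀ : M) (x : M) :
    TangentSpace (𝓡 n) x →L[ℝ] EuclideanSpace ℝ (Fin n) :=
  mfderiv (𝓡 n) (𝓡 n) (chartAt (EuclideanSpace ℝ (Fin n)) x₀) x

theorem chartCoframe_chartFrame {x₀ : M} {y : EuclideanSpace ℝ (Fin n)}
    (hy : y ∈ (chartAt (EuclideanSpace ℝ (Fin n)) x₀).target) (w : EuclideanSpace ℝ (Fin n)) :
    chartCoframe x₀ _ (chartFrame x₀ y w) = w := by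
  have := (mdifferentiable_chart (I := 𝓡 n) x₀).comp_symm_deriv hy
  exact DFunLike.congr_fun this w

theorem chartFrame_chartCoframe {x₀ : M} {y : EuclideanSpace ℝ (Fin n)}
    (hy : y ∈ (chartAt (EuclideanSpace ℝ (Fin n)) x₀).target)
    (v : TangentSpace (𝓡 n) ((chartAt (EuclideanSpace ℝ (Fin n)) x₀).symm y)) :
    chartFrame x₀ y (chartCoframe x₀ _ v) = v := by
  have := (mdifferentiable_chart (I := 𝓡 n) x₀).symm_comp_deriv
    ((chartAt (EuclideanSpace ℝ (Fin n)) x₀).map_target hy)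
  have h2 := DFunLike.congr_fun this v
  rw [(chartAt (EuclideanSpace ℝ (Fin n)) x₀).right_inv hy] at h2
  exact h2

theorem chartFrame_apply_chartCoframe {x₀ x : M}
    (hx : x ∈ (chartAt (EuclideanSpace ℝ (Fin n)) x₀).source) (v : EuclideanSpace ℝ (Fin n)) :
    (chartFrame x₀ (chartAt (EuclideanSpace ℝ (Fin n)) x₀ x) (chartCoframe x₀ x v) :
      EuclideanSpace ℝ (Fin n)) = v := by
  have := (mdifferentiable_chart (I := 𝓡 n) x₀).symm_comp_deriv hx
  exact DFunLike.congr_fun this v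

/-- All tangent spaces are definitionally the model space, so one vector can be tested at two equal
base points without a cast. -/
theorem mem_distribution_congr {D : Distribution n M} {x x' : M} (h : x = x')
    (v : EuclideanSpace ℝ (Fin n)) :
    (show TangentSpace (𝓡 n) x from v) ∈ D x ↔ (show TangentSpace (𝓡 n) x' from v) ∈ D x' := by
  subst h; rfl

theorem mem_chartDistribution_chart {D : Distribution n M} {x₀ x : M}
    (hx : x ∈ (chartAt (EuclideanSpace ℝ (Fin n)) x₀).source) {v : TangentSpace (𝓡 n) x} :
    chartCoframe x₀ x v ∈ chartDistribution D x₀ (chartAt (EuclideanSpace ℝ (Fin n)) x₀ x) ↔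
      v ∈ D x := by
  rw [mem_chartDistribution]
  have := mem_distribution_congr (D := D)
    ((chartAt (EuclideanSpace ℝ (Fin n)) x₀).left_inv hx) v
  rw [← chartFrame_apply_chartCoframe hx v] at this
  refine this.trans ?_
  rw [chartFrame_apply_chartCoframe hx v]

theorem chartCoframe_injective {x₀ x : M}
    (hx : x ∈ (chartAt (EuclideanSpace ℝ (Fin n)) x₀).source) :
    Function.Injective (chartCoframe (n := n) x₀ x) := by
  intro v w h
  have h1 := chartFrame_apply_chartCoframe hx v
  have h2 := chartFrame_apply_chartCoframe hx w
  exact h1.symm.trans ((congrArg _ h).trans h2)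

theorem chartCoframe_surjective {x₀ x : M}
    (hx : x ∈ (chartAt (EuclideanSpace ℝ (Fin n)) x₀).source) (w : EuclideanSpace ℝ (Fin n)) :
    ∃ v, chartCoframe x₀ x v = w := by
  have h := (mdifferentiable_chart (I := 𝓡 n) x₀).comp_symm_deriv
    ((chartAt (EuclideanSpace ℝ (Fin n)) x₀).map_source hx)
  have h2 := DFunLike.congr_fun h w
  rw [(chartAt (EuclideanSpace ℝ (Fin n)) x₀).left_inv hx] at h2
  exact ⟨_, h2⟩

theorem chartDistribution_sup {D D' : Distribution n M} {x₀ : M} {y : EuclideanSpace ℝ (Fin n)}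
    (hy : y ∈ (chartAt (EuclideanSpace ℝ (Fin n)) x₀).target) :
    chartDistribution (fun x => D x ⊔ D' x) x₀ y =
      chartDistribution D x₀ y ⊔ chartDistribution D' x₀ y := by
  apply le_antisymm
  · intro w hw
    obtain ⟨a, ha, b, hb, hab⟩ := Submodule.mem_sup.1 (mem_chartDistribution.1 hw)
    refine Submodule.mem_sup.2 ⟨chartCoframe x₀ _ a, ?_, chartCoframe x₀ _ b, ?_, ?_⟩
    · rw [mem_chartDistribution, chartFrame_chartCoframe hy]; exact ha
    · rw [mem_chartDistribution, chartFrame_chartCoframe hy]; exact hb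
    · rw [← map_add, hab, chartCoframe_chartFrame hy]
  · refine sup_le ?_ ?_
    · exact Submodule.comap_mono le_sup_left
    · exact Submodule.comap_mono le_sup_right

theorem HasC1Plaques.congr {E F G : Type*} [NormedAddCommGroup E] [NormedSpace ℝ E]
    [NormedAddCommGroup F] [NormedSpace ℝ F] [NormedAddCommGroup G] [NormedSpace ℝ G]
    {φ : OpenPartialHomeomorph E (F × G)} {D D' : E → Submodule ℝ E} (h : HasC1Plaques φ D)
    (hD : ∀ p ∈ φ.target, D (φ.symm p) = D' (φ.symm p)) : HasC1Plaques φ D' :=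
  ⟨h.contDiffAt, h.injective, fun p hp => (h.range_eq p hp).trans (hD p hp)⟩

/-- Reading a plaque in the chart composes its derivative with that of the chart, which is injective
and carries `D` onto `chartDistribution D x₀`. -/
theorem Foliation.IsTangentTo.hasC1Plaques {d : ℕ} {W : Foliation n d M} {D : Distribution n M}
    (h : W.IsTangentTo D) {φ} (hφ : φ ∈ W.charts) (x₀ : M) :
    HasC1Plaques ((chartAt (EuclideanSpace ℝ (Fin n)) x₀).symm.trans φ)
      (chartDistribution D x₀) := by
  set ψ := chartAt (EuclideanSpace ℝ (Fin n)) x₀ with hψ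
  have key : ∀ p ∈ (ψ.symm.trans φ).target, φ.symm p ∈ ψ.source := by
    intro p hp
    rw [OpenPartialHomeomorph.trans_target] at hp
    exact hp.2
  have hmd : ∀ p ∈ (ψ.symm.trans φ).target,
      MDifferentiableAt (𝓡 n) (𝓡 n) ψ (φ.symm p) := fun p hp =>
    (mdifferentiable_chart (I := 𝓡 n) x₀).mdifferentiableAt (key p hp)
  have hgd : ∀ p : EuclideanSpace ℝ (Fin d) × EuclideanSpace ℝ (Fin (n - d)),
      MDifferentiableAt (𝓡 d) (𝓡 n) (fun a => φ.symm (a, p.2)) p.1 := fun p =>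
    ((h φ hφ p.2).1 p.1).mdifferentiableAt one_ne_zero
  have hder : ∀ p ∈ (ψ.symm.trans φ).target, ∀ w,
      fderiv ℝ (fun a => (ψ.symm.trans φ).symm (a, p.2)) p.1 w =
        chartCoframe x₀ (φ.symm p) (mfderiv (𝓡 d) (𝓡 n) (fun a => φ.symm (a, p.2)) p.1 w) := by
    intro p hp w
    have e : (fun a => (ψ.symm.trans φ).symm (a, p.2)) = ψ ∘ (fun a => φ.symm (a, p.2)) := rfl
    rw [e, ← mfderiv_eq_fderiv]
    have := mfderiv_comp p.1 (hmd p hp) (hgd p)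
    rw [this]
    rfl
  refine ⟨?_, ?_, ?_⟩
  · intro p hp
    have e : (fun a => (ψ.symm.trans φ).symm (a, p.2)) = ψ ∘ (fun a => φ.symm (a, p.2)) := rfl
    rw [e, ← contMDiffAt_iff_contDiffAt]
    exact ContMDiffAt.comp p.1 ((contMDiffOn_chart (I := 𝓡 n) (n := 1) (x := x₀)).contMDiffAt
      (ψ.open_source.mem_nhds (key p hp))) ((h φ hφ p.2).1 p.1)
  · intro p hp v w hvw
    rw [hder p hp, hder p hp] at hvw
    exact ((h φ hφ p.2).2 p.1).1 (chartCoframe_injective (key p hp) hvw)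
  · intro p hp
    have e : (ψ.symm.trans φ).symm p = ψ (φ.symm p) := rfl
    rw [e]
    ext w
    have hr := ((h φ hφ p.2).2 p.1).2
    constructor
    · rintro ⟨v, rfl⟩
      rw [ContinuousLinearMap.coe_coe, hder p hp, mem_chartDistribution_chart (key p hp)]
      have := LinearMap.mem_range_self
        (mfderiv (𝓡 d) (𝓡 n) (fun a => φ.symm (a, p.2)) p.1).toLinearMap v
      rw [hr] at this
      exact this
    · intro hw
      obtain ⟨v, rfl⟩ := chartCoframe_surjective (key p hp) w
      rw [mem_chartDistribution_chart (key p hp)] at hw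
      have hw' : v ∈ LinearMap.range
        (mfderiv (𝓡 d) (𝓡 n) (fun a => φ.symm (a, p.2)) p.1).toLinearMap := by
        rw [hr]; exact hw
      obtain ⟨u, rfl⟩ := hw'
      exact ⟨u, hder p hp u⟩

theorem map_chartCoframe {D : Distribution n M} {x₀ : M} {y : EuclideanSpace ℝ (Fin n)}
    (hy : y ∈ (chartAt (EuclideanSpace ℝ (Fin n)) x₀).target) :
    (D ((chartAt (EuclideanSpace ℝ (Fin n)) x₀).symm y)).map
      (chartCoframe x₀ ((chartAt (EuclideanSpace ℝ (Fin n)) x₀).symm y)).toLinearMap =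
      chartDistribution D x₀ y := by
  ext w
  constructor
  · rintro ⟨v, hv, rfl⟩
    rw [mem_chartDistribution, ContinuousLinearMap.coe_coe, chartFrame_chartCoframe hy]
    exact hv
  · intro hw
    exact ⟨_, hw, chartCoframe_chartFrame hy w⟩

theorem finrank_chartDistribution {D : Distribution n M} {x₀ : M} {y : EuclideanSpace ℝ (Fin n)}
    (hy : y ∈ (chartAt (EuclideanSpace ℝ (Fin n)) x₀).target) :
    Module.finrank ℝ (chartDistribution D x₀ y) =
      Module.finrank ℝ (D ((chartAt (EuclideanSpace ℝ (Fin n)) x₀).symm y)) := by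
  let e : EuclideanSpace ℝ (Fin n) ≃ₗ[ℝ]
      TangentSpace (𝓡 n) ((chartAt (EuclideanSpace ℝ (Fin n)) x₀).symm y) :=
    LinearEquiv.ofLinearMap (chartFrame x₀ y).toLinearMap (chartCoframe x₀ _).toLinearMap
      (LinearMap.ext (chartFrame_chartCoframe hy)) (LinearMap.ext (chartCoframe_chartFrame hy))
  have : chartDistribution D x₀ y = (D ((chartAt (EuclideanSpace ℝ (Fin n)) x₀).symm y)).map
      (e.symm : TangentSpace (𝓡 n) ((chartAt (EuclideanSpace ℝ (Fin n)) x₀).symm y) →ₗ[ℝ]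
        EuclideanSpace ℝ (Fin n)) := by
    rw [← Submodule.comap_equiv_eq_map_symm]; rfl
  rw [this]
  exact LinearEquiv.finrank_map_eq e.symm _

/-- Continuous frames of three complementary distributions give continuous projections. -/
theorem exists_isLocalSplitting {E : Type*} [NormedAddCommGroup E] [NormedSpace ℝ E]
    [FiniteDimensional ℝ E] {O : Set E} (hO : IsOpen O) {Ds Dc Du : E → Submodule ℝ E}
    {ks kc ku : ℕ} {Zs : Fin ks → E → E} {Zc : Fin kc → E → E} {Zu : Fin ku → E → E}
    (hZs : ∀ i, ContinuousOn (Zs i) O) (hZc : ∀ i, ContinuousOn (Zc i) O)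
    (hZu : ∀ i, ContinuousOn (Zu i) O)
    (his : ∀ y ∈ O, LinearIndependent ℝ (fun i => Zs i y))
    (hic : ∀ y ∈ O, LinearIndependent ℝ (fun i => Zc i y))
    (hiu : ∀ y ∈ O, LinearIndependent ℝ (fun i => Zu i y))
    (hss : ∀ y ∈ O, Submodule.span ℝ (range fun i => Zs i y) = Ds y)
    (hsc : ∀ y ∈ O, Submodule.span ℝ (range fun i => Zc i y) = Dc y)
    (hsu : ∀ y ∈ O, Submodule.span ℝ (range fun i => Zu i y) = Du y)
    (hd : ∀ y ∈ O, Disjoint (Ds y) (Dc y)) (hd' : ∀ y ∈ O, Disjoint (Ds y ⊔ Dc y) (Du y))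
    (ht : ∀ y ∈ O, Ds y ⊔ Dc y ⊔ Du y = ⊤) :
    ∃ Ps Pc Pu, IsLocalSplitting O Ds Dc Du Ps Pc Pu := by
  let Ls : E → (Fin ks → ℝ) →L[ℝ] E := fun y =>
    ∑ i, (ContinuousLinearMap.proj (R := ℝ) (φ := fun _ => ℝ) i).smulRight (Zs i y)
  let Lc : E → (Fin kc → ℝ) →L[ℝ] E := fun y =>
    ∑ i, (ContinuousLinearMap.proj (R := ℝ) (φ := fun _ => ℝ) i).smulRight (Zc i y)
  let Lu : E → (Fin ku → ℝ) →L[ℝ] E := fun y =>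
    ∑ i, (ContinuousLinearMap.proj (R := ℝ) (φ := fun _ => ℝ) i).smulRight (Zu i y)
  have aux : ∀ {k : ℕ} (Z : Fin k → E → E) (hZ : ∀ i, ContinuousOn (Z i) O),
      ContinuousOn (fun y => (∑ i, (ContinuousLinearMap.proj (R := ℝ)
        (φ := fun _ : Fin k => ℝ) i).smulRight (Z i y) : (Fin k → ℝ) →L[ℝ] E)) O := by
    intro k Z hZ
    refine continuousOn_finsetSum _ fun i _ => ?_
    exact (ContinuousLinearMap.smulRightL ℝ (Fin k → ℝ) E
      (ContinuousLinearMap.proj i)).continuous.comp_continuousOn (hZ i)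
  have aux_mem : ∀ {k : ℕ} (z : Fin k → E) (D : Submodule ℝ E)
      (_ : Submodule.span ℝ (range z) = D) (w : E), w ∈ D ↔ ∃ a : Fin k → ℝ,
        (∑ i, (ContinuousLinearMap.proj (R := ℝ)
          (φ := fun _ : Fin k => ℝ) i).smulRight (z i) : (Fin k → ℝ) →L[ℝ] E) a = w := by
    intro k z D hD w
    rw [← hD, Submodule.mem_span_range_iff_exists_fun]
    simp
  have aux_inj : ∀ {k : ℕ} (z : Fin k → E) (_ : LinearIndependent ℝ z) (a : Fin k → ℝ),
        (∑ i, (ContinuousLinearMap.proj (R := ℝ)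
          (φ := fun _ : Fin k => ℝ) i).smulRight (z i) : (Fin k → ℝ) →L[ℝ] E) a = 0 → a = 0 := by
    intro k z hz a ha
    funext i
    refine Fintype.linearIndependent_iff.1 hz a ?_ i
    simpa using ha
  have mem_Ls : ∀ y ∈ O, ∀ w, w ∈ Ds y ↔ ∃ a, Ls y a = w := fun y hy => aux_mem _ _ (hss y hy)
  have mem_Lc : ∀ y ∈ O, ∀ w, w ∈ Dc y ↔ ∃ a, Lc y a = w := fun y hy => aux_mem _ _ (hsc y hy)
  have mem_Lu : ∀ y ∈ O, ∀ w, w ∈ Du y ↔ ∃ a, Lu y a = w := fun y hy => aux_mem _ _ (hsu y hy)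
  -- The three frames together form an isomorphism `L y` depending continuously on `y`. Each
  -- projection is one block of `L y` composed with `(L y)⁻¹`, so its continuity is that of
  -- inversion.
  let L : E → ((Fin ks → ℝ) × (Fin kc → ℝ) × (Fin ku → ℝ)) →L[ℝ] E := fun y =>
    (Ls y).comp (ContinuousLinearMap.fst ℝ _ _) +
    ((Lc y).comp ((ContinuousLinearMap.fst ℝ _ _).comp (ContinuousLinearMap.snd ℝ _ _)) +
    (Lu y).comp ((ContinuousLinearMap.snd ℝ _ _).comp (ContinuousLinearMap.snd ℝ _ _)))
  have hL : ∀ y a b c, L y (a, b, c) = Ls y a + (Lc y b + Lu y c) := fun _ _ _ _ => rfl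
  have hLc : ContinuousOn L O := by
    refine ((aux Zs hZs).clm_comp continuousOn_const).add
      (((aux Zc hZc).clm_comp continuousOn_const).add ((aux Zu hZu).clm_comp continuousOn_const))
  have hinj : ∀ y ∈ O, Function.Injective (L y) := by
    intro y hy
    rw [injective_iff_map_eq_zero]
    rintro ⟨a, b, c⟩ h
    rw [hL] at h
    have ha : Ls y a ∈ Ds y := (mem_Ls y hy _).2 ⟨a, rfl⟩
    have hb : Lc y b ∈ Dc y := (mem_Lc y hy _).2 ⟨b, rfl⟩
    have hc : Lu y c ∈ Du y := (mem_Lu y hy _).2 ⟨c, rfl⟩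
    have hab : Ls y a + Lc y b ∈ Ds y ⊔ Dc y := Submodule.add_mem_sup ha hb
    have h0 : Lu y c = 0 := by
      refine Submodule.disjoint_def.1 (hd' y hy) _ ?_ hc
      have : Lu y c = -(Ls y a + Lc y b) := by
        rw [eq_neg_iff_add_eq_zero, ← h]; abel
      rw [this]; exact Submodule.neg_mem _ hab
    have h1 : Ls y a = 0 := by
      refine Submodule.disjoint_def.1 (hd y hy) _ ha ?_
      have : Ls y a = -(Lc y b) := by
        rw [eq_neg_iff_add_eq_zero, ← h, h0, add_zero]
      rw [this]; exact Submodule.neg_mem _ hb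
    have h2 : Lc y b = 0 := by simpa [h0, h1] using h
    rw [aux_inj _ (his y hy) a h1, aux_inj _ (hic y hy) b h2, aux_inj _ (hiu y hy) c h0]
    rfl
  have hsurj : ∀ y ∈ O, Function.Surjective (L y) := by
    intro y hy w
    have hw : w ∈ Ds y ⊔ Dc y ⊔ Du y := by rw [ht y hy]; trivial
    obtain ⟨v, hv, c, hc, rfl⟩ := Submodule.mem_sup.1 hw
    obtain ⟨a, ha, b, hb, rfl⟩ := Submodule.mem_sup.1 hv
    obtain ⟨a, rfl⟩ := (mem_Ls y hy _).1 ha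
    obtain ⟨b, rfl⟩ := (mem_Lc y hy _).1 hb
    obtain ⟨c, rfl⟩ := (mem_Lu y hy _).1 hc
    exact ⟨(a, b, c), by rw [hL]; abel⟩
  have hequiv : ∀ y ∈ O, ∃ e : ((Fin ks → ℝ) × (Fin kc → ℝ) × (Fin ku → ℝ)) ≃L[ℝ] E,
      (e : _ →L[ℝ] E) = L y := fun y hy =>
    ⟨(LinearEquiv.ofBijective (L y).toLinearMap ⟨hinj y hy, hsurj y hy⟩).toContinuousLinearEquiv,
      by ext <;> rfl⟩
  have hR : ContinuousOn (fun y => (L y).inverse) O := by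
    intro y hy
    obtain ⟨e, he⟩ := hequiv y hy
    have h1 := (contDiffAt_map_inverse (n := 0) e).continuousAt
    rw [he] at h1
    exact h1.comp_continuousWithinAt (hLc y hy)
  have hright : ∀ y ∈ O, ∀ w, L y ((L y).inverse w) = w := by
    intro y hy w
    obtain ⟨e, he⟩ := hequiv y hy
    rw [← he, ContinuousLinearMap.inverse_equiv]; simp
  have hleft : ∀ y ∈ O, ∀ v, (L y).inverse (L y v) = v := by
    intro y hy w
    obtain ⟨e, he⟩ := hequiv y hy
    rw [← he, ContinuousLinearMap.inverse_equiv]; simp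
  refine ⟨fun y => ((Ls y).comp (ContinuousLinearMap.fst ℝ _ _)).comp (L y).inverse,
    fun y => ((Lc y).comp ((ContinuousLinearMap.fst ℝ _ _).comp
      (ContinuousLinearMap.snd ℝ _ _))).comp (L y).inverse,
    fun y => ((Lu y).comp ((ContinuousLinearMap.snd ℝ _ _).comp
      (ContinuousLinearMap.snd ℝ _ _))).comp (L y).inverse, hO, ?_, ?_, ?_, ?_, ?_, ?_, ?_, ?_, ?_, ?_⟩
  · exact ((aux Zs hZs).clm_comp continuousOn_const).clm_comp hR
  · exact ((aux Zc hZc).clm_comp continuousOn_const).clm_comp hR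
  · exact ((aux Zu hZu).clm_comp continuousOn_const).clm_comp hR
  · intro y hy w
    conv_rhs => rw [← hright y hy w]
    exact add_assoc _ _ _
  · exact fun y hy w => (mem_Ls y hy _).2 ⟨_, rfl⟩
  · exact fun y hy w => (mem_Lc y hy _).2 ⟨_, rfl⟩
  · exact fun y hy w => (mem_Lu y hy _).2 ⟨_, rfl⟩
  · intro y hy w hw
    obtain ⟨a, rfl⟩ := (mem_Ls y hy _).1 hw
    have : (L y).inverse (Ls y a) = (a, 0, 0) := by
      rw [← hleft y hy (a, 0, 0), hL]; simp
    simp [this]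
  · intro y hy w hw
    obtain ⟨a, rfl⟩ := (mem_Lc y hy _).1 hw
    have : (L y).inverse (Lc y a) = (0, a, 0) := by
      rw [← hleft y hy (0, a, 0), hL]; simp
    simp [this]
  · intro y hy w hw
    obtain ⟨a, rfl⟩ := (mem_Lu y hy _).1 hw
    have : (L y).inverse (Lu y a) = (0, 0, a) := by
      rw [← hleft y hy (0, 0, a), hL]; simp
    simp [this]

/-- The fibre component of the trivialisation at `x₀` is the derivative of the chart. Continuity of
a section of the tangent bundle thus becomes continuity of its image in the model space. -/
theorem IsContinuousSubbundle.exists_chart_frame {D : Distribution n M}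
    (h : IsContinuousSubbundle D) (x₀ : M) :
    ∃ O : Set (EuclideanSpace ℝ (Fin n)), IsOpen O ∧
      chartAt (EuclideanSpace ℝ (Fin n)) x₀ x₀ ∈ O ∧
      ∃ (k : ℕ) (Z : Fin k → EuclideanSpace ℝ (Fin n) → EuclideanSpace ℝ (Fin n)),
        (∀ i, ContinuousOn (Z i) O) ∧ ∀ y ∈ O, LinearIndependent ℝ (fun i => Z i y) ∧
          Submodule.span ℝ (range fun i => Z i y) = chartDistribution D x₀ y := by
  set ψ := chartAt (EuclideanSpace ℝ (Fin n)) x₀ with hψ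
  obtain ⟨U, hU, k, X, hX, hX'⟩ := h x₀
  obtain ⟨V, hVU, hV, hxV⟩ := mem_nhds_iff.1 hU
  refine ⟨ψ.target ∩ ψ.symm ⁻¹' V, ψ.isOpen_inter_preimage_symm hV,
    ⟨mem_chart_target _ _, by simpa [hψ] using hxV⟩, k,
    fun i y => chartCoframe x₀ (ψ.symm y) (X i (ψ.symm y)), ?_, ?_⟩
  · intro i
    have h1 : ContinuousOn (fun y => (⟨ψ.symm y, X i (ψ.symm y)⟩ : TangentBundle (𝓡 n) M))
        (ψ.target ∩ ψ.symm ⁻¹' V) :=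
      (hX i).comp (ψ.continuousOn_symm.mono inter_subset_left) fun y hy => hVU hy.2
    have h2 := (trivializationAt (EuclideanSpace ℝ (Fin n)) (TangentSpace (𝓡 n)) x₀).continuousOn.comp
      h1 (fun y hy => by
        rw [Trivialization.mem_source, TangentBundle.trivializationAt_baseSet]
        exact ψ.map_target hy.1)
    refine (continuous_snd.comp_continuousOn h2).congr fun y hy => ?_
    have hs : ψ.symm y ∈ ψ.source := ψ.map_target hy.1
    have h3 := DFunLike.congr_fun
      (TangentBundle.continuousLinearMapAt_trivializationAt (I := 𝓡 n) hs) (X i (ψ.symm y))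
    rw [Trivialization.continuousLinearMapAt_apply, Trivialization.coe_linearMapAt_of_mem _
      (by rw [TangentBundle.trivializationAt_baseSet]; exact hs)] at h3
    exact h3.symm
  · intro y hy
    obtain ⟨hi, hspan⟩ := hX' (ψ.symm y) (hVU hy.2)
    refine ⟨hi.map_injOn (chartCoframe x₀ (ψ.symm y)).toLinearMap
      (chartCoframe_injective (ψ.map_target hy.1)).injOn, ?_⟩
    rw [← map_chartCoframe hy.1, ← hspan, Submodule.map_span]
    congr 1
    exact range_comp (chartCoframe x₀ (ψ.symm y)) (fun i => X i (ψ.symm y))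

/-- Near every point, the charts of the two foliations of a dynamically coherent partially
hyperbolic diffeomorphism, read in a chart of the manifold, are locally coherent. -/
theorem exists_isLocallyCoherent [RiemannianBundle (fun x : M => TangentSpace (𝓡 n) x)]
    {f : M ≃ₘ^1⟮𝓡 n, 𝓡 n⟯ M} {Es Ec Eu : Distribution n M}
    (hf : IsPartiallyHyperbolic f Es Ec Eu) (hdim : ∀ x, Module.finrank ℝ (Ec x) = 1)
    {dcs dcu : ℕ} {Wcs : Foliation n dcs M} {Wcu : Foliation n dcu M}
    (hcoh : IsDynamicallyCoherent f Es Ec Eu Wcs Wcu) (x₀ : M) :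
    ∃ (O : Set (EuclideanSpace ℝ (Fin n))) (Ps Pc Pu : EuclideanSpace ℝ (Fin n) →
      EuclideanSpace ℝ (Fin n) →L[ℝ] EuclideanSpace ℝ (Fin n)),
      chartAt (EuclideanSpace ℝ (Fin n)) x₀ x₀ ∈ O ∧
      O ⊆ (chartAt (EuclideanSpace ℝ (Fin n)) x₀).target ∧
      ∀ φs ∈ Wcs.charts, ∀ φu ∈ Wcu.charts,
        IsLocallyCoherent O (chartDistribution Es x₀) (chartDistribution Ec x₀)
          (chartDistribution Eu x₀) Ps Pc Pu
          ((chartAt (EuclideanSpace ℝ (Fin n)) x₀).symm.trans φs)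
          ((chartAt (EuclideanSpace ℝ (Fin n)) x₀).symm.trans φu) := by
  set ψ := chartAt (EuclideanSpace ℝ (Fin n)) x₀ with hψ
  obtain ⟨Os, hOs, hs, ks, Zs, hZs, hZs'⟩ := hf.continuous_s.exists_chart_frame x₀
  obtain ⟨Oc, hOc, hc, kc, Zc, hZc, hZc'⟩ := hf.continuous_c.exists_chart_frame x₀
  obtain ⟨Ou, hOu, hu, ku, Zu, hZu, hZu'⟩ := hf.continuous_u.exists_chart_frame x₀
  set O := Os ∩ Oc ∩ Ou ∩ ψ.target with hOdef
  have hO : IsOpen O := ((hOs.inter hOc).inter hOu).inter ψ.open_target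
  have e1 : O ⊆ Os := fun y hy => hy.1.1.1
  have e2 : O ⊆ Oc := fun y hy => hy.1.1.2
  have e3 : O ⊆ Ou := fun y hy => hy.1.2
  have e4 : O ⊆ ψ.target := fun y hy => hy.2
  have hd : ∀ y ∈ O, Disjoint (chartDistribution Es x₀ y) (chartDistribution Ec x₀ y) := by
    intro y hy
    rw [Submodule.disjoint_def]
    intro w hw hw'
    rw [mem_chartDistribution] at hw hw'
    have := Submodule.disjoint_def.1 (hf.disjoint_s_c _) _ hw hw'
    rw [← chartCoframe_chartFrame (e4 hy) w, this, map_zero]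
  have hd' : ∀ y ∈ O, Disjoint (chartDistribution Es x₀ y ⊔ chartDistribution Ec x₀ y)
      (chartDistribution Eu x₀ y) := by
    intro y hy
    rw [← chartDistribution_sup (e4 hy), Submodule.disjoint_def]
    intro w hw hw'
    rw [mem_chartDistribution] at hw hw'
    have := Submodule.disjoint_def.1 (hf.disjoint_sc_u _) _ hw hw'
    rw [← chartCoframe_chartFrame (e4 hy) w, this, map_zero]
  have ht : ∀ y ∈ O, chartDistribution Es x₀ y ⊔ chartDistribution Ec x₀ y ⊔
      chartDistribution Eu x₀ y = ⊤ := by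
    intro y hy
    rw [← chartDistribution_sup (e4 hy), ← chartDistribution_sup (e4 hy), eq_top_iff]
    intro w _
    rw [mem_chartDistribution, hf.sup_eq_top]
    trivial
  obtain ⟨Ps, Pc, Pu, hP⟩ := exists_isLocalSplitting hO
    (fun i => (hZs i).mono e1) (fun i => (hZc i).mono e2) (fun i => (hZu i).mono e3)
    (fun y hy => (hZs' y (e1 hy)).1) (fun y hy => (hZc' y (e2 hy)).1)
    (fun y hy => (hZu' y (e3 hy)).1) (fun y hy => (hZs' y (e1 hy)).2)
    (fun y hy => (hZc' y (e2 hy)).2) (fun y hy => (hZu' y (e3 hy)).2) hd hd' ht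
  refine ⟨O, Ps, Pc, Pu, ⟨⟨⟨hs, hc⟩, hu⟩, mem_chart_target _ _⟩, e4, fun φs hφs φu hφu =>
    ⟨hP, ?_, ?_, fun y hy => ?_⟩⟩
  · refine (hcoh.tangent_cs.hasC1Plaques hφs x₀).congr fun p hp => ?_
    exact chartDistribution_sup (((ψ.symm.trans φs).map_target hp).1)
  · refine (hcoh.tangent_cu.hasC1Plaques hφu x₀).congr fun p hp => ?_
    exact chartDistribution_sup (((ψ.symm.trans φu).map_target hp).1)
  · exact (finrank_chartDistribution (e4 hy)).trans (hdim _)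

end PartialHyperbolicity

namespace PartialHyperbolicity

open Metric

set_option linter.unusedSectionVars false

/-! ### Curves in charts and their lengths -/

open scoped ENNReal NNReal

variable {n : ℕ} {M : Type*} [TopologicalSpace M] [ChartedSpace (EuclideanSpace ℝ (Fin n)) M]
  [IsManifold (𝓡 n) 1 M]

section Curves

variable {x₀ : M} {Γ Γ' : ℝ → EuclideanSpace ℝ (Fin n)}

theorem isC1Curve_symm_comp (hd : ∀ t ∈ Icc (0 : ℝ) 1, HasDerivWithinAt Γ (Γ' t) (Icc 0 1) t)
    (hc : ContinuousOn Γ' (Icc 0 1))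
    (ht : ∀ t ∈ Icc (0 : ℝ) 1, Γ t ∈ (chartAt (EuclideanSpace ℝ (Fin n)) x₀).target) :
    IsC1Curve (n := n) ((chartAt (EuclideanSpace ℝ (Fin n)) x₀).symm ∘ Γ) := by
  have h1 : ContDiffOn ℝ 1 Γ (Icc 0 1) := by
    rw [contDiffOn_one_iff_derivWithin (uniqueDiffOn_Icc zero_lt_one)]
    refine ⟨fun t h => (hd t h).differentiableWithinAt, hc.congr fun t h => ?_⟩
    exact (hd t h).derivWithin (uniqueDiffOn_Icc zero_lt_one t h)
  exact (contMDiffOn_chart_symm (I := 𝓡 n) (n := 1) (x := x₀)).comp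
    (contMDiffOn_iff_contDiffOn.2 h1) ht

theorem mfderivWithin_symm_comp {t : ℝ} (h : t ∈ Icc (0 : ℝ) 1)
    (hd : HasDerivWithinAt Γ (Γ' t) (Icc 0 1) t)
    (ht : Γ t ∈ (chartAt (EuclideanSpace ℝ (Fin n)) x₀).target) :
    mfderivWithin 𝓘(ℝ) (𝓡 n) ((chartAt (EuclideanSpace ℝ (Fin n)) x₀).symm ∘ Γ) (Icc 0 1) t
      (1 : ℝ) = chartFrame x₀ (Γ t) (Γ' t) := by
  have hu : UniqueMDiffWithinAt 𝓘(ℝ) (Icc (0 : ℝ) 1) t :=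
    (uniqueDiffOn_Icc zero_lt_one t h).uniqueMDiffWithinAt
  have h1 := mfderiv_comp_mfderivWithin t (I := 𝓘(ℝ)) (I' := 𝓡 n) (I'' := 𝓡 n)
    ((mdifferentiable_chart (I := 𝓡 n) x₀).mdifferentiableAt_symm ht)
    (hd.differentiableWithinAt.mdifferentiableWithinAt) hu
  have h2 : mfderivWithin 𝓘(ℝ) (𝓡 n) Γ (Icc 0 1) t (1 : ℝ) = Γ' t := by
    rw [mfderivWithin_eq_fderivWithin]
    exact hd.derivWithin (uniqueDiffOn_Icc zero_lt_one t h)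
  have h3 := DFunLike.congr_fun h1 (1 : ℝ)
  refine h3.trans ?_
  exact congrArg (chartFrame x₀ (Γ t)) h2

theorem isCurveTangentTo_symm_comp {D : Distribution n M}
    (hd : ∀ t ∈ Icc (0 : ℝ) 1, HasDerivWithinAt Γ (Γ' t) (Icc 0 1) t)
    (ht : ∀ t ∈ Icc (0 : ℝ) 1, Γ t ∈ (chartAt (EuclideanSpace ℝ (Fin n)) x₀).target)
    (hD : ∀ t ∈ Icc (0 : ℝ) 1, Γ' t ∈ chartDistribution D x₀ (Γ t)) :
    IsCurveTangentTo D ((chartAt (EuclideanSpace ℝ (Fin n)) x₀).symm ∘ Γ) := by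
  intro t h
  have e := mfderivWithin_symm_comp h (hd t h) (ht t h)
  have := mem_chartDistribution.1 (hD t h)
  rw [← e] at this
  exact this

variable [RiemannianBundle (fun x : M => TangentSpace (𝓡 n) x)]

theorem pathELength_symm_comp_le {B : ℝ≥0∞}
    (hd : ∀ t ∈ Icc (0 : ℝ) 1, HasDerivWithinAt Γ (Γ' t) (Icc 0 1) t)
    (ht : ∀ t ∈ Icc (0 : ℝ) 1, Γ t ∈ (chartAt (EuclideanSpace ℝ (Fin n)) x₀).target)
    (hB : ∀ t ∈ Icc (0 : ℝ) 1, ‖chartFrame x₀ (Γ t) (Γ' t)‖ₑ ≤ B) :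
    pathELength (𝓡 n) ((chartAt (EuclideanSpace ℝ (Fin n)) x₀).symm ∘ Γ) 0 1 ≤ B := by
  rw [pathELength_eq_lintegral_mfderivWithin_Icc]
  calc _ ≤ ∫⁻ _ in Icc (0 : ℝ) 1, B := by
        refine MeasureTheory.setLIntegral_mono' measurableSet_Icc fun t h => ?_
        have e := mfderivWithin_symm_comp h (hd t h) (ht t h)
        exact (congrArg (fun v : TangentSpace (𝓡 n)
          ((chartAt (EuclideanSpace ℝ (Fin n)) x₀).symm (Γ t)) => ‖v‖ₑ) e).trans_le (hB t h)
    _ = B := by simp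

theorem exists_enorm_chartFrame_le
    [IsContinuousRiemannianBundle (EuclideanSpace ℝ (Fin n)) (fun x : M => TangentSpace (𝓡 n) x)]
    (x₀ : M) : ∃ Λ : ℝ≥0, 0 < Λ ∧ ∀ᶠ y in 𝓝 (chartAt (EuclideanSpace ℝ (Fin n)) x₀ x₀),
      ∀ w, ‖chartFrame x₀ y w‖ₑ ≤ Λ * ‖w‖ₑ := by
  obtain ⟨C, hC, h⟩ := eventually_enorm_mfderivWithin_symm_extChartAt_lt (𝓡 n) x₀
  refine ⟨C, hC, ?_⟩
  rw [ModelWithCorners.range_eq_univ, nhdsWithin_univ] at h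
  filter_upwards [h] with y hy w
  rw [mfderivWithin_univ] at hy
  have h1 : ‖chartFrame x₀ y‖ₑ ≤ C := hy.le
  exact (ContinuousLinearMap.le_opENorm _ w).trans (by gcongr)

/-- Homogeneity extends the bound from unit vectors to all of `D`, and integration along `γ` gives
the estimate. It serves for iterates along curves tangent to `E^s`, where it makes endpoints
exponentially close. -/
theorem riemannianEDist_image_le {f : M → M} {D : Distribution n M} {γ : ℝ → M} {c : ℝ}
    (hγ : IsC1Curve (n := n) γ) (hD : IsCurveTangentTo D γ) (hf : ContMDiff (𝓡 n) (𝓡 n) 1 f)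
    (hc : ∀ x, ∀ v ∈ D x, ‖v‖ = 1 → ‖mfderiv (𝓡 n) (𝓡 n) f x v‖ ≤ c) (hc0 : 0 ≤ c) :
    riemannianEDist (𝓡 n) (f (γ 0)) (f (γ 1)) ≤ ENNReal.ofReal c * pathELength (𝓡 n) γ 0 1 := by
  have hc' : ∀ x, ∀ v ∈ D x, ‖mfderiv (𝓡 n) (𝓡 n) f x v‖ₑ ≤ ENNReal.ofReal c * ‖v‖ₑ := by
    intro x v hv
    have : ‖mfderiv (𝓡 n) (𝓡 n) f x v‖ ≤ c * ‖v‖ := by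
      rcases eq_or_ne v 0 with rfl | h0
      · simp
      · have hn : 0 < ‖v‖ := norm_pos_iff.2 h0
        have := hc x (‖v‖⁻¹ • v) (Submodule.smul_mem _ _ hv)
          (by rw [norm_smul, norm_inv, norm_norm, inv_mul_cancel₀ hn.ne'])
        rw [map_smul, norm_smul, norm_inv, norm_norm, inv_mul_le_iff₀ hn] at this
        linarith
    rw [← ofReal_norm, ← ofReal_norm, ← ENNReal.ofReal_mul hc0]
    exact ENNReal.ofReal_le_ofReal this
  have hfγ : ContMDiffOn 𝓘(ℝ) (𝓡 n) 1 (f ∘ γ) (Icc 0 1) := hf.comp_contMDiffOn hγ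
  refine (riemannianEDist_le_pathELength hfγ rfl rfl zero_le_one).trans ?_
  rw [pathELength_eq_lintegral_mfderivWithin_Icc, pathELength_eq_lintegral_mfderivWithin_Icc,
    ← MeasureTheory.lintegral_const_mul' _ _ ENNReal.ofReal_ne_top]
  refine MeasureTheory.setLIntegral_mono' measurableSet_Icc fun t h => ?_
  have hu : UniqueMDiffWithinAt 𝓘(ℝ) (Icc (0 : ℝ) 1) t :=
    (uniqueDiffOn_Icc zero_lt_one t h).uniqueMDiffWithinAt
  rw [mfderiv_comp_mfderivWithin t ((hf (γ t)).mdifferentiableAt one_ne_zero)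
    ((hγ t h).mdifferentiableWithinAt one_ne_zero) hu]
  exact hc' _ _ (hD t h)

theorem integralLeaf_image {f : M → M} {D : Distribution n M} (hf : ContMDiff (𝓡 n) (𝓡 n) 1 f)
    (hD : ∀ x, (D x).map (mfderiv (𝓡 n) (𝓡 n) f x).toLinearMap ≤ D (f x)) {x y : M}
    (hy : y ∈ integralLeaf D x) : f y ∈ integralLeaf D (f x) := by
  obtain ⟨γ, hγ, hγD, rfl, rfl⟩ := hy
  refine ⟨f ∘ γ, hf.comp_contMDiffOn hγ, fun t h => ?_, rfl, rfl⟩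
  have hu : UniqueMDiffWithinAt 𝓘(ℝ) (Icc (0 : ℝ) 1) t :=
    (uniqueDiffOn_Icc zero_lt_one t h).uniqueMDiffWithinAt
  rw [mfderiv_comp_mfderivWithin t ((hf (γ t)).mdifferentiableAt one_ne_zero)
    ((hγ t h).mdifferentiableWithinAt one_ne_zero) hu]
  exact hD _ (Submodule.mem_map_of_mem (hγD t h))

end Curves

end PartialHyperbolicity

namespace PartialHyperbolicity

open Metric

set_option linter.unusedSectionVars false

/-! ### Local product structure on the manifold -/

open scoped ENNReal NNReal

/-- Being a leaf curve is a condition in every chart. Compatibility of plaques transfers it from the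
one chart in which the curve is known to lie in a plaque. -/
theorem Foliation.isLeafCurve_of_plaque {n d : ℕ} {M : Type*} [TopologicalSpace M]
    {W : Foliation n d M} {γ : ℝ → M} (hγ : ContinuousOn γ (Icc 0 1)) {φ} (hφ : φ ∈ W.charts)
    {c} (h : ∀ t ∈ Icc (0 : ℝ) 1, γ t ∈ φ.source ∧ (φ (γ t)).2 = c) : W.IsLeafCurve γ := by
  refine ⟨hγ, fun t ht φ' hφ' hγt => ?_⟩
  have h1 := W.compat φ' hφ' φ hφ (γ t) ⟨hγt, (h t ht).1⟩
  have h2 : Tendsto (fun s => (γ s, γ t)) (𝓝[Icc 0 1] t) (𝓝 (γ t) ×ˢ 𝓝 (γ t)) :=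
    Tendsto.prodMk (hγ t ht) tendsto_const_nhds
  filter_upwards [h2.eventually h1, self_mem_nhdsWithin] with s hs hst
  exact hs.2 ((h s hst).2.trans (h t ht).2.symm)

variable {n : ℕ} {M : Type*} [TopologicalSpace M] [ChartedSpace (EuclideanSpace ℝ (Fin n)) M]
  [IsManifold (𝓡 n) 1 M]

/-- Integral curves of vector fields give small `C^1` curves in the manifold. -/
theorem rescaled_curve {x₀ : M} {D : Distribution n M}
    {X : EuclideanSpace ℝ (Fin n) → EuclideanSpace ℝ (Fin n)} {O : Set (EuclideanSpace ℝ (Fin n))}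
    (hO : O ⊆ (chartAt (EuclideanSpace ℝ (Fin n)) x₀).target) (hX : ContinuousOn X O)
    (hXD : ∀ y ∈ O, X y ∈ chartDistribution D x₀ y) {s₀ : ℝ}
    {σ : ℝ → EuclideanSpace ℝ (Fin n)}
    (hσ : ∀ t ∈ Icc 0 s₀, σ t ∈ O ∧ HasDerivWithinAt σ (X (σ t)) (Icc 0 s₀) t)
    {s : ℝ} (hs : s ∈ Icc 0 s₀) :
    ∃ γ : ℝ → M, IsC1Curve (n := n) γ ∧ IsCurveTangentTo D γ ∧
      γ 0 = (chartAt (EuclideanSpace ℝ (Fin n)) x₀).symm (σ 0) ∧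
      γ 1 = (chartAt (EuclideanSpace ℝ (Fin n)) x₀).symm (σ s) ∧
      ∀ [RiemannianBundle (fun x : M => TangentSpace (𝓡 n) x)] (B : ℝ≥0∞),
        (∀ y ∈ O, ‖chartFrame x₀ y (X y)‖ₑ ≤ B) →
        pathELength (𝓡 n) γ 0 1 ≤ ENNReal.ofReal s * B := by
  have hmaps : MapsTo (fun t => s * t) (Icc 0 1) (Icc 0 s₀) := fun t ht =>
    ⟨mul_nonneg hs.1 ht.1, (mul_le_of_le_one_right hs.1 ht.2).trans hs.2⟩
  have hd : ∀ t ∈ Icc (0 : ℝ) 1,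
      HasDerivWithinAt (fun t => σ (s * t)) (s • X (σ (s * t))) (Icc 0 1) t := by
    intro t ht
    have h1 : HasDerivWithinAt (fun t => s * t) s (Icc 0 1) t := by
      simpa using ((hasDerivAt_id t).const_mul s).hasDerivWithinAt
    exact HasDerivWithinAt.scomp t (hσ _ (hmaps ht)).2 h1 hmaps
  have hσc : ContinuousOn (fun t => σ (s * t)) (Icc 0 1) := fun t ht =>
    (hd t ht).continuousWithinAt
  have hO' : ∀ t ∈ Icc (0 : ℝ) 1, σ (s * t) ∈ O := fun t ht => (hσ _ (hmaps ht)).1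
  have hc : ContinuousOn (fun t => s • X (σ (s * t))) (Icc 0 1) :=
    (hX.comp hσc hO').const_smul s
  refine ⟨_, isC1Curve_symm_comp hd hc fun t ht => hO (hO' t ht),
    isCurveTangentTo_symm_comp hd (fun t ht => hO (hO' t ht)) fun t ht =>
      Submodule.smul_mem _ _ (hXD _ (hO' t ht)), by simp, by simp, ?_⟩
  intro _ B hB
  refine pathELength_symm_comp_le hd (fun t ht => hO (hO' t ht)) fun t ht => ?_
  rw [map_smul, enorm_smul, Real.enorm_of_nonneg hs.1]
  gcongr
  exact hB _ (hO' t ht)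

theorem eventually_norm_sub_sub_smul_le {F : Type*} [NormedAddCommGroup F] [NormedSpace ℝ F]
    {σ : ℝ → F} {v : F} {s₀ : ℝ} (hs₀ : 0 < s₀) (h : HasDerivWithinAt σ v (Icc 0 s₀) 0) {e : ℝ}
    (he : 0 < e) : ∀ᶠ s in 𝓝[>] (0 : ℝ), s ∈ Icc 0 s₀ ∧ ‖σ s - σ 0 - s • v‖ ≤ s * e := by
  have h1 : Ioc 0 s₀ ∈ 𝓝[>] (0 : ℝ) := Ioc_mem_nhdsGT hs₀
  have h2 := (hasDerivWithinAt_iff_isLittleO.1 h).def he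
  have h3 : 𝓝[>] (0 : ℝ) ≤ 𝓝[Icc 0 s₀] 0 := by
    refine nhdsWithin_le_of_mem (mem_of_superset h1 Ioc_subset_Icc_self)
  filter_upwards [h3 h2, h1] with s hs hs1
  refine ⟨Ioc_subset_Icc_self hs1, ?_⟩
  simp only [sub_zero, Real.norm_eq_abs, abs_of_pos hs1.1] at hs
  linarith

/-- The orbits of `z` and `q` are exponentially close in the future. -/
def IsForwardClose [RiemannianBundle (fun x : M => TangentSpace (𝓡 n) x)]
    (f : M → M) (lam : ℝ) (z q : M) : Prop :=
  ∀ k : ℕ, riemannianEDist (𝓡 n) (f^[k] z) (f^[k] q) ≤ ENNReal.ofReal (lam ^ k)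

variable [RiemannianBundle (fun x : M => TangentSpace (𝓡 n) x)]
  {f : M ≃ₘ^1⟮𝓡 n, 𝓡 n⟯ M} {Es Ec Eu : Distribution n M} {dcs dcu : ℕ}
  {Wcs : Foliation n dcs M} {Wcu : Foliation n dcu M}

theorem eventually_mem_target_and {x₀ : M} {p : EuclideanSpace ℝ (Fin n) → Prop}
    (hp : ∀ᶠ y in 𝓝 (chartAt (EuclideanSpace ℝ (Fin n)) x₀ x₀), p y) :
    ∀ᶠ x in 𝓝 x₀, x ∈ (chartAt (EuclideanSpace ℝ (Fin n)) x₀).source ∧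
      p (chartAt (EuclideanSpace ℝ (Fin n)) x₀ x) :=
  ((chartAt (EuclideanSpace ℝ (Fin n)) x₀).open_source.eventually_mem
    (mem_chart_source _ x₀)).and (((chartAt _ x₀).continuousAt (mem_chart_source _ x₀)).eventually hp)

theorem mem_trans_source {d : ℕ} {x₀ x : M}
    {φ : OpenPartialHomeomorph M (EuclideanSpace ℝ (Fin d) × EuclideanSpace ℝ (Fin (n - d)))}
    (hx : x ∈ (chartAt (EuclideanSpace ℝ (Fin n)) x₀).source) (hφ : x ∈ φ.source) :
    chartAt (EuclideanSpace ℝ (Fin n)) x₀ x ∈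
      ((chartAt (EuclideanSpace ℝ (Fin n)) x₀).symm.trans φ).source := by
  rw [OpenPartialHomeomorph.trans_source]
  exact ⟨(chartAt _ x₀).map_source hx, by simpa [(chartAt _ x₀).left_inv hx] using hφ⟩

theorem mem_plaque_chart {d : ℕ} {x₀ x y : M}
    {φ : OpenPartialHomeomorph M (EuclideanSpace ℝ (Fin d) × EuclideanSpace ℝ (Fin (n - d)))}
    (hx : x ∈ (chartAt (EuclideanSpace ℝ (Fin n)) x₀).source)
    (hy : y ∈ (chartAt (EuclideanSpace ℝ (Fin n)) x₀).source) (hyφ : y ∈ φ.source)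
    (h : (φ y).2 = (φ x).2) :
    chartAt (EuclideanSpace ℝ (Fin n)) x₀ y ∈
      plaque ((chartAt (EuclideanSpace ℝ (Fin n)) x₀).symm.trans φ)
        (chartAt (EuclideanSpace ℝ (Fin n)) x₀ x) := by
  refine ⟨mem_trans_source hy hyφ, ?_⟩
  simpa [(chartAt _ x₀).left_inv hx, (chartAt _ x₀).left_inv hy] using h

theorem of_mem_plaque_chart {d : ℕ} {x₀ x : M} {z : EuclideanSpace ℝ (Fin n)}
    {φ : OpenPartialHomeomorph M (EuclideanSpace ℝ (Fin d) × EuclideanSpace ℝ (Fin (n - d)))}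
    (hx : x ∈ (chartAt (EuclideanSpace ℝ (Fin n)) x₀).source)
    (h : z ∈ plaque ((chartAt (EuclideanSpace ℝ (Fin n)) x₀).symm.trans φ)
        (chartAt (EuclideanSpace ℝ (Fin n)) x₀ x)) :
    (chartAt (EuclideanSpace ℝ (Fin n)) x₀).symm z ∈ φ.source ∧
      (φ ((chartAt (EuclideanSpace ℝ (Fin n)) x₀).symm z)).2 = (φ x).2 := by
  obtain ⟨h1, h2⟩ := h
  rw [OpenPartialHomeomorph.trans_source] at h1
  exact ⟨h1.2, by simpa [(chartAt _ x₀).left_inv hx] using h2⟩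

variable [IsContinuousRiemannianBundle (EuclideanSpace ℝ (Fin n))
    (fun x : M => TangentSpace (𝓡 n) x)]

/-- Nearby points in a common center-stable and a common center-unstable plaque are joined by a
short center curve. -/
theorem eventually_mem_centerBall
    (hf : IsPartiallyHyperbolic f Es Ec Eu) (hdim : ∀ x, Module.finrank ℝ (Ec x) = 1)
    (hcoh : IsDynamicallyCoherent f Es Ec Eu Wcs Wcu) {x₀ : M} {φs φu} (hφs : φs ∈ Wcs.charts)
    (hφu : φu ∈ Wcu.charts) (hs : x₀ ∈ φs.source) (hu : x₀ ∈ φu.source) {R : ℝ} (hR : 0 < R) :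
    ∀ᶠ p : M × M in 𝓝 (x₀, x₀), (φs p.1).2 = (φs p.2).2 → (φu p.1).2 = (φu p.2).2 →
      p.2 ∈ centerBall Wcs Wcu R p.1 := by
  set ψ := chartAt (EuclideanSpace ℝ (Fin n)) x₀ with hψ
  obtain ⟨O, Ps, Pc, Pu, hO, hOt, hloc⟩ := exists_isLocallyCoherent hf hdim hcoh x₀
  have h := hloc φs hφs φu hφu
  obtain ⟨Λ, hΛ, hΛb⟩ := exists_enorm_chartFrame_le (n := n) x₀
  have hxs := mem_chart_source (EuclideanSpace ℝ (Fin n)) x₀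
  have hN : {y | (∀ w, ‖chartFrame x₀ y w‖ₑ ≤ Λ * ‖w‖ₑ) ∧ y ∈ O} ∈ 𝓝 (ψ x₀) :=
    hΛb.and (h.isOpen.mem_nhds hO)
  -- Speed at most `R / (2 * Λ)` in the chart gives Riemannian length at most `R / 2`, hence
  -- strictly less than `R`.
  have hη : 0 < R / (2 * Λ) := by positivity
  have key := h.exists_center_curve hO (mem_trans_source hxs hs) (mem_trans_source hxs hu) hN hη
  have hψc : Tendsto (Prod.map ψ ψ) (𝓝 (x₀, x₀)) (𝓝 (ψ x₀, ψ x₀)) :=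
    ((ψ.continuousAt hxs).prodMap (ψ.continuousAt hxs))
  have hsrc : ∀ᶠ x in 𝓝 x₀, x ∈ ψ.source ∧ x ∈ φs.source ∧ x ∈ φu.source :=
    (ψ.open_source.eventually_mem hxs).and
      ((φs.open_source.eventually_mem hs).and (φu.open_source.eventually_mem hu))
  filter_upwards [hψc.eventually key, (continuous_fst.tendsto (x₀, x₀)).eventually hsrc,
    (continuous_snd.tendsto (x₀, x₀)).eventually hsrc]
  rintro ⟨p, q⟩ hk ⟨hp, hps, hpu⟩ ⟨hq, hqs, hqu⟩ h1 h2
  obtain ⟨Γ, Γ', h0, h1', hc, hΓ⟩ := hk ⟨mem_plaque_chart hp hq hqs h1.symm,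
    mem_plaque_chart hp hq hqu h2.symm⟩
  have ht : ∀ t ∈ Icc (0 : ℝ) 1, Γ t ∈ ψ.target := fun t h => hOt (hΓ t h).2.2.1.2
  have hC1 := isC1Curve_symm_comp (fun t h => (hΓ t h).1) hc ht
  refine ⟨ψ.symm ∘ Γ, ⟨hC1, ?_, ?_⟩, ?_, ?_, ?_⟩
  · exact Foliation.isLeafCurve_of_plaque hC1.continuousOn hφs fun t h =>
      of_mem_plaque_chart hp (hΓ t h).2.2.2.1
  · exact Foliation.isLeafCurve_of_plaque hC1.continuousOn hφu fun t h =>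
      of_mem_plaque_chart hp (hΓ t h).2.2.2.2
  · simp only [Function.comp_apply, h0]; exact ψ.left_inv hp
  · simp only [Function.comp_apply, h1']; exact ψ.left_inv hq
  · refine (pathELength_symm_comp_le (B := ENNReal.ofReal (R / 2)) (fun t h => (hΓ t h).1) ht
      fun t h => ?_).trans_lt ((ENNReal.ofReal_lt_ofReal_iff hR).2 (by linarith))
    refine ((hΓ t h).2.2.1.1 _).trans ?_
    have : (R / 2) = Λ * (R / (2 * Λ)) := by field_simp
    rw [this, ENNReal.ofReal_mul (NNReal.coe_nonneg Λ), ENNReal.ofReal_coe_nnreal, ← ofReal_norm]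
    gcongr
    exact (hΓ t h).2.1

theorem exists_closedBall_subset {F : Type*} [PseudoMetricSpace F] {y₀ : F} {p : F → Prop}
    (h : ∀ᶠ y in 𝓝 y₀, p y) : ∃ r > 0, ∀ y ∈ closedBall y₀ r, p y :=
  nhds_basis_closedBall.mem_iff.1 h

/-- A closed unstably saturated set passing near `q` meets the local center-stable plaque
of `q`. -/
theorem exists_nhds_forall_exists_mem
    (hf : IsPartiallyHyperbolic f Es Ec Eu) (hdim : ∀ x, Module.finrank ℝ (Ec x) = 1)
    (hcoh : IsDynamicallyCoherent f Es Ec Eu Wcs Wcu) {x₀ : M} {φs} (hφs : φs ∈ Wcs.charts)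
    (hs : x₀ ∈ φs.source) {U : Set M} (hU : U ∈ 𝓝 x₀) :
    ∃ V ∈ 𝓝 x₀, ∀ q ∈ V, ∀ A : Set M, IsClosed A → (∀ x ∈ A, integralLeaf Eu x ⊆ A) →
      (A ∩ V).Nonempty → ∃ a ∈ A ∩ U, a ∈ φs.source ∧ (φs a).2 = (φs q).2 := by
  set ψ := chartAt (EuclideanSpace ℝ (Fin n)) x₀ with hψ
  obtain ⟨O, Ps, Pc, Pu, hO, hOt, hloc⟩ := exists_isLocallyCoherent hf hdim hcoh x₀
  obtain ⟨φu, hφu, hu⟩ := Wcu.cover x₀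
  have h := hloc φs hφs φu hφu
  have hxs := mem_chart_source (EuclideanSpace ℝ (Fin n)) x₀
  have hxt := mem_chart_target (EuclideanSpace ℝ (Fin n)) x₀
  have hsU : ∀ᶠ y in 𝓝 (ψ x₀), ψ.symm y ∈ U := by
    refine (ψ.continuousAt_symm hxt).eventually ?_
    rw [ψ.left_inv hxs]; exact hU
  obtain ⟨r₀, hr₀, hr₀O⟩ := exists_closedBall_subset (h.isOpen.mem_nhds hO)
  obtain ⟨ρ, hρ, hρU⟩ := exists_closedBall_subset (hsU.and (ψ.open_target.mem_nhds hxt))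
  obtain ⟨V, hV, key⟩ := h.exists_mem_plaque hO (mem_trans_source hxs hs)
    (mem_trans_source hxs hu) hr₀ hρ
  refine ⟨_, eventually_mem_target_and hV, ?_⟩
  rintro q ⟨hq, hqV⟩ A hA hsat ⟨a, haA, ha, haV⟩
  have hclosed : IsClosed ((ψ.target ∩ ψ.symm ⁻¹' A) ∩ closedBall (ψ x₀) r₀) := by
    have hc : ContinuousOn ψ.symm (closedBall (ψ x₀) r₀) :=
      ψ.continuousOn_symm.mono fun y hy => hOt (hr₀O y hy)
    have := hc.preimage_isClosed_of_isClosed isClosed_closedBall hA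
    convert! this using 1
    ext y
    constructor
    · rintro ⟨⟨-, h2⟩, h3⟩; exact ⟨h3, h2⟩
    · rintro ⟨h3, h2⟩; exact ⟨⟨hOt (hr₀O y h3), h2⟩, h3⟩
  -- Integral curves of `y ↦ Pu y x` are `C^1` and tangent to `E^u`, so saturation keeps them in
  -- `A`.
  have hmove : ∀ z ∈ ψ.target ∩ ψ.symm ⁻¹' A, z ∈ ball (ψ x₀) r₀ → ∀ x, ∀ e > 0,
      ∀ᶠ s in 𝓝[>] (0 : ℝ), ∃ z' ∈ ψ.target ∩ ψ.symm ⁻¹' A, ‖z' - z - s • Pu z x‖ ≤ s * e := by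
    intro z hzA hzb x e he
    have hbO : ball (ψ x₀) r₀ ⊆ O := fun y hy => hr₀O y (ball_subset_closedBall hy)
    have hX : ContinuousOn (fun y => Pu y x) (ball (ψ x₀) r₀) :=
      (h.continuousOn_u.mono hbO).clm_apply continuousOn_const
    obtain ⟨s₀, hs₀, σ, hσ0, hσ⟩ := exists_hasDerivWithinAt_of_continuousOn isOpen_ball hX hzb
    have hd0 := (hσ 0 ⟨le_rfl, hs₀.le⟩).2
    rw [hσ0] at hd0
    filter_upwards [eventually_norm_sub_sub_smul_le hs₀ hd0 he] with s hs
    rw [hσ0] at hs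
    refine ⟨σ s, ⟨hOt (hbO (hσ s hs.1).1), ?_⟩, hs.2⟩
    obtain ⟨γ, hγ, hγD, hγ0, hγ1, -⟩ := rescaled_curve (D := Eu) (x₀ := x₀)
      (fun y hy => hOt (hbO hy)) hX (fun y hy => h.mem_u y (hbO hy) x) hσ hs.1
    rw [hσ0] at hγ0
    exact hsat _ hzA.2 ⟨γ, hγ, hγD, hγ0, hγ1⟩
  obtain ⟨z, hzA, hzq, hzρ⟩ := key (ψ q) hqV (ψ.target ∩ ψ.symm ⁻¹' A) hclosed hmove
    ⟨ψ a, ⟨ψ.map_source ha, by simpa [ψ.left_inv ha] using haA⟩, haV⟩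
  obtain ⟨h1, h2⟩ := of_mem_plaque_chart hq hzq
  exact ⟨ψ.symm z, ⟨hzA.2, (hρU z (ball_subset_closedBall hzρ)).1⟩, h1, h2⟩

end PartialHyperbolicity

/-! ### Center-stable plaques: a center move followed by a contracted jump. -/

namespace PartialHyperbolicity

open Metric

set_option linter.unusedSectionVars false

open scoped ENNReal NNReal

variable {n : ℕ} {M : Type*} [TopologicalSpace M] [ChartedSpace (EuclideanSpace ℝ (Fin n)) M]
  [IsManifold (𝓡 n) 1 M] [RiemannianBundle (fun x : M => TangentSpace (𝓡 n) x)]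
  [IsContinuousRiemannianBundle (EuclideanSpace ℝ (Fin n)) (fun x : M => TangentSpace (𝓡 n) x)]

variable (n M) in
theorem continuous_riemannianEDist [RegularSpace M] :
    Continuous fun p : M × M => riemannianEDist (𝓡 n) p.1 p.2 := by
  let _ := PseudoEMetricSpace.ofRiemannianMetric (𝓡 n) M
  exact continuous_edist

variable {f : M ≃ₘ^1⟮𝓡 n, 𝓡 n⟯ M} {Es Ec Eu : Distribution n M} {dcs dcu : ℕ}
  {Wcs : Foliation n dcs M} {Wcu : Foliation n dcu M}

/-- If `p` and `q` lie close to each other in a common center-stable plaque, then one gets from `p`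
to `q` by a short center curve followed by a curve that `f` contracts. -/
theorem eventually_exists_isForwardClose [RegularSpace M]
    (hf : IsPartiallyHyperbolic f Es Ec Eu) (hdim : ∀ x, Module.finrank ℝ (Ec x) = 1)
    (hcoh : IsDynamicallyCoherent f Es Ec Eu Wcs Wcu) {lam C : ℝ} (hlam : 0 ≤ lam) (hC : 0 < C)
    (hst : ∀ (x : M) (m : ℕ), ∀ v ∈ Es x, ‖v‖ = 1 →
      ‖mfderiv (𝓡 n) (𝓡 n) (f^[m]) x v‖ < C * lam ^ m)
    {x₀ : M} {φs} (hφs : φs ∈ Wcs.charts) (hs : x₀ ∈ φs.source) {R : ℝ} (hR : 0 < R) :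
    ∀ᶠ p : M × M in 𝓝 (x₀, x₀), (φs p.1).2 = (φs p.2).2 →
      ∃ c ∈ centerBall Wcs Wcu R p.1, IsForwardClose (n := n) f lam c p.2 := by
  set ψ := chartAt (EuclideanSpace ℝ (Fin n)) x₀ with hψ
  obtain ⟨O, Ps, Pc, Pu, hO, hOt, hloc⟩ := exists_isLocallyCoherent hf hdim hcoh x₀
  obtain ⟨φu, hφu, hu⟩ := Wcu.cover x₀
  have h := hloc φs hφs φu hφu
  obtain ⟨Λ, hΛ, hΛb⟩ := exists_enorm_chartFrame_le (n := n) x₀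
  have hxs := mem_chart_source (EuclideanSpace ℝ (Fin n)) x₀
  have hxt := mem_chart_target (EuclideanSpace ℝ (Fin n)) x₀
  have hcen := eventually_mem_centerBall hf hdim hcoh hφs hφu hs hu hR
  rw [nhds_prod_eq, eventually_prod_self_iff'] at hcen
  obtain ⟨V, hV, hVc⟩ := hcen
  have hsV : ∀ᶠ y in 𝓝 (ψ x₀), ψ.symm y ∈ V := by
    refine (ψ.continuousAt_symm hxt).eventually ?_
    rw [ψ.left_inv hxs]; exact hV
  set B : ℝ := ‖Ps (ψ x₀)‖ + 1 with hB
  have hB0 : 0 < B := by positivity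
  have hPB : ∀ᶠ y in 𝓝 (ψ x₀), ‖Ps y‖ < B :=
    ((h.continuousOn_s.continuousAt (h.isOpen.mem_nhds hO)).norm).eventually
      (gt_mem_nhds (lt_add_one _))
  -- A stable move of parameter `s` in direction `x` has chart speed at most `B * ‖x‖` and length at
  -- most `s * (Λ * B * ‖x‖)`. After `k` iterates its ends are within `K * (s * ‖x‖) * lam ^ k` of
  -- each other.
  set K : ℝ := C * (Λ * B) with hK
  have hΛ' : (0 : ℝ) < Λ := hΛ
  have hK0 : 0 < K := by positivity
  obtain ⟨r₀, hr₀, hr₀O⟩ := exists_closedBall_subset ((h.isOpen.eventually_mem hO).and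
    ((((ψ.symm.trans φs).open_source.eventually_mem (mem_trans_source hxs hs))).and
      (hΛb.and hPB)))
  obtain ⟨ρ₁, hρ₁, hρV⟩ := exists_closedBall_subset hsV
  -- Cost at most `1 / K` will turn the bound `K * m * lam ^ k` into `lam ^ k`. The radius `ρ₁`
  -- keeps the intersection point where center plaques give center balls of radius `R`.
  obtain ⟨U, hU, key⟩ := h.exists_mem_center_plaque hO (mem_trans_source hxs hs)
    (mem_trans_source hxs hu) hr₀ (show 0 < min ρ₁ (1 / K) by positivity)
  have hsrc := (eventually_mem_target_and (x₀ := x₀)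
    ((eventually_mem_set.2 hU).and (ball_mem_nhds (ψ x₀) hr₀))).and
    ((eventually_mem_set.2 hV).and ((φs.open_source.eventually_mem hs).and (φu.open_source.eventually_mem hu)))
  filter_upwards [(continuous_fst.tendsto (x₀, x₀)).eventually hsrc,
    (continuous_snd.tendsto (x₀, x₀)).eventually hsrc]
  rintro ⟨p, q⟩ ⟨⟨hp, hpU, hpr⟩, hpV, hps, hpu⟩ ⟨⟨hq, hqU, hqr⟩, hqV, hqs, hqu⟩ hpq
  simp only at hp hpU hpr hpV hps hpu hq hqU hqr hqV hqs hqu hpq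
  have hbO : ball (ψ x₀) r₀ ⊆ O := fun y hy => (hr₀O y (ball_subset_closedBall hy)).1
  have hcO : closedBall (ψ x₀) r₀ ⊆ ψ.target := fun y hy => hOt (hr₀O y hy).1
  -- This set replaces the local stable leaf of `q`. It records the points of the plaque whose
  -- orbits shadow that of `q` with constant proportional to the cost `m`. It is closed, contains
  -- `q` at cost `0`, and stable integral curves move inside it at cost `s * ‖x‖`.
  set A : Set (EuclideanSpace ℝ (Fin n) × ℝ) :=
    {w | w.1 ∈ plaque (ψ.symm.trans φs) (ψ p) ∩ closedBall (ψ x₀) r₀ ∧ 0 ≤ w.2 ∧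
      ∀ k : ℕ, riemannianEDist (𝓡 n) (f^[k] (ψ.symm w.1)) (f^[k] q) ≤
        ENNReal.ofReal (K * w.2 * lam ^ k)} with hA
  have hfk : ∀ k : ℕ, ContMDiff (𝓡 n) (𝓡 n) 1 (f^[k]) := fun k => f.contMDiff_toFun.iterate k
  have hclosed : IsClosed (A ∩ closedBall (ψ x₀) r₀ ×ˢ univ) := by
    have h1 : IsClosed {w : EuclideanSpace ℝ (Fin n) × ℝ |
        w.1 ∈ plaque (ψ.symm.trans φs) (ψ p) ∩ closedBall (ψ x₀) r₀} :=
      (isClosed_plaque_inter isClosed_closedBall (fun y hy => (hr₀O y hy).2.1) _).preimage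
        continuous_fst
    have h2 : ∀ k : ℕ, IsClosed {w ∈ (closedBall (ψ x₀) r₀ ×ˢ (univ : Set ℝ)) |
        riemannianEDist (𝓡 n) (f^[k] (ψ.symm w.1)) (f^[k] q) ≤
          ENNReal.ofReal (K * w.2 * lam ^ k)} := by
      intro k
      refine (isClosed_closedBall.prod isClosed_univ).isClosed_le ?_ ?_
      · refine (continuous_riemannianEDist n M).comp_continuousOn
          (ContinuousOn.prodMk ?_ continuousOn_const)
        refine (hfk k).continuous.comp_continuousOn ?_
        exact ψ.continuousOn_symm.comp continuousOn_fst fun w hw => hcO hw.1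
      · exact (ENNReal.continuous_ofReal.comp (by fun_prop)).continuousOn
    have h3 : IsClosed {w : EuclideanSpace ℝ (Fin n) × ℝ | 0 ≤ w.2} :=
      isClosed_le continuous_const continuous_snd
    convert! (h1.inter h3).inter (isClosed_iInter h2) using 1
    ext w
    simp only [hA, mem_inter_iff, mem_ofPred_eq, mem_iInter, mem_prod, mem_univ, and_true]
    constructor
    · rintro ⟨⟨h1, h2, h3⟩, h4⟩; exact ⟨⟨h1, h2⟩, fun k => ⟨h4, h3 k⟩⟩
    · rintro ⟨⟨h1, h2⟩, h3⟩; exact ⟨⟨h1, h2, fun k => (h3 k).2⟩, h1.2⟩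
  have hmove : ∀ z m, (z, m) ∈ A → z ∈ ball (ψ x₀) r₀ → ∀ x, ∀ e > 0, ∀ᶠ s in 𝓝[>] (0 : ℝ),
      ∃ z', (z', m + s * ‖x‖) ∈ A ∧ ‖z' - z - s • Ps z x‖ ≤ s * e := by
    rintro z m ⟨⟨hzp, hzc⟩, hm, hzk⟩ hzb x e he
    simp only at hzp hzc hm hzk
    have hX : ContinuousOn (fun y => Ps y x) (ball (ψ x₀) r₀) :=
      (h.continuousOn_s.mono hbO).clm_apply continuousOn_const
    obtain ⟨s₀, hs₀, σ, hσ0, hσ⟩ := h.plaques_s.exists_integral_curve isOpen_ball hX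
      (fun y hy => Submodule.mem_sup_left (h.mem_s y (hbO hy) x)) hzp.1 hzb
    have hd0 := (hσ 0 ⟨le_rfl, hs₀.le⟩).2.2
    rw [hσ0] at hd0
    filter_upwards [eventually_norm_sub_sub_smul_le hs₀ hd0 he] with s hs
    rw [hσ0] at hs
    have hs0 : 0 ≤ s := hs.1.1
    obtain ⟨hσb, ⟨hσp1, hσp2⟩, -⟩ := hσ s hs.1
    refine ⟨σ s, ⟨⟨⟨hσp1, hσp2.trans hzp.2⟩, ball_subset_closedBall hσb⟩,
      add_nonneg hm (mul_nonneg hs0 (norm_nonneg _)), fun k => ?_⟩, hs.2⟩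
    obtain ⟨γ, hγ, hγD, hγ0, hγ1, hγl⟩ := rescaled_curve (D := Es) (x₀ := x₀)
      (fun y hy => hOt (hbO hy)) hX (fun y hy => h.mem_s y (hbO hy) x)
      (fun t ht => ⟨(hσ t ht).1, (hσ t ht).2.2⟩) hs.1
    rw [hσ0] at hγ0
    have hlen := hγl (ENNReal.ofReal (Λ * B * ‖x‖)) fun y hy => by
      obtain ⟨-, -, h1, h2⟩ := hr₀O y (ball_subset_closedBall hy)
      refine (h1 _).trans ?_
      rw [mul_assoc, ENNReal.ofReal_mul hΛ'.le, ENNReal.ofReal_coe_nnreal, ← ofReal_norm]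
      gcongr
      exact (ContinuousLinearMap.le_opNorm _ _).trans (by gcongr)
    have hdist := riemannianEDist_image_le hγ hγD (hfk k)
      (fun y v hv h1 => (hst y k v hv h1).le) (by positivity)
    rw [hγ0, hγ1] at hdist
    simp only
    calc riemannianEDist (𝓡 n) (f^[k] (ψ.symm (σ s))) (f^[k] q)
        ≤ riemannianEDist (𝓡 n) (f^[k] (ψ.symm (σ s))) (f^[k] (ψ.symm z)) +
          riemannianEDist (𝓡 n) (f^[k] (ψ.symm z)) (f^[k] q) := riemannianEDist_triangle
      _ ≤ ENNReal.ofReal (C * lam ^ k) * (ENNReal.ofReal s * ENNReal.ofReal (Λ * B * ‖x‖)) +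
          ENNReal.ofReal (K * m * lam ^ k) := by
          refine add_le_add ?_ (hzk k)
          rw [riemannianEDist_comm]
          exact hdist.trans (by gcongr)
      _ = ENNReal.ofReal (K * (m + s * ‖x‖) * lam ^ k) := by
          rw [← ENNReal.ofReal_mul hs0, ← ENNReal.ofReal_mul (by positivity),
            ← ENNReal.ofReal_add (by positivity) (by positivity)]
          congr 1
          rw [hK]; ring
  obtain ⟨z, m, hzA, ⟨hz1, hz2⟩, hzρ, hm⟩ := key (ψ p) hpU (ψ q) hqU A hclosed
    (fun w hw => hw.1.1) ⟨⟨mem_plaque_chart hp hq hqs hpq.symm, ball_subset_closedBall hqr⟩, le_rfl,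
      fun k => by rw [ψ.left_inv hq, riemannianEDist_self]; exact zero_le⟩ hmove
  have hzt : z ∈ closedBall (ψ x₀) ρ₁ :=
    ball_subset_closedBall (ball_subset_ball (min_le_left _ _) hzρ)
  refine ⟨ψ.symm z, ?_, fun k => (hzA.2.2 k).trans ?_⟩
  · have := hVc p hpV (ψ.symm z) (hρV z hzt)
    exact this (of_mem_plaque_chart hp hz1).2.symm (of_mem_plaque_chart hp hz2).2.symm
  · refine ENNReal.ofReal_le_ofReal (mul_le_of_le_one_left (by positivity) ?_)
    have : m ≤ 1 / K := hm.trans (min_le_right _ _)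
    rw [le_div_iff₀ hK0] at this
    simp only
    linarith

end PartialHyperbolicity

namespace PartialHyperbolicity

open Metric

set_option linter.unusedSectionVars false

/-! ### Center curves and center balls -/

open scoped ENNReal NNReal

theorem Foliation.IsLeafCurve.comp {n d : ℕ} {M : Type*} [TopologicalSpace M]
    {W : Foliation n d M} {γ : ℝ → M} (h : W.IsLeafCurve γ) {u : ℝ → ℝ} (hu : Continuous u)
    (hm : MapsTo u (Icc 0 1) (Icc 0 1)) : W.IsLeafCurve (γ ∘ u) := by
  refine ⟨h.1.comp hu.continuousOn hm, fun t ht φ hφ hs => ?_⟩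
  exact (hu.continuousWithinAt.tendsto_nhdsWithin hm).eventually (h.2 _ (hm ht) φ hφ hs)

theorem Foliation.IsLeafCurve.of_eventuallyEq {n d : ℕ} {M : Type*} [TopologicalSpace M]
    {W : Foliation n d M} {γ : ℝ → M}
    (h : ∀ t ∈ Icc (0 : ℝ) 1, ∃ γ', W.IsLeafCurve γ' ∧ γ =ᶠ[𝓝 t] γ') : W.IsLeafCurve γ := by
  refine ⟨fun t ht => ?_, fun t ht φ hφ hs => ?_⟩
  · obtain ⟨γ', h1, h2⟩ := h t ht
    exact (h1.1 t ht).congr_of_eventuallyEq (h2.filter_mono nhdsWithin_le_nhds) h2.eq_of_nhds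
  · obtain ⟨γ', h1, h2⟩ := h t ht
    rw [h2.eq_of_nhds] at hs ⊢
    filter_upwards [h1.2 t ht φ hφ hs, h2.filter_mono nhdsWithin_le_nhds] with s h3 h4
    rw [h4, h3]

theorem Foliation.IsLeafCurve.apply_eq {n d : ℕ} {M : Type*} [TopologicalSpace M]
    {W : Foliation n d M} {γ : ℝ → M} (h : W.IsLeafCurve γ) {φ} (hφ : φ ∈ W.charts)
    (hs : ∀ t ∈ Icc (0 : ℝ) 1, γ t ∈ φ.source) : (φ (γ 0)).2 = (φ (γ 1)).2 := by
  have hl : IsLocallyConstant fun t : unitInterval => (φ (γ t)).2 := by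
    rw [IsLocallyConstant.iff_eventually_eq]
    rintro ⟨t, ht⟩
    have := h.2 t ht φ hφ (hs t ht)
    rw [nhdsWithin_eq_map_subtype_coe ht] at this
    exact this
  exact hl.apply_eq_of_preconnectedSpace 0 1

variable {n : ℕ} {M : Type*} [TopologicalSpace M] [ChartedSpace (EuclideanSpace ℝ (Fin n)) M]
  {dcs dcu : ℕ} {Wcs : Foliation n dcs M} {Wcu : Foliation n dcu M}

theorem IsCenterCurve.comp {γ : ℝ → M} (h : IsCenterCurve Wcs Wcu γ) {u : ℝ → ℝ}
    (hu : ContDiff ℝ 1 u) (hm : MapsTo u (Icc 0 1) (Icc 0 1)) : IsCenterCurve Wcs Wcu (γ ∘ u) :=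
  ⟨ContMDiffOn.comp h.contMDiff hu.contMDiff.contMDiffOn hm, h.leaf_cs.comp hu.continuous hm,
    h.leaf_cu.comp hu.continuous hm⟩

theorem IsCenterCurve.of_eventuallyEq {γ : ℝ → M}
    (h : ∀ t ∈ Icc (0 : ℝ) 1, ∃ γ', IsCenterCurve Wcs Wcu γ' ∧ γ =ᶠ[𝓝 t] γ') :
    IsCenterCurve Wcs Wcu γ := by
  refine ⟨fun t ht => ?_, Foliation.IsLeafCurve.of_eventuallyEq fun t ht => ?_,
    Foliation.IsLeafCurve.of_eventuallyEq fun t ht => ?_⟩ <;> obtain ⟨γ', h1, h2⟩ := h t ht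
  · exact (h1.contMDiff t ht).congr_of_eventuallyEq (h2.filter_mono nhdsWithin_le_nhds)
      h2.eq_of_nhds
  · exact ⟨γ', h1.leaf_cs, h2⟩
  · exact ⟨γ', h1.leaf_cu, h2⟩

variable [RiemannianBundle (fun x : M => TangentSpace (𝓡 n) x)]

theorem mem_centerLeaf_of_mem_centerBall {R : ℝ} {x y : M} (h : y ∈ centerBall Wcs Wcu R x) :
    y ∈ centerLeaf Wcs Wcu x := by
  obtain ⟨γ, h1, h2, h3, -⟩ := h
  exact ⟨γ, h1, h2, h3⟩

theorem centerBall_mono {R R' : ℝ} (h : R ≤ R') (x : M) :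
    centerBall Wcs Wcu R x ⊆ centerBall Wcs Wcu R' x := by
  rintro y ⟨γ, h1, h2, h3, h4⟩
  exact ⟨γ, h1, h2, h3, h4.trans_le (ENNReal.ofReal_le_ofReal h)⟩

/-- To concatenate within the `C^1` class, both curves are reparametrised by smooth transitions that
are at rest on `[1/3, 2/3]`, around the junction. Monotone reparametrisation does not change the
length. -/
theorem mem_centerBall_trans {R R' : ℝ} {x y z : M} (hy : y ∈ centerBall Wcs Wcu R x)
    (hz : z ∈ centerBall Wcs Wcu R' y) : z ∈ centerBall Wcs Wcu (R + R') x := by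
  obtain ⟨γ₁, h₁, rfl, hy1, hl₁⟩ := hy
  obtain ⟨γ₂, h₂, hy2, rfl, hl₂⟩ := hz
  have hR : 0 < R := by
    by_contra h
    rw [ENNReal.ofReal_of_nonpos (not_lt.1 h)] at hl₁
    exact not_lt_zero hl₁
  have hR' : 0 < R' := by
    by_contra h
    rw [ENNReal.ofReal_of_nonpos (not_lt.1 h)] at hl₂
    exact not_lt_zero hl₂
  set u₁ : ℝ → ℝ := fun t => Real.smoothTransition (3 * t) with hu₁
  set u₂ : ℝ → ℝ := fun t => Real.smoothTransition (3 * t - 2) with hu₂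
  have hc₁ : ContDiff ℝ 1 u₁ := Real.smoothTransition.contDiff.comp (by fun_prop)
  have hc₂ : ContDiff ℝ 1 u₂ := Real.smoothTransition.contDiff.comp (by fun_prop)
  have hm₁ : MapsTo u₁ (Icc 0 1) (Icc 0 1) := fun t _ =>
    ⟨Real.smoothTransition.nonneg _, Real.smoothTransition.le_one _⟩
  have hm₂ : MapsTo u₂ (Icc 0 1) (Icc 0 1) := fun t _ =>
    ⟨Real.smoothTransition.nonneg _, Real.smoothTransition.le_one _⟩
  have one₁ : ∀ t, 1 / 3 ≤ t → u₁ t = 1 := fun t ht =>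
    Real.smoothTransition.one_of_one_le (by linarith)
  have zero₂ : ∀ t, t ≤ 2 / 3 → u₂ t = 0 := fun t ht =>
    Real.smoothTransition.zero_of_nonpos (by linarith)
  have mono₁ : Monotone u₁ := fun a b hab => Real.smoothTransition.monotone (by linarith)
  have mono₂ : Monotone u₂ := fun a b hab => Real.smoothTransition.monotone (by linarith)
  set γ : ℝ → M := fun t => if t ≤ 1 / 2 then γ₁ (u₁ t) else γ₂ (u₂ t) with hγ
  have e₁ : ∀ t, t ≤ 2 / 3 → γ t = (γ₁ ∘ u₁) t := by
    intro t ht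
    by_cases h : t ≤ 1 / 2
    · simp only [hγ, if_pos h, Function.comp_apply]
    · simp only [hγ, if_neg h, Function.comp_apply]
      rw [zero₂ t ht, one₁ t (by linarith), hy1, hy2]
  have e₂ : ∀ t, 1 / 3 ≤ t → γ t = (γ₂ ∘ u₂) t := by
    intro t ht
    by_cases h : t ≤ 1 / 2
    · simp only [hγ, if_pos h, Function.comp_apply]
      rw [zero₂ t (by linarith), one₁ t (by linarith), hy1, hy2]
    · simp only [hγ, if_neg h, Function.comp_apply]
  have u10 : u₁ 0 = 0 := by simp [hu₁]
  have u21 : u₂ 1 = 1 := Real.smoothTransition.one_of_one_le (by norm_num)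
  refine ⟨γ, IsCenterCurve.of_eventuallyEq fun t ht => ?_, ?_, ?_, ?_⟩
  · rcases lt_or_ge t (2 / 3) with h | h
    · exact ⟨_, h₁.comp hc₁ hm₁, (gt_mem_nhds h).mono fun s hs => e₁ s hs.le⟩
    · exact ⟨_, h₂.comp hc₂ hm₂, (lt_mem_nhds (show (1 / 3 : ℝ) < t by linarith)).mono
        fun s hs => e₂ s hs.le⟩
  · rw [e₁ 0 (by norm_num), Function.comp_apply, u10]
  · rw [e₂ 1 (by norm_num), Function.comp_apply, u21]
  · have l₁ : pathELength (𝓡 n) γ 0 (1 / 2) = pathELength (𝓡 n) γ₁ 0 1 := by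
      rw [pathELength_congr (γ' := γ₁ ∘ u₁) fun t ht => e₁ t (by linarith [ht.2]),
        pathELength_comp_of_monotoneOn (by norm_num) (mono₁.monotoneOn _)
          (hc₁.differentiable one_ne_zero).differentiableOn, u10, one₁ _ (by norm_num)]
      rw [u10, one₁ _ (by norm_num)]
      exact h₁.contMDiff.mdifferentiableOn one_ne_zero
    have l₂ : pathELength (𝓡 n) γ (1 / 2) 1 = pathELength (𝓡 n) γ₂ 0 1 := by
      rw [pathELength_congr (γ' := γ₂ ∘ u₂) fun t ht => e₂ t (by linarith [ht.1]),
        pathELength_comp_of_monotoneOn (by norm_num) (mono₂.monotoneOn _)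
          (hc₂.differentiable one_ne_zero).differentiableOn, u21, zero₂ _ (by norm_num)]
      rw [u21, zero₂ _ (by norm_num)]
      exact h₂.contMDiff.mdifferentiableOn one_ne_zero
    rw [← pathELength_add (show (0 : ℝ) ≤ 1 / 2 by norm_num) (by norm_num), l₁, l₂,
      ENNReal.ofReal_add hR.le hR'.le]
    exact ENNReal.add_lt_add hl₁ hl₂

theorem IsCenterCurve.mem_centerBall {γ : ℝ → M} (h : IsCenterCurve Wcs Wcu γ) {a b R : ℝ}
    (ha : 0 ≤ a) (hab : a ≤ b) (hb : b ≤ 1)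
    (hR : pathELength (𝓡 n) γ a b < ENNReal.ofReal R) : γ b ∈ centerBall Wcs Wcu R (γ a) := by
  set u : ℝ → ℝ := fun t => a + (b - a) * t with hu
  have hc : ContDiff ℝ 1 u := by fun_prop
  have hmono : Monotone u := fun s t hst => by
    have := mul_le_mul_of_nonneg_left hst (sub_nonneg.2 hab)
    simp only [hu]; linarith
  have u0 : u 0 = a := by simp [hu]
  have u1 : u 1 = b := by simp [hu]
  have hm : MapsTo u (Icc 0 1) (Icc 0 1) := fun t ht =>
    ⟨ha.trans (u0 ▸ hmono ht.1), (u1 ▸ hmono ht.2 : u t ≤ b).trans hb⟩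
  refine ⟨_, h.comp hc hm, by simp [u0], by simp [u1], ?_⟩
  rw [pathELength_comp_of_monotoneOn zero_le_one (hmono.monotoneOn _)
    (hc.differentiable one_ne_zero).differentiableOn, u0, u1]
  · exact hR
  · rw [u0, u1]
    exact (h.contMDiff.mdifferentiableOn one_ne_zero).mono (Icc_subset_Icc ha hb)

/-- Absolute continuity of the integral of the speed. -/
theorem exists_pathELength_lt {γ : ℝ → M} (h : pathELength (𝓡 n) γ 0 1 ≠ ⊤) {ε : ℝ≥0∞}
    (hε : ε ≠ 0) : ∃ d > 0, ∀ a b : ℝ, 0 ≤ a → b ≤ 1 → b - a < d →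
      pathELength (𝓡 n) γ a b < ε := by
  rw [pathELength] at h
  obtain ⟨d, hd, hd'⟩ := MeasureTheory.exists_pos_setLIntegral_lt_of_measure_lt h hε
  obtain ⟨d', hd'0, hd'd⟩ := ENNReal.lt_iff_exists_nnreal_btwn.1 hd
  refine ⟨d', by exact_mod_cast hd'0, fun a b ha hb hab => ?_⟩
  have h1 := hd' (Icc a b) (by
    refine (MeasureTheory.Measure.restrict_apply_le _ _).trans_lt (lt_of_le_of_lt ?_ hd'd)
    rw [Real.volume_Icc]
    exact ENNReal.ofReal_le_of_le_toReal (by simpa using hab.le))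
  rw [MeasureTheory.Measure.restrict_restrict measurableSet_Icc,
    inter_eq_left.2 (Icc_subset_Icc ha hb)] at h1
  rw [pathELength]
  exact h1

/-- The times before which the length is less than `R`, and those after which it is less than `R'`,
form two non-empty open sets covering `[0,1]`. By connectedness they meet. -/
theorem exists_mem_centerBall_split {R R' : ℝ} (hR : 0 < R) (hR' : 0 < R') {x y : M}
    (hy : y ∈ centerBall Wcs Wcu (R + R') x) :
    ∃ z ∈ centerBall Wcs Wcu R x, y ∈ centerBall Wcs Wcu R' z := by
  obtain ⟨γ, hγ, rfl, rfl, hl⟩ := hy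
  have hfin : pathELength (𝓡 n) γ 0 1 ≠ ⊤ := hl.ne_top
  have hadd : ∀ t : unitInterval, pathELength (𝓡 n) γ 0 t + pathELength (𝓡 n) γ t 1 =
      pathELength (𝓡 n) γ 0 1 := fun t => pathELength_add t.2.1 t.2.2
  have hU : IsOpen {t : unitInterval | pathELength (𝓡 n) γ 0 t < ENNReal.ofReal R} := by
    rw [Metric.isOpen_iff]
    intro t ht
    obtain ⟨d, hd, hd'⟩ := exists_pathELength_lt hfin (tsub_pos_of_lt ht).ne'
    refine ⟨d, hd, fun s hs => ?_⟩
    have hs' : |(s : ℝ) - t| < d := hs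
    rcases le_total (s : ℝ) t with hst | hst
    · exact (pathELength_mono le_rfl hst).trans_lt ht
    · have := hd' t s t.2.1 s.2.2 (le_abs_self _ |>.trans_lt hs')
      change pathELength (𝓡 n) γ 0 s < _
      rw [← pathELength_add t.2.1 hst, add_comm]
      exact lt_tsub_iff_right.1 this
  have hV : IsOpen {t : unitInterval | pathELength (𝓡 n) γ t 1 < ENNReal.ofReal R'} := by
    rw [Metric.isOpen_iff]
    intro t ht
    obtain ⟨d, hd, hd'⟩ := exists_pathELength_lt hfin (tsub_pos_of_lt ht).ne'
    refine ⟨d, hd, fun s hs => ?_⟩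
    have hs' : |(s : ℝ) - t| < d := hs
    rcases le_total (s : ℝ) t with hst | hst
    · have := hd' s t s.2.1 t.2.2 (by rw [abs_sub_comm] at hs'; exact (le_abs_self _).trans_lt hs')
      change pathELength (𝓡 n) γ s 1 < _
      rw [← pathELength_add hst t.2.2]
      exact lt_tsub_iff_right.1 this
    · exact (pathELength_mono hst le_rfl).trans_lt ht
  obtain ⟨t, ht, ht'⟩ := nonempty_inter hU hV (by
    rw [eq_univ_iff_forall]
    intro t
    by_contra h
    simp only [mem_union, mem_ofPred_eq, not_or, not_lt] at h
    rw [← hadd t, ENNReal.ofReal_add hR.le hR'.le] at hl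
    exact absurd hl (not_lt.2 (add_le_add h.1 h.2)))
    ⟨0, by simpa using hR⟩ ⟨1, by simpa using hR'⟩
  exact ⟨γ t, hγ.mem_centerBall le_rfl t.2.1 t.2.2 ht, hγ.mem_centerBall t.2.1 t.2.2 le_rfl ht'⟩

end PartialHyperbolicity

namespace PartialHyperbolicity

open Metric

set_option linter.unusedSectionVars false

/-! ### Limits of center balls -/

open scoped ENNReal NNReal

variable {n : ℕ} {M : Type*} [TopologicalSpace M] [ChartedSpace (EuclideanSpace ℝ (Fin n)) M]
  [IsManifold (𝓡 n) 1 M] [RiemannianBundle (fun x : M => TangentSpace (𝓡 n) x)]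
  [IsContinuousRiemannianBundle (EuclideanSpace ℝ (Fin n)) (fun x : M => TangentSpace (𝓡 n) x)]
  {f : M ≃ₘ^1⟮𝓡 n, 𝓡 n⟯ M} {Es Ec Eu : Distribution n M} {dcs dcu : ℕ}
  {Wcs : Foliation n dcs M} {Wcu : Foliation n dcu M}

theorem IsCenterCurve.riemannianEDist_le {γ : ℝ → M} (h : IsCenterCurve Wcs Wcu γ) {t : ℝ}
    (ht : t ∈ Icc (0 : ℝ) 1) :
    riemannianEDist (𝓡 n) (γ 0) (γ t) ≤ pathELength (𝓡 n) γ 0 1 :=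
  (riemannianEDist_le_pathELength (h.contMDiff.mono (Icc_subset_Icc le_rfl ht.2)) rfl rfl
    ht.1).trans (pathELength_mono le_rfl ht.2)

/-- Short center balls pass to the limit, with a loss in the radius. -/
theorem exists_pos_forall_tendsto_mem_centerBall [CompactSpace M] [T2Space M]
    (hf : IsPartiallyHyperbolic f Es Ec Eu) (hdim : ∀ x, Module.finrank ℝ (Ec x) = 1)
    (hcoh : IsDynamicallyCoherent f Es Ec Eu Wcs Wcu) :
    ∃ η > (0 : ℝ), ∀ {ι : Type} (F : Filter ι) [F.NeBot] (p c : ι → M) (x y : M),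
      (∀ i, c i ∈ centerBall Wcs Wcu η (p i)) → Tendsto p F (𝓝 x) → Tendsto c F (𝓝 y) →
      y ∈ centerBall Wcs Wcu 1 x := by
  have hloc : ∀ x₀ : M, ∃ N : Set M, IsOpen N ∧ x₀ ∈ N ∧ ∃ φs ∈ Wcs.charts, ∃ φu ∈ Wcu.charts,
      N ⊆ φs.source ∧ N ⊆ φu.source ∧ ∀ p ∈ N, ∀ q ∈ N, (φs p).2 = (φs q).2 →
        (φu p).2 = (φu q).2 → q ∈ centerBall Wcs Wcu 1 p := by
    intro x₀
    obtain ⟨φs, hφs, hs⟩ := Wcs.cover x₀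
    obtain ⟨φu, hφu, hu⟩ := Wcu.cover x₀
    have h := eventually_mem_centerBall hf hdim hcoh hφs hφu hs hu one_pos
    rw [nhds_prod_eq, eventually_prod_self_iff'] at h
    obtain ⟨V, hV, hVc⟩ := h
    obtain ⟨V', hVV', hV'o, hxV'⟩ := mem_nhds_iff.1 hV
    exact ⟨V' ∩ φs.source ∩ φu.source, (hV'o.inter φs.open_source).inter φu.open_source,
      ⟨⟨hxV', hs⟩, hu⟩, φs, hφs, φu, hφu, fun y hy => hy.1.2, fun y hy => hy.2,
      fun p hp q hq h1 h2 => hVc p (hVV' hp.1.1) q (hVV' hq.1.1) h1 h2⟩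
  choose N hNo hxN φs hφs φu hφu hNs hNu hN using hloc
  let _ := PseudoEMetricSpace.ofRiemannianMetric (𝓡 n) M
  have hedist : ∀ x y : M, edist x y = riemannianEDist (𝓡 n) x y := fun _ _ => rfl
  -- With `η < δ / 2`, a center curve of length less than `η` starting within `δ / 2` of `x` stays
  -- in one `N x₀`. Its endpoints then share the plaques of one fixed pair of charts, an equality of
  -- transversal coordinates that survives the limit.
  obtain ⟨δ, hδ, hδN⟩ := lebesgue_number_lemma_of_emetric (isCompact_univ (X := M)) hNo
    (fun x _ => mem_iUnion.2 ⟨x, hxN x⟩)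
  obtain ⟨η, hη0, hηδ⟩ := ENNReal.lt_iff_exists_nnreal_btwn.1 (ENNReal.half_pos hδ.ne')
  refine ⟨η, by exact_mod_cast hη0, ?_⟩
  intro ι F _ p c x y hc hp hcy
  obtain ⟨x₀, hx₀⟩ := hδN x (mem_univ x)
  have hnear : ∀ᶠ i in F, edist x (p i) < δ / 2 := by
    have : Tendsto (fun i => edist x (p i)) F (𝓝 (edist x x)) := tendsto_const_nhds.edist hp
    rw [edist_self] at this
    exact this.eventually (gt_mem_nhds (ENNReal.half_pos hδ.ne'))
  have hcurve : ∀ᶠ i in F, p i ∈ N x₀ ∧ c i ∈ N x₀ ∧ edist (p i) (c i) ≤ η ∧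
      (φs x₀ (p i)).2 = (φs x₀ (c i)).2 ∧ (φu x₀ (p i)).2 = (φu x₀ (c i)).2 := by
    filter_upwards [hnear] with i hi
    obtain ⟨γ, hγ, h0, h1, hl⟩ := hc i
    rw [ENNReal.ofReal_coe_nnreal] at hl
    have hin : ∀ t ∈ Icc (0 : ℝ) 1, γ t ∈ N x₀ := by
      intro t ht
      refine hx₀ ?_
      rw [Metric.mem_eball, edist_comm]
      calc edist x (γ t) ≤ edist x (p i) + edist (p i) (γ t) := edist_triangle _ _ _
        _ < δ / 2 + δ / 2 := by
          refine ENNReal.add_lt_add hi ?_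
          rw [hedist, ← h0]
          exact (hγ.riemannianEDist_le ht).trans_lt (hl.trans hηδ)
        _ = δ := ENNReal.add_halves δ
    have hs := hγ.leaf_cs.apply_eq (hφs x₀) fun t ht => hNs x₀ (hin t ht)
    have hu := hγ.leaf_cu.apply_eq (hφu x₀) fun t ht => hNu x₀ (hin t ht)
    rw [h0, h1] at hs hu
    refine ⟨h0 ▸ hin 0 (by simp), h1 ▸ hin 1 (by simp), ?_, hs, hu⟩
    rw [hedist, ← h0, ← h1]
    exact (hγ.riemannianEDist_le (by simp)).trans hl.le
  have hx : x ∈ N x₀ := hx₀ (Metric.mem_eball_self hδ)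
  have hy : y ∈ N x₀ := by
    refine hx₀ ?_
    rw [Metric.mem_eball, edist_comm]
    have h1 : edist x y ≤ η := le_of_tendsto (hp.edist hcy) (hcurve.mono fun i hi => hi.2.2.1)
    exact h1.trans_lt (hηδ.trans_le ENNReal.half_le_self)
  refine hN x₀ x hx y hy ?_ ?_
  · have h1 : Tendsto (fun i => (φs x₀ (p i)).2) F (𝓝 (φs x₀ x).2) :=
      (((φs x₀).continuousAt (hNs x₀ hx)).snd).tendsto.comp hp
    have h2 : Tendsto (fun i => (φs x₀ (c i)).2) F (𝓝 (φs x₀ y).2) :=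
      (((φs x₀).continuousAt (hNs x₀ hy)).snd).tendsto.comp hcy
    exact tendsto_nhds_unique (h1.congr' (hcurve.mono fun i hi => hi.2.2.2.1)) h2
  · have h1 : Tendsto (fun i => (φu x₀ (p i)).2) F (𝓝 (φu x₀ x).2) :=
      (((φu x₀).continuousAt (hNu x₀ hx)).snd).tendsto.comp hp
    have h2 : Tendsto (fun i => (φu x₀ (c i)).2) F (𝓝 (φu x₀ y).2) :=
      (((φu x₀).continuousAt (hNu x₀ hy)).snd).tendsto.comp hcy
    exact tendsto_nhds_unique (h1.congr' (hcurve.mono fun i hi => hi.2.2.2.2)) h2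

/-- Center balls of a fixed radius pass to the limit, with a loss in the radius. -/
theorem exists_forall_tendsto_mem_centerBall [CompactSpace M] [T2Space M]
    (hf : IsPartiallyHyperbolic f Es Ec Eu) (hdim : ∀ x, Module.finrank ℝ (Ec x) = 1)
    (hcoh : IsDynamicallyCoherent f Es Ec Eu Wcs Wcu) (R : ℝ) :
    ∃ R' > (0 : ℝ), ∀ {ι : Type} (F : Ultrafilter ι) (p c : ι → M) (x y : M),
      (∀ i, c i ∈ centerBall Wcs Wcu R (p i)) → Tendsto p F (𝓝 x) → Tendsto c F (𝓝 y) →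
      y ∈ centerBall Wcs Wcu R' x := by
  obtain ⟨η, hη, h⟩ := exists_pos_forall_tendsto_mem_centerBall hf hdim hcoh
  -- A center curve of length less than `(K + 1) * η` is cut into `K + 1` pieces of length less than
  -- `η`. By compactness the cut points converge along the ultrafilter, and each piece contributes
  -- radius `1` in the limit.
  have key : ∀ K : ℕ, ∀ {ι : Type} (F : Ultrafilter ι) (p c : ι → M) (x y : M),
      (∀ i, c i ∈ centerBall Wcs Wcu ((K + 1) * η) (p i)) → Tendsto p F (𝓝 x) →
      Tendsto c F (𝓝 y) → y ∈ centerBall Wcs Wcu (K + 1) x := by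
    intro K
    induction K with
    | zero =>
      intro ι F p c x y hc hp hcy
      simp only [Nat.cast_zero, zero_add, one_mul] at hc ⊢
      exact h F p c x y hc hp hcy
    | succ K ih =>
      intro ι F p c x y hc hp hcy
      have hsplit : ∀ i, ∃ z ∈ centerBall Wcs Wcu η (p i),
          c i ∈ centerBall Wcs Wcu ((K + 1) * η) z := by
        intro i
        refine exists_mem_centerBall_split hη (by positivity) ?_
        have := hc i
        push_cast at this
        convert this using 2
        ring
      choose z hz hz' using hsplit
      obtain ⟨w, hw⟩ : ∃ w, Tendsto z F (𝓝 w) := by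
        obtain ⟨w, -, hw⟩ := isCompact_univ.ultrafilter_le_nhds (F.map z) (by simp)
        exact ⟨w, hw⟩
      have := mem_centerBall_trans (h F p z x w hz hp hw) (ih F z c w y hz' hw hcy)
      convert this using 2
      push_cast; ring
  obtain ⟨K, hK⟩ := exists_nat_gt (R / η)
  refine ⟨K + 1, by positivity, fun F p c x y hc hp hcy => key K F p c x y (fun i => ?_) hp hcy⟩
  refine centerBall_mono ?_ _ (hc i)
  rw [div_lt_iff₀ hη] at hK
  nlinarith

/-! ### Chains -/

section Chain

variable {X : Type*}

/-- Chains of `N` steps of a relation. -/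
def Chain (S : X → X → Prop) : ℕ → X → X → Prop
  | 0, p, q => p = q
  | N + 1, p, q => ∃ r, S p r ∧ Chain S N r q

variable {S : X → X → Prop}

theorem Chain.trans {N N' : ℕ} {p q r : X} (h : Chain S N p q) (h' : Chain S N' q r) :
    Chain S (N + N') p r := by
  induction N generalizing p with
  | zero => rw [zero_add]; cases h; exact h'
  | succ N ih =>
    obtain ⟨s, hs, hsq⟩ := h
    rw [Nat.succ_add]
    exact ⟨s, hs, ih hsq⟩

theorem Chain.of_le (hS : ∀ p, S p p) {N N' : ℕ} (hN : N ≤ N') {p q : X} (h : Chain S N p q) :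
    Chain S N' p q := by
  obtain ⟨k, rfl⟩ := Nat.exists_eq_add_of_le hN
  refine h.trans ?_
  clear h hN
  induction k with
  | zero => rfl
  | succ k ih => exact ⟨q, hS q, ih⟩

/-- All points near `x` are joined, by chains of bounded length, to points near `z`. -/
def IsChainJoined [TopologicalSpace X] (S : X → X → Prop) (x z : X) : Prop :=
  ∃ N, ∀ W ∈ 𝓝 z, ∀ᶠ x' in 𝓝 x, ∃ z' ∈ W, Chain S N x' z'

variable [TopologicalSpace X]

theorem IsChainJoined.refl (x : X) : IsChainJoined S x x :=
  ⟨0, fun _ hW => mem_of_superset hW fun x' hx' => ⟨x', hx', rfl⟩⟩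

theorem IsChainJoined.trans {x y z : X} (h : IsChainJoined S x y) (h' : IsChainJoined S y z) :
    IsChainJoined S x z := by
  obtain ⟨N, h⟩ := h
  obtain ⟨N', h'⟩ := h'
  refine ⟨N + N', fun W hW => ?_⟩
  filter_upwards [h _ (h' W hW)] with x' hx'
  obtain ⟨y', ⟨z', hz', hyz⟩, hxy⟩ := hx'
  exact ⟨z', hz', hxy.trans hyz⟩

/-- If nearby points of a plaque are related, all pairs of points of a leaf are chain joined. -/
theorem Foliation.isChainJoined {n d : ℕ} (W : Foliation n d X)
    (hS : ∀ x₀, ∀ φ ∈ W.charts, x₀ ∈ φ.source → ∀ᶠ p : X × X in 𝓝 (x₀, x₀),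
      (φ p.1).2 = (φ p.2).2 → S p.1 p.2) {x z : X} (hz : z ∈ W.leaf x) : IsChainJoined S x z := by
  have hlocal : ∀ x₀, ∀ φ ∈ W.charts, x₀ ∈ φ.source → ∃ V ∈ 𝓝 x₀, ∀ p ∈ V, ∀ q ∈ V,
      (φ p).2 = (φ q).2 → IsChainJoined S p q := by
    intro x₀ φ hφ hx₀
    have h := hS x₀ φ hφ hx₀
    rw [nhds_prod_eq, eventually_prod_self_iff'] at h
    obtain ⟨V, hV, hVS⟩ := h
    obtain ⟨V', hVV', hV'o, hxV'⟩ := mem_nhds_iff.1 hV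
    refine ⟨V' ∩ φ.source, (hV'o.inter φ.open_source).mem_nhds ⟨hxV', hx₀⟩, ?_⟩
    rintro p ⟨hpV, hps⟩ q ⟨hqV, hqs⟩ hpq
    refine ⟨1, fun U hU => ?_⟩
    -- Local holonomy: a point `p'` near `p` is joined to the point of its own plaque that has the
    -- leaf coordinate of `q`, and this point is near `q`.
    have hc : ContinuousAt (fun p' => φ.symm ((φ q).1, (φ p').2)) p := by
      have h1 : ContinuousAt φ.symm ((φ q).1, (φ p).2) :=
        φ.continuousAt_symm (by rw [W.target_eq φ hφ]; trivial)
      exact ContinuousAt.comp (f := fun p' => ((φ q).1, (φ p').2)) h1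
        (continuousAt_const.prodMk (φ.continuousAt hps).snd)
    have hq : φ.symm ((φ q).1, (φ p).2) = q := by rw [hpq]; exact φ.left_inv hqs
    have hev : ∀ᶠ p' in 𝓝 p, φ.symm ((φ q).1, (φ p').2) ∈ U ∩ V' := by
      refine hc.eventually ?_
      beta_reduce
      rw [hq]
      exact inter_mem hU (hV'o.mem_nhds hqV)
    filter_upwards [hev, hV'o.mem_nhds hpV] with p' hp' hp'V
    refine ⟨_, hp'.1, _, hVS p' (hVV' hp'V) _ (hVV' hp'.2) ?_, rfl⟩
    simp only
    rw [φ.right_inv (by rw [W.target_eq φ hφ]; trivial)]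
  have hplaque : ∀ x y, W.SamePlaque x y → IsChainJoined S x y := by
    rintro x y ⟨φ, hφ, hx, hy, hxy⟩
    set g : EuclideanSpace ℝ (Fin d) → X := fun a => φ.symm (a, (φ x).2) with hg
    have hgc : Continuous g := by
      have : ContinuousOn φ.symm univ := by rw [← W.target_eq φ hφ]; exact φ.continuousOn_symm
      exact (continuousOn_univ.1 this).comp (by fun_prop)
    have hgs : ∀ a, g a ∈ φ.source := fun a =>
      φ.map_target (by rw [W.target_eq φ hφ]; trivial)
    have hgv : ∀ a, (φ (g a)).2 = (φ x).2 := fun a => by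
      rw [hg]; simp only; rw [φ.right_inv (by rw [W.target_eq φ hφ]; trivial)]
    have hnear : ∀ a, ∀ᶠ b in 𝓝 a, IsChainJoined S (g a) (g b) ∧ IsChainJoined S (g b) (g a) := by
      intro a
      obtain ⟨V, hV, h⟩ := hlocal (g a) φ hφ (hgs a)
      filter_upwards [hgc.continuousAt.eventually (eventually_mem_set.2 hV)] with b hb
      exact ⟨h _ (mem_of_mem_nhds hV) _ hb ((hgv a).trans (hgv b).symm),
        h _ hb _ (mem_of_mem_nhds hV) ((hgv b).trans (hgv a).symm)⟩
    -- A plaque is parametrised by a whole Euclidean space, because the charts have full target. It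
    -- is connected, so a clopen condition propagates along it.
    have hclopen : IsClopen {a | IsChainJoined S x (g a)} := by
      constructor
      · rw [← isOpen_compl_iff, isOpen_iff_mem_nhds]
        intro a ha
        filter_upwards [hnear a] with b hb hb'
        exact ha (hb'.trans hb.2)
      · rw [isOpen_iff_mem_nhds]
        intro a ha
        filter_upwards [hnear a] with b hb
        exact ha.trans hb.1
    have hx' : g (φ x).1 = x := φ.left_inv hx
    have hy' : g (φ y).1 = y := by rw [hg]; simp only; rw [hxy]; exact φ.left_inv hy
    have huniv := hclopen.eq_univ ⟨(φ x).1, by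
      change IsChainJoined S x (g (φ x).1)
      rw [hx']; exact IsChainJoined.refl x⟩
    have : (φ y).1 ∈ {a | IsChainJoined S x (g a)} := huniv ▸ mem_univ _
    rw [← hy']
    exact this
  have hsymm : ∀ x y, W.SamePlaque x y → W.SamePlaque y x := fun x y ⟨φ, hφ, hx, hy, h⟩ =>
    ⟨φ, hφ, hy, hx, h.symm⟩
  -- Chain joinedness is not visibly symmetric, so both directions are carried through the
  -- induction.
  have hboth : ∀ x y, Relation.EqvGen W.SamePlaque x y →
      IsChainJoined S x y ∧ IsChainJoined S y x := by
    intro x y h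
    induction h with
    | rel x y h => exact ⟨hplaque _ _ h, hplaque _ _ (hsymm _ _ h)⟩
    | refl x => exact ⟨IsChainJoined.refl x, IsChainJoined.refl x⟩
    | symm x y _ ih => exact ih.symm
    | trans x y z _ _ ih ih' => exact ⟨ih.1.trans ih'.1, ih'.2.trans ih.2⟩
  exact (hboth x z hz).1

end Chain

end PartialHyperbolicity

namespace PartialHyperbolicity

open Metric

set_option linter.unusedSectionVars false

/-! ### Center balls meet unstable laminations -/

open scoped ENNReal NNReal

variable {n : ℕ} {M : Type*} [TopologicalSpace M] [ChartedSpace (EuclideanSpace ℝ (Fin n)) M]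
  [IsManifold (𝓡 n) 1 M] [RiemannianBundle (fun x : M => TangentSpace (𝓡 n) x)]
  [IsContinuousRiemannianBundle (EuclideanSpace ℝ (Fin n)) (fun x : M => TangentSpace (𝓡 n) x)]
  {f : M ≃ₘ^1⟮𝓡 n, 𝓡 n⟯ M} {Es Ec Eu : Distribution n M} {dcs dcu : ℕ}
  {Wcs : Foliation n dcs M} {Wcu : Foliation n dcu M}

/-- A short center step followed by a jump along a forward contracted pair. -/
def CenterStep (f : M → M) (lam l : ℝ) (Wcs : Foliation n dcs M) (Wcu : Foliation n dcu M)
    (p q : M) : Prop :=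
  ∃ c ∈ centerBall Wcs Wcu l p, IsForwardClose (n := n) f lam c q

/-- All points are joined to all closed unstably saturated sets by chains of bounded length. -/
theorem exists_chain_length [CompactSpace M] [T2Space M]
    (hf : IsPartiallyHyperbolic f Es Ec Eu) (hdim : ∀ x, Module.finrank ℝ (Ec x) = 1)
    (hcoh : IsDynamicallyCoherent f Es Ec Eu Wcs Wcu) (hmin : Wcs.IsMinimal) {lam C l : ℝ}
    (hlam : 0 ≤ lam) (hC : 0 < C)
    (hst : ∀ (x : M) (m : ℕ), ∀ v ∈ Es x, ‖v‖ = 1 →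
      ‖mfderiv (𝓡 n) (𝓡 n) (f^[m]) x v‖ < C * lam ^ m) (hl : 0 < l) :
    ∃ N : ℕ, ∀ x : M, ∀ A : Set M, IsClosed A → (∀ x ∈ A, integralLeaf Eu x ⊆ A) → A.Nonempty →
      ∃ a ∈ A, Chain (CenterStep f lam l Wcs Wcu) N x a := by
  set S := CenterStep f lam l Wcs Wcu with hS
  have hstep : ∀ x₀ : M, ∀ φ ∈ Wcs.charts, x₀ ∈ φ.source → ∀ᶠ p : M × M in 𝓝 (x₀, x₀),
      (φ p.1).2 = (φ p.2).2 → S p.1 p.2 := fun x₀ φ hφ hx =>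
    eventually_exists_isForwardClose hf hdim hcoh hlam hC hst hφ hx hl
  have hrefl : ∀ p, S p p := by
    intro p
    obtain ⟨φ, hφ, hp⟩ := Wcs.cover p
    exact (hstep p φ hφ hp).self_of_nhds rfl
  -- The dense leaf of `x` visits points `z` close to `y`, so points near `x` reach points near `z`
  -- in `N` steps. If `A` passes near `y`, it meets the local center-stable plaque there, at the
  -- price of one more step.
  have hlocal : ∀ x y : M, ∃ N : ℕ, ∃ V ∈ 𝓝 y, ∀ᶠ x' in 𝓝 x, ∀ A : Set M, IsClosed A →
      (∀ x ∈ A, integralLeaf Eu x ⊆ A) → (A ∩ V).Nonempty → ∃ a ∈ A, Chain S N x' a := by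
    intro x y
    obtain ⟨φ, hφ, hy⟩ := Wcs.cover y
    have h := hstep y φ hφ hy
    rw [nhds_prod_eq, eventually_prod_self_iff'] at h
    obtain ⟨U, hU, hUS⟩ := h
    obtain ⟨V, hV, hVA⟩ := exists_nhds_forall_exists_mem hf hdim hcoh hφ hy hU
    obtain ⟨V', hV', hV'o, hyV'⟩ := mem_nhds_iff.1 (inter_mem hU hV)
    obtain ⟨z, hz, hzV'⟩ := (hmin x).exists_mem_open hV'o ⟨y, hyV'⟩
    obtain ⟨N, hN⟩ := Wcs.isChainJoined hstep hz
    refine ⟨N + 1, V, hV, ?_⟩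
    filter_upwards [hN V' (hV'o.mem_nhds hzV')] with x' hx' A hA hsat hAV
    obtain ⟨z', hz', hxz⟩ := hx'
    obtain ⟨a, ⟨haA, haU⟩, -, ha⟩ := hVA z' (hV' hz').2 A hA hsat hAV
    exact ⟨a, haA, hxz.trans ⟨a, hUS z' (hV' hz').1 a haU ha.symm, rfl⟩⟩
  -- Compactness is used on pairs, the second entry being any point of `A`. This makes `N`
  -- independent of both the starting point and the set. Chains of different lengths are padded by
  -- trivial steps.
  have hcompact : ∃ N : ℕ, ∀ p ∈ (univ : Set (M × M)), ∀ A : Set M, IsClosed A →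
      (∀ x ∈ A, integralLeaf Eu x ⊆ A) → p.2 ∈ A → ∃ a ∈ A, Chain S N p.1 a := by
    refine isCompact_univ.induction_on (p := fun T : Set (M × M) => ∃ N : ℕ, ∀ p ∈ T,
      ∀ A : Set M, IsClosed A → (∀ x ∈ A, integralLeaf Eu x ⊆ A) → p.2 ∈ A →
        ∃ a ∈ A, Chain S N p.1 a) ⟨0, fun p hp => hp.elim⟩ ?_ ?_ ?_
    · rintro T T' hTT' ⟨N, hN⟩
      exact ⟨N, fun p hp => hN p (hTT' hp)⟩
    · rintro T T' ⟨N, hN⟩ ⟨N', hN'⟩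
      refine ⟨max N N', fun p hp A hA hsat hpA => ?_⟩
      rcases hp with hp | hp
      · obtain ⟨a, ha, hc⟩ := hN p hp A hA hsat hpA
        exact ⟨a, ha, hc.of_le hrefl (le_max_left _ _)⟩
      · obtain ⟨a, ha, hc⟩ := hN' p hp A hA hsat hpA
        exact ⟨a, ha, hc.of_le hrefl (le_max_right _ _)⟩
    · rintro ⟨x, y⟩ -
      obtain ⟨N, V, hV, hN⟩ := hlocal x y
      refine ⟨_, mem_nhdsWithin_of_mem_nhds (prod_mem_nhds hN hV), N, ?_⟩
      rintro ⟨x', y'⟩ ⟨hx', hy'⟩ A hA hsat hyA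
      exact hx' A hA hsat ⟨y', hyA, hy'⟩
  obtain ⟨N, hN⟩ := hcompact
  exact ⟨N, fun x A hA hsat ⟨y, hy⟩ => hN (x, y) (mem_univ _) A hA hsat hy⟩

/-- The limits of the images `f^k` of chains of length `N` are joined by center curves. -/
theorem exists_forall_chain_limit [CompactSpace M] [T2Space M]
    (hf : IsPartiallyHyperbolic f Es Ec Eu) (hdim : ∀ x, Module.finrank ℝ (Ec x) = 1)
    (hcoh : IsDynamicallyCoherent f Es Ec Eu Wcs Wcu) {lam l L₀ : ℝ} (hlam : lam ∈ Ioo (0 : ℝ) 1)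
    (hqi : ∀ (x : M) (m : ℕ), f^[m] '' centerBall Wcs Wcu l x ⊆ centerBall Wcs Wcu L₀ (f^[m] x))
    (N : ℕ) :
    ∃ L > (0 : ℝ), ∀ (F : Ultrafilter ℕ) (p q : ℕ → M) (x y : M), (F : Filter ℕ) ≤ atTop →
      (∀ k, Chain (CenterStep f lam l Wcs Wcu) N (p k) (q k)) →
      Tendsto (fun k => f^[k] (p k)) F (𝓝 x) → Tendsto (fun k => f^[k] (q k)) F (𝓝 y) →
      y ∈ centerBall Wcs Wcu L x := by
  induction N with
  | zero =>
    refine ⟨1, one_pos, fun F p q x y _ hc hp hq => ?_⟩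
    have : p = q := funext hc
    subst this
    rw [tendsto_nhds_unique hq hp]
    obtain ⟨φs, hφs, hs⟩ := Wcs.cover x
    obtain ⟨φu, hφu, hu⟩ := Wcu.cover x
    exact (eventually_mem_centerBall hf hdim hcoh hφs hφu hs hu one_pos).self_of_nhds rfl rfl
  | succ N ih =>
    obtain ⟨L, hL, ih⟩ := ih
    obtain ⟨L₁, hL₁, hlim⟩ := exists_forall_tendsto_mem_centerBall hf hdim hcoh L₀
    refine ⟨L₁ + L, by positivity, fun F p q x y hF hc hp hq => ?_⟩
    choose r hr hrq using hc
    choose c hcp hcr using hr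
    obtain ⟨z, hz⟩ : ∃ z, Tendsto (fun k => f^[k] (r k)) F (𝓝 z) := by
      obtain ⟨z, -, hz⟩ := isCompact_univ.ultrafilter_le_nhds (F.map fun k => f^[k] (r k))
        (by simp)
      exact ⟨z, hz⟩
    -- The first step of the `k`-th chain goes from `p k` to `c k` in the center leaf and then jumps
    -- to `r k`. At time `k` the jump has size at most `lam ^ k`, so the images of `c k` and `r k`
    -- have the same limit `z`.
    refine mem_centerBall_trans (hlim F (fun k => f^[k] (p k)) (fun k => f^[k] (c k)) x z
      (fun k => hqi _ k ⟨_, hcp k, rfl⟩) hp ?_) (ih F r q z y hF hrq hz hq)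
    let _ := PseudoEMetricSpace.ofRiemannianMetric (𝓡 n) M
    have h0 : Tendsto (fun k : ℕ => ENNReal.ofReal (lam ^ k)) F (𝓝 0) := by
      have := (ENNReal.continuous_ofReal.tendsto 0).comp
        (tendsto_pow_atTop_nhds_zero_of_lt_one hlam.1.le hlam.2)
      rw [ENNReal.ofReal_zero] at this
      exact this.mono_left hF
    have h1 : Tendsto (fun k : ℕ => edist (f^[k] (r k)) z) F (𝓝 0) := by
      have : Tendsto (fun k => edist (f^[k] (r k)) z) F (𝓝 (edist z z)) :=
        hz.edist tendsto_const_nhds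
      rwa [edist_self] at this
    rw [tendsto_iff_edist_tendsto_0]
    have h2 := h0.add h1
    rw [add_zero] at h2
    refine tendsto_of_tendsto_of_tendsto_of_le_of_le tendsto_const_nhds h2
      (fun _ => zero_le) fun k => ?_
    refine (edist_triangle _ (f^[k] (r k)) _).trans (add_le_add ?_ le_rfl)
    exact hcr k k

/-- Iterates send curves tangent to `E^u` to curves tangent to `E^u`, hence unstable leaves into
unstable leaves. -/
theorem IsPartiallyHyperbolic.preimage_saturated (hf : IsPartiallyHyperbolic f Es Ec Eu)
    {A : Set M} (hA : ∀ x ∈ A, integralLeaf Eu x ⊆ A) (k : ℕ) :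
    ∀ x ∈ f^[k] ⁻¹' A, integralLeaf Eu x ⊆ f^[k] ⁻¹' A := by
  have himage : ∀ k : ℕ, ∀ x, ∀ y ∈ integralLeaf Eu x, f^[k] y ∈ integralLeaf Eu (f^[k] x) := by
    intro k
    induction k with
    | zero => exact fun x y hy => hy
    | succ k ih =>
      intro x y hy
      exact ih _ _ (integralLeaf_image f.contMDiff_toFun (fun x => (hf.invariant_u x).le) hy)
  exact fun x hx y hy => hA _ hx (himage k x y hy)

/-- Chains of the same length `N` join `f^{-k}(x)` to `f^{-k}(A)` for every `k`. Their images under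
`f^k` start at `x` and end in `A`, and an ultrafilter limit turns them into a center path of bounded
length. -/
theorem exists_forall_centerBall_inter_nonempty [CompactSpace M] [T2Space M]
    (hf : IsPartiallyHyperbolic f Es Ec Eu) (hdim : ∀ x, Module.finrank ℝ (Ec x) = 1)
    (hcoh : IsDynamicallyCoherent f Es Ec Eu Wcs Wcu) (hmin : Wcs.IsMinimal)
    (hqi : ActsQuasiIsometricallyInFuture Wcs Wcu f) :
    ∃ L > (0 : ℝ), ∀ A : Set M, IsClosed A → (∀ x ∈ A, integralLeaf Eu x ⊆ A) → A.Nonempty →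
      ∀ x : M, (centerBall Wcs Wcu L x ∩ A).Nonempty := by
  obtain ⟨l, hl, L₀, -, hqi⟩ := hqi
  obtain ⟨lam, hlam, C, hC, hst⟩ := hf.hyperbolic
  obtain ⟨N, hN⟩ := exists_chain_length hf hdim hcoh hmin hlam.1.le hC
    (fun x m => (hst x m).1) hl
  obtain ⟨L, hL, hlim⟩ := exists_forall_chain_limit hf hdim hcoh hlam hqi N
  refine ⟨L, hL, fun A hA hsat hne x => ?_⟩
  have hpre : ∀ k : ℕ, ∃ a ∈ f^[k] ⁻¹' A,
      Chain (CenterStep f lam l Wcs Wcu) N (f.symm^[k] x) a := by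
    intro k
    refine hN _ _ (hA.preimage (f.continuous.iterate k)) (hf.preimage_saturated hsat k) ?_
    obtain ⟨a, ha⟩ := hne
    obtain ⟨b, rfl⟩ := f.surjective.iterate k a
    exact ⟨b, ha⟩
  choose a haA ha using hpre
  obtain ⟨y, hyA, hy⟩ := hA.isCompact.ultrafilter_le_nhds
    ((hyperfilter ℕ).map fun k => f^[k] (a k)) (by
      rw [Filter.le_principal_iff]
      exact Filter.univ_mem' (f := (hyperfilter ℕ : Filter ℕ)) haA)
  refine ⟨y, hlim (hyperfilter ℕ) (fun k => f.symm^[k] x) a x y ?_ ha ?_ hy, hyA⟩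
  · exact Nat.hyperfilter_le_atTop
  · have : ∀ k : ℕ, f^[k] (f.symm^[k] x) = x := fun k =>
      (Function.LeftInverse.iterate (g := f) (f := f.symm) f.apply_symm_apply k) x
    simp only [this]
    exact tendsto_const_nhds

end PartialHyperbolicity
end

/-! ### Minimal unstable laminations meet all center balls of a fixed radius. -/

theorem proposition1 {n : ℕ} {M : Type*} [TopologicalSpace M] [T2Space M] [CompactSpace M]
    [ChartedSpace (EuclideanSpace ℝ (Fin n)) M] [IsManifold (𝓡 n) ∞ M]
    [Bundle.RiemannianBundle (fun x : M => TangentSpace (𝓡 n) x)]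
    [IsContMDiffRiemannianBundle (𝓡 n) ∞ (EuclideanSpace ℝ (Fin n))
      (fun x : M => TangentSpace (𝓡 n) x)]
    (f : M ≃ₘ^1⟮𝓡 n, 𝓡 n⟯ M)
    (Es Ec Eu : PartialHyperbolicity.Distribution n M)
    (hf : PartialHyperbolicity.IsPartiallyHyperbolic f Es Ec Eu)
    (hdim : ∀ x, Module.finrank ℝ (Ec x) = 1)
    {dcs dcu : ℕ}
    (Wcs : PartialHyperbolicity.Foliation n dcs M) (Wcu : PartialHyperbolicity.Foliation n dcu M)
    (hcoh : PartialHyperbolicity.IsDynamicallyCoherent f Es Ec Eu Wcs Wcu)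
    (hmin : Wcs.IsMinimal)
    (hqi : PartialHyperbolicity.ActsQuasiIsometricallyInFuture Wcs Wcu f) :
    ∃ L > (0 : ℝ), ∀ A : Set M, PartialHyperbolicity.IsMinimalUnstableLamination Eu A →
      (∀ x : M, (PartialHyperbolicity.centerBall Wcs Wcu L x ∩ A).Nonempty) ∧
      (∀ x : M, (PartialHyperbolicity.centerLeaf Wcs Wcu x ∩ A).Nonempty) := by
  have : IsContinuousRiemannianBundle (EuclideanSpace ℝ (Fin n))
      (fun x : M => TangentSpace (𝓡 n) x) := by
    obtain ⟨g, hg, hg'⟩ := IsContMDiffRiemannianBundle.exists_contMDiff (IB := 𝓡 n) (n := ∞)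
      (F := EuclideanSpace ℝ (Fin n)) (E := fun x : M => TangentSpace (𝓡 n) x)
    exact ⟨g, hg.continuous, hg'⟩
  obtain ⟨L, hL, h⟩ :=
    PartialHyperbolicity.exists_forall_centerBall_inter_nonempty hf hdim hcoh hmin hqi
  refine ⟨L, hL, fun A hA => ?_⟩
  have hAL := h A hA.isCompact.isClosed hA.saturated hA.nonempty
  refine ⟨hAL, fun x => ?_⟩
  obtain ⟨y, hy, hyA⟩ := hAL x
  exact ⟨y, PartialHyperbolicity.mem_centerLeaf_of_mem_centerBall hy, hyA⟩
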